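/- Let $T>0$, $\alpha>\frac13$, and $\frac13<\kappa<\alpha$ with $\kappa\le\frac12$. Let $\zeta:[0,T]\to\mathbb R^d$ be $\alpha$-Hölder with $\zeta_0=0$, and let $\zeta^2:\{0\le s\le t\le T\}\to\mathbb R^{d\times d}$ satisfy $|\zeta^2_{st}|\le C|t-s|^{2\alpha}$, $\zeta^{2;ij}_{st}-\zeta^{2;ij}_{su}-\zeta^{2;ij}_{ut}=(\zeta^i_u-\zeta^i_s)(\zeta^j_t-\zeta^j_u)$ and $\zeta^{2;ij}_{st}+\zeta^{2;ji}_{st}=(\zeta^i_t-\zeta^i_s)(\zeta^j_t-\zeta^j_s)$ (a geometric rough path). Let $U\subset\mathbb R^k$, let $\mathcal P(U)$ be the set of Borel probability measures on $U$, let $\mathcal K\subset\mathcal P(U)$ be weakly compact, and let $W_2$ be the (possibly infinite) 2-Wasserstein distance. Assume: (a) $b\in\mathcal C_b^{0,1,1}([0,T]\times\mathbb R^m\times U;\mathbb R^m)$ is uniformly continuous in time (uniformly in the other variables) and Lipschitz in space uniformly in time and control; (b) $\sigma\in\mathcal C_b^{1,3}([0,T]\times\mathbb R^m;\mathbb R^{m\times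 d})$, that is, $\sigma$, $\partial_t\sigma$ and the space derivatives of $\sigma$ of order $1,2,3$ exist and are bounded and continuous; (c) $\gamma:[0,T]\to\mathcal K$ satisfies $W_2(\gamma_s,\gamma_t)\le L|t-s|^\varepsilon$ for some $\varepsilon,L>0$; moreover $\mu\in\mathcal P(U)$, $t_0\in[0,T)$ and $y\in\mathbb R^m$; (d) $F\in\mathcal C_b^{0,1,0}([0,T]\times\mathbb R^m\times(\mathcal K\cup\{\mu\});\mathbb R)$, that is, $F$ and its space gradient $DF$ are bounded and jointly continuous, where $\mathcal K\cup\{\mu\}$ carries $W_2$; and $G\in\mathcal C_b^1(\mathbb R^m;\mathbb R)$. For a control $\eta$, a solution on $[t_0,T]$ of $$x_t=y+\int_{t_0}^t\int_U b(r,x_r,a)\,\eta_r(da)\,dr+\int_{t_0}^t\sigma(r,x_r)\,d\zeta_r$$ is a path $x$ that is weakly controlled by $\zeta$ with exponent $\kappa$ and derivative $\sigma(\cdot,x)$ (that is, $x$ and $\sigma(\cdot,x)$ are $\kappa$-Hölder and $x_v-x_u-\sigma(u,x_u)(\zeta_v-\zeta_u)=O(|v-u|^{2\kappa})$), and that satisfies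 the equation, the last integral being the rough integral of $\sigma(\cdot,x)$ with controlled derivative $D\sigma(\cdot,x)\sigma(\cdot,x)$. For $0<\beta\le T-t_0$ let $\hat\gamma^\beta$ equal $\mu$ on $[t_0,t_0+\beta]$ and $\gamma$ elsewhere. Then the equation has a unique solution $x^\gamma$ for $\eta=\gamma$ and a unique solution $\hat x^\beta$ for $\eta=\hat\gamma^\beta$, for every $0<\beta\le T-t_0$; the right derivative at $\beta=0$ $$\widehat V^0_t=\lim_{\beta\downarrow0}\frac{\hat x^\beta_t-x^\gamma_t}{\beta}$$ exists for every $t\in(t_0,T]$; and with $$J_{t_0,T}(y;\gamma)=\int_{t_0}^TF(s,x^\gamma_s,\gamma_s)\,ds+G(x^\gamma_T),$$ $$Q_\beta(t_0,y,\mu;\gamma)=\int_{t_0}^{t_0+\beta}F(s,\hat x^\beta_s,\mu)\,ds+\int_{t_0+\beta}^TF(s,\hat x^\beta_s,\gamma_s)\,ds+G(\hat x^\beta_T),$$ $$q(t_0,y,\mu;\gamma)=F(t_0,y,\mu)-F(t_0,y,\gamma_{t_0})+\int_{t_0}^TDF(s,x^\gamma_s,\gamma_s)\widehat V^0_s\,ds+DG(x^\gamma_T)\widehat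 V^0_T,$$ all the integrals of $F$ and $DF$ being of integrable functions, one has $$\lim_{\beta\downarrow0}\frac{Q_\beta(t_0,y,\mu;\gamma)-J_{t_0,T}(y;\gamma)}{\beta}=q(t_0,y,\mu;\gamma).$$ -/

import Mathlib

open MeasureTheory Set Filter Topology
open scoped ENNReal

noncomputable section

namespace RoughControl

/-- `ℝⁿ` with its Euclidean norm. -/
abbrev E (n : ℕ) : Type := EuclideanSpace ℝ (Fin n)

/-- `f` is `κ`-Hölder continuous on `[a,b]`. -/
def HolderOn {V : Type*} [NormedAddCommGroup V] (κ : ℝ) (f : ℝ → V) (a b : ℝ) : Prop :=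
  ∃ C : ℝ, ∀ u v : ℝ, a ≤ u → u ≤ v → v ≤ b → ‖f v - f u‖ ≤ C * (v - u) ^ κ

/-- `(ζ, ζ2)` is a geometric `α`-Hölder rough path on `[0,T]` in `ℝᵈ` started at `0`:
`ζ` is `α`-Hölder and `ζ2` is a two-parameter map of order `2α` on the simplex with
`δζ2_{sut}^{ij} = δζ_{su}^i δζ_{ut}^j` and `ζ2_{st}^{ij} + ζ2_{st}^{ji} = δζ_{st}^i δζ_{st}^j`.
Informally `ζ2_{st}^{ij} = ∫_s^t (ζ_r^i - ζ_s^i) dζ_r^j`. -/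
structure IsGeometricRoughPath {d : ℕ} (α T : ℝ) (ζ : ℝ → E d)
    (ζ2 : ℝ → ℝ → Matrix (Fin d) (Fin d) ℝ) : Prop where
  zero : ζ 0 = 0
  holder : HolderOn α ζ 0 T
  area_holder : ∃ C : ℝ, ∀ s t : ℝ, 0 ≤ s → s ≤ t → t ≤ T →
    ∀ i j, |ζ2 s t i j| ≤ C * (t - s) ^ (2 * α)
  chen : ∀ s u t : ℝ, 0 ≤ s → s ≤ u → u ≤ t → t ≤ T → ∀ i j,
    ζ2 s t i j - ζ2 s u i j - ζ2 u t i j = (ζ u i - ζ s i) * (ζ t j - ζ u j)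
  geometric : ∀ s t : ℝ, 0 ≤ s → s ≤ t → t ≤ T → ∀ i j,
    ζ2 s t i j + ζ2 s t j i = (ζ t i - ζ s i) * (ζ t j - ζ s j)

/-- The pair `(z, z')` is a path on `[a,b]` weakly controlled by `ζ` with exponent `κ`:
`z` and `z'` are `κ`-Hölder and `δz_{uv} - z'_u δζ_{uv}` is of order `2κ`. -/
structure IsControlled {d : ℕ} {V : Type*} [NormedAddCommGroup V] [NormedSpace ℝ V]
    (κ : ℝ) (ζ : ℝ → E d) (z : ℝ → V) (z' : ℝ → E d →L[ℝ] V) (a b : ℝ) : Prop where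
  holder : HolderOn κ z a b
  holder_deriv : HolderOn κ z' a b
  remainder : ∃ C : ℝ, ∀ u v : ℝ, a ≤ u → u ≤ v → v ≤ b →
    ‖z v - z u - z' u (ζ v - ζ u)‖ ≤ C * (v - u) ^ (2 * κ)

/-- The contraction `∑_{i,i₁} μ'^{i i₁} A^{i₁ i}` of a second order coefficient
with a `d × d` matrix. The first argument of `μ'` is the direction of differentiation `i₁`,
the second one the direction of integration `i`. -/
def contract {d : ℕ} {V : Type*} [NormedAddCommGroup V] [NormedSpace ℝ V]
    (μ' : E d →L[ℝ] E d →L[ℝ] V) (A : Matrix (Fin d) (Fin d) ℝ) : V :=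
  ∑ i : Fin d, ∑ i₁ : Fin d,
    A i₁ i • μ' (EuclideanSpace.single i₁ 1) (EuclideanSpace.single i 1)

/-- `z_t = ∫_a^t μ_r dζ_r` for all `t ∈ [a,b]`, in the rough sense, for an integrand `μ` with
controlled derivative `μ'`: the increments of `z` are
`μ_u δζ_{uv} + μ'_u ζ2_{uv}` plus a remainder of order `3κ`. When `(μ, μ')` is a
`κ`-controlled path and `3κ > 1` the remainder is the image under the sewing map of
minus the coboundary of the first two terms, and `z` is the limit of the compensated
Riemann sums; `z` is unique as soon as `3κ > 1`. -/
def IsRoughIntegral {d : ℕ} {V : Type*} [NormedAddCommGroup V] [NormedSpace ℝ V]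
    (κ : ℝ) (ζ : ℝ → E d) (ζ2 : ℝ → ℝ → Matrix (Fin d) (Fin d) ℝ)
    (μ : ℝ → E d →L[ℝ] V) (μ' : ℝ → E d →L[ℝ] E d →L[ℝ] V) (a b : ℝ) (z : ℝ → V) : Prop :=
  z a = 0 ∧ ∃ C : ℝ, ∀ u v : ℝ, a ≤ u → u ≤ v → v ≤ b →
    ‖z v - z u - μ u (ζ v - ζ u) - contract (μ' u) (ζ2 u v)‖ ≤ C * (v - u) ^ (3 * κ)

/-- The 2-Wasserstein distance (possibly infinite) between two probability measures:
the infimum of `(∫∫ d(x,y)² dπ(x,y))^{1/2}` over all couplings `π`. -/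
def W2 {X : Type*} [PseudoEMetricSpace X] [MeasurableSpace X]
    (ν₁ ν₂ : ProbabilityMeasure X) : ℝ≥0∞ :=
  ⨅ (π : Measure (X × X)) (_ : π.map Prod.fst = (ν₁ : Measure X) ∧
      π.map Prod.snd = (ν₂ : Measure X)),
    (∫⁻ p, edist p.1 p.2 ^ 2 ∂π) ^ (1 / 2 : ℝ)

/-- The class `𝒱^{ε,L}` of relaxed controls on `[0,T]`: paths with values in `K`
that are `ε`-Hölder with constant `L` for `W2`. -/
def IsRelaxedControl {X : Type*} [PseudoEMetricSpace X] [MeasurableSpace X]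
    (T ε L : ℝ) (K : Set (ProbabilityMeasure X)) (γ : ℝ → ProbabilityMeasure X) : Prop :=
  (∀ s ∈ Icc 0 T, γ s ∈ K) ∧
    ∀ s ∈ Icc 0 T, ∀ t ∈ Icc 0 T, W2 (γ s) (γ t) ≤ ENNReal.ofReal (L * |t - s| ^ ε)

/-- The spike variation of `γ`: equal to `μ` on `[t₀, t₀ + β]` and to `γ` elsewhere. -/
def spike {X : Type*} [MeasurableSpace X] (γ : ℝ → ProbabilityMeasure X)
    (μ : ProbabilityMeasure X) (t₀ β : ℝ) : ℝ → ProbabilityMeasure X :=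
  open Classical in fun t => if t ∈ Icc t₀ (t₀ + β) then μ else γ t

/-- `b ∈ 𝒞_b^{0,1,1}([0,T] × ℝᵐ × U; ℝᵐ)`, with `b` uniformly continuous in time, uniformly in
the other variables, and Lipschitz in space, uniformly in time and control. The derivative in
`a ∈ U` is taken relative to `U`. -/
structure IsDrift {m k : ℕ} (T : ℝ) (U : Set (E k)) (b : ℝ → E m → E k → E m) : Prop where
  continuousOn : ContinuousOn (fun p : ℝ × E m × E k => b p.1 p.2.1 p.2.2)
    (Icc 0 T ×ˢ (univ ×ˢ U))
  bounded : ∃ M : ℝ, ∀ t ∈ Icc 0 T, ∀ x, ∀ a ∈ U, ‖b t x a‖ ≤ M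
  differentiable_space : ∀ t ∈ Icc 0 T, ∀ a ∈ U, Differentiable ℝ (fun x => b t x a)
  continuousOn_space : ContinuousOn
    (fun p : ℝ × E m × E k => fderiv ℝ (fun x => b p.1 x p.2.2) p.2.1) (Icc 0 T ×ˢ (univ ×ˢ U))
  bounded_space : ∃ M : ℝ, ∀ t ∈ Icc 0 T, ∀ x, ∀ a ∈ U, ‖fderiv ℝ (fun x => b t x a) x‖ ≤ M
  deriv_control : ∃ Da : ℝ × E m × E k → E k →L[ℝ] E m,
    (∀ t ∈ Icc 0 T, ∀ x, ∀ a ∈ U, HasFDerivWithinAt (b t x) (Da (t, x, a)) U a) ∧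
    ContinuousOn Da (Icc 0 T ×ˢ (univ ×ˢ U)) ∧
    ∃ M : ℝ, ∀ t ∈ Icc 0 T, ∀ x, ∀ a ∈ U, ‖Da (t, x, a)‖ ≤ M
  uniform_time : ∀ η > 0, ∃ δ > 0, ∀ s ∈ Icc 0 T, ∀ t ∈ Icc 0 T, |t - s| < δ →
    ∀ x, ∀ a ∈ U, ‖b t x a - b s x a‖ < η
  lipschitz_space : ∃ M : ℝ, ∀ t ∈ Icc 0 T, ∀ x x', ∀ a ∈ U,
    ‖b t x a - b t x' a‖ ≤ M * ‖x - x'‖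

/-- `σ ∈ 𝒞_b^{1,3}([0,T] × ℝᵐ; ℝ^{m,d})`: the function, its time derivative and its space
derivatives up to order three are continuous and bounded on `[0,T] × ℝᵐ`. -/
structure IsDiffusion {m d : ℕ} (T : ℝ) (σ : ℝ → E m → E d →L[ℝ] E m) : Prop where
  contDiff_space : ∀ t ∈ Icc 0 T, ContDiff ℝ 3 (σ t)
  continuousOn_space : ∀ j ≤ 3, ContinuousOn
    (fun p : ℝ × E m => iteratedFDeriv ℝ j (σ p.1) p.2) (Icc 0 T ×ˢ univ)
  bounded_space : ∀ j ≤ 3, ∃ M : ℝ, ∀ t ∈ Icc 0 T, ∀ x, ‖iteratedFDeriv ℝ j (σ t) x‖ ≤ M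
  deriv_time : ∃ Dt : ℝ × E m → E d →L[ℝ] E m,
    (∀ t ∈ Icc 0 T, ∀ x, HasDerivWithinAt (fun r => σ r x) (Dt (t, x)) (Icc 0 T) t) ∧
    ContinuousOn Dt (Icc 0 T ×ˢ univ) ∧
    ∃ M : ℝ, ∀ t ∈ Icc 0 T, ∀ x, ‖Dt (t, x)‖ ≤ M

/-- Joint continuity on `[0,T] × ℝᵐ × S`, where the set `S` of probability measures is
endowed with the distance `W2`. -/
def ContinuousW2 {m : ℕ} {X V : Type*} [PseudoEMetricSpace X] [MeasurableSpace X]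
    [NormedAddCommGroup V] (T : ℝ) (S : Set (ProbabilityMeasure X))
    (Φ : ℝ → E m → ProbabilityMeasure X → V) : Prop :=
  ∀ t ∈ Icc 0 T, ∀ x, ∀ ν ∈ S, ∀ η > 0, ∃ δ > 0,
    ∀ t' ∈ Icc 0 T, ∀ x', ∀ ν' ∈ S, |t' - t| < δ → ‖x' - x‖ < δ → W2 ν ν' < ENNReal.ofReal δ →
      ‖Φ t' x' ν' - Φ t x ν‖ < η

/-- `F ∈ 𝒞_b^{0,1,0}([0,T] × ℝᵐ × S)`: `F` and its gradient in the space variable are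
bounded and jointly continuous. -/
structure IsRunningReward {m : ℕ} {X : Type*} [PseudoEMetricSpace X] [MeasurableSpace X]
    (T : ℝ) (S : Set (ProbabilityMeasure X)) (F : ℝ → E m → ProbabilityMeasure X → ℝ) :
    Prop where
  continuous : ContinuousW2 T S F
  bounded : ∃ M : ℝ, ∀ t ∈ Icc 0 T, ∀ x, ∀ ν ∈ S, |F t x ν| ≤ M
  differentiable_space : ∀ t ∈ Icc 0 T, ∀ ν ∈ S, Differentiable ℝ (fun x => F t x ν)
  continuous_space : ContinuousW2 T S (fun t x ν => fderiv ℝ (fun x' => F t x' ν) x)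
  bounded_space : ∃ M : ℝ, ∀ t ∈ Icc 0 T, ∀ x, ∀ ν ∈ S, ‖fderiv ℝ (fun x' => F t x' ν) x‖ ≤ M

/-- `G ∈ 𝒞_b^1(ℝᵐ)`. -/
structure IsTerminalReward {m : ℕ} (G : E m → ℝ) : Prop where
  contDiff : ContDiff ℝ 1 G
  bounded : ∃ M : ℝ, ∀ x, |G x| ≤ M
  bounded_deriv : ∃ M : ℝ, ∀ x, ‖fderiv ℝ G x‖ ≤ M

/-- The relaxed drift `∫_U b(r, x, a) ν(da)`. -/
def relaxedDrift {m k : ℕ} {U : Set (E k)} (b : ℝ → E m → E k → E m) (r : ℝ) (x : E m)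
    (ν : ProbabilityMeasure U) : E m :=
  ∫ a : U, b r x a ∂(ν : Measure U)

/-- `x` solves on `[s,T]` the rough differential equation
`x_t = y + ∫_s^t ∫_U b(r, x_r, a) γ_r(da) dr + ∫_s^t σ(r, x_r) dζ_r`
in the space of weakly controlled paths of exponent `κ`. The controlled derivative of `x` is
`σ(r, x_r)`, hence that of the integrand `σ(r, x_r)` is `Dσ(r, x_r) σ(r, x_r)`. -/
structure IsRDESolution {m d k : ℕ} {U : Set (E k)} (κ T : ℝ) (ζ : ℝ → E d)
    (ζ2 : ℝ → ℝ → Matrix (Fin d) (Fin d) ℝ) (b : ℝ → E m → E k → E m)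
    (σ : ℝ → E m → E d →L[ℝ] E m) (γ : ℝ → ProbabilityMeasure U) (s : ℝ) (y : E m)
    (x : ℝ → E m) : Prop where
  controlled : IsControlled κ ζ x (fun r => σ r (x r)) s T
  integrable : IntervalIntegrable (fun r => relaxedDrift b r (x r) (γ r)) volume s T
  equation : ∃ z : ℝ → E m,
    IsRoughIntegral κ ζ ζ2 (fun r => σ r (x r))
      (fun r => (fderiv ℝ (σ r) (x r)).comp (σ r (x r))) s T z ∧
    ∀ t ∈ Icc s T, x t = y + (∫ r in s..t, relaxedDrift b r (x r) (γ r)) + z t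

/-- `x` is a solution on `[s,T]`, and every solution agrees with it on `[s,T]`. -/
def IsUniqueRDESolution {m d k : ℕ} {U : Set (E k)} (κ T : ℝ) (ζ : ℝ → E d)
    (ζ2 : ℝ → ℝ → Matrix (Fin d) (Fin d) ℝ) (b : ℝ → E m → E k → E m)
    (σ : ℝ → E m → E d →L[ℝ] E m) (γ : ℝ → ProbabilityMeasure U) (s : ℝ) (y : E m)
    (x : ℝ → E m) : Prop :=
  IsRDESolution κ T ζ ζ2 b σ γ s y x ∧
    ∀ x' : ℝ → E m, IsRDESolution κ T ζ ζ2 b σ γ s y x' → EqOn x' x (Icc s T)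

/-- The reward `J_{s,T} = ∫_s^T F(r, x_r, γ_r) dr + G(x_T)` along a path `x` and a control `γ`. -/
def reward {m : ℕ} {X : Type*} [MeasurableSpace X] (T : ℝ)
    (F : ℝ → E m → ProbabilityMeasure X → ℝ) (G : E m → ℝ) (s : ℝ)
    (γ : ℝ → ProbabilityMeasure X) (x : ℝ → E m) : ℝ :=
  (∫ r in s..T, F r (x r) (γ r)) + G (x T)

/-- `Q_β = ∫_{t₀}^{t₀+β} F(s, x̂_s, μ) ds + ∫_{t₀+β}^T F(s, x̂_s, γ_s) ds + G(x̂_T)`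
along a path `x̂`. -/
def Qreward {m : ℕ} {X : Type*} [MeasurableSpace X] (T : ℝ)
    (F : ℝ → E m → ProbabilityMeasure X → ℝ) (G : E m → ℝ) (t₀ β : ℝ)
    (μ : ProbabilityMeasure X) (γ : ℝ → ProbabilityMeasure X) (xhat : ℝ → E m) : ℝ :=
  (∫ s in t₀..(t₀ + β), F s (xhat s) μ) + (∫ s in (t₀ + β)..T, F s (xhat s) (γ s)) + G (xhat T)

/-- The `q`-function
`F(t₀, y, μ) - F(t₀, y, γ_{t₀}) + ∫_{t₀}^T DF(s, x_s, γ_s) V_s ds + DG(x_T) V_T`. -/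
def qFunction {m : ℕ} {X : Type*} [MeasurableSpace X] (T : ℝ)
    (F : ℝ → E m → ProbabilityMeasure X → ℝ) (G : E m → ℝ) (t₀ : ℝ) (y : E m)
    (μ : ProbabilityMeasure X) (γ : ℝ → ProbabilityMeasure X) (x V : ℝ → E m) : ℝ :=
  F t₀ y μ - F t₀ y (γ t₀)
    + (∫ s in t₀..T, fderiv ℝ (fun x' => F s x' (γ s)) (x s) (V s)) + fderiv ℝ G (x T) (V T)

end RoughControl

end

open RoughControl

set_option linter.unusedSectionVars false

/-! The proof replaces the rough equation by a local expansion. With the germ `Γ u v x = σ(u,x) δζ +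
(Dσ σ)(u,x) ζ2`, a path is a solution exactly when its increments equal the drift integral plus the
germ up to order `3κ > 1`. This is `RDEBound`; `RDEBound.isRDESolution` and
`IsRDESolution.exists_rdeBound` translate in both directions.

All that is used of the rough part is collected in `IsGerm`: the size of `Γ`, its Lipschitz and
Taylor bounds, its coboundary, and differences of coboundaries. `IsDriver.exists_isGerm` proves
these from Chen's relation and the bounds on `σ`. No mixed time-space derivatives of `σ` are
assumed; the Hölder regularity in time of `Dσ` and `D²σ` comes from interpolation in
`exists_isRegular`.

The engine is `sewing_bound`: a two-parameter map of order `θ > 1` is controlled by its coboundary,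
even if the coboundary bound contains a small multiple of the unknown constant. Applied to the
difference of two solutions it yields uniqueness, Lipschitz dependence on the initial value, and the
estimate over a short time with two drifts. Existence comes from a discrete version of sewing for
the Euler scheme, followed by compactness. The constants depend only on the germ and on the bound of
the drift, so they are uniform in the spike width `β`.

For the derivative, the difference of the two states over the spike is the integral of the drift
difference plus `O(β^(κ+2/3)) = o(β)`. So at `t₀ + β` the difference quotient tends to the jump of
the drift. Later both states solve the same equation, and stability keeps the quotients bounded. The
linearised equation is never solved: quotients of steps `β' ≤ β` are compared with each other and
shown to be Cauchy. Linearising the germ costs `β l^κ` on length `l`, an order too low to be sewn;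
interpolation with a bound free of `β` turns it into a power of `β` times an order above `1`.
Linearising the drift, which has one continuous space derivative, has no rate but vanishes in `L¹`
of time by dominated convergence. These are `IsGerm.exists_quotient_diff_bound` and
`IsSpikeFamily.exists_tendsto_quot`.

The reward quotient splits into an average over the spike, an integral of difference quotients of
`F` handled by dominated convergence, and the chain rule for `G`; see `tendsto_reward_quotient`. -/

namespace RoughControl

/-! ### Power inequalities, bootstrapping and the sewing bound. -/

section Elementary

/-- A bound that improves itself affinely holds with the fixed point as its constant. -/
lemma le_mul_of_bootstrap {ι : Type*} {f w : ι → ℝ} (hw : ∀ i, 0 ≤ w i) {A q N₀ : ℝ}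
    (hA : 0 ≤ A) (hq0 : 0 ≤ q) (hq : q < 1) (h0 : ∀ i, f i ≤ N₀ * w i)
    (step : ∀ N, 0 ≤ N → (∀ i, f i ≤ N * w i) → ∀ i, f i ≤ (A + q * N) * w i) :
    ∀ i, f i ≤ A / (1 - q) * w i := by
  have hq' : 0 < 1 - q := by linarith
  -- `A / (1 - q)` is the fixed point of `N ↦ A + q N`, and the excess over it shrinks by `q` at
  -- each use of `step`. The truncation `max N₀ 0` keeps the constants nonnegative, as `step`
  -- requires.
  have key : ∀ k : ℕ, ∀ i, f i ≤ (A / (1 - q) + q ^ k * max N₀ 0) * w i := by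
    intro k
    induction k with
    | zero =>
      intro i
      refine (h0 i).trans (mul_le_mul_of_nonneg_right ?_ (hw i))
      have := div_nonneg hA hq'.le
      simp only [pow_zero, one_mul]
      linarith [le_max_left N₀ 0]
    | succ k ih =>
      intro i
      have h1 : 0 ≤ A / (1 - q) + q ^ k * max N₀ 0 :=
        add_nonneg (div_nonneg hA hq'.le) (mul_nonneg (pow_nonneg hq0 k) (le_max_right _ _))
      have h2 : A + q * (A / (1 - q) + q ^ k * max N₀ 0)
          = A / (1 - q) + q ^ (k + 1) * max N₀ 0 := by
        field_simp
        ring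
      simpa only [h2] using step _ h1 ih i
  intro i
  have hlim : Tendsto (fun k : ℕ => (A / (1 - q) + q ^ k * max N₀ 0) * w i) atTop
      (𝓝 ((A / (1 - q) + 0 * max N₀ 0) * w i)) :=
    (((tendsto_pow_atTop_nhds_zero_of_lt_one hq0 hq).mul_const _).const_add _).mul_const _
  rw [zero_mul, add_zero] at hlim
  exact ge_of_tendsto' hlim fun k => key k i

lemma rpow_le_rpow_of_le_one {l a b : ℝ} (hl : 0 ≤ l) (hl1 : l ≤ 1) (hb : 0 ≤ b) (hab : b ≤ a) :
    l ^ a ≤ l ^ b :=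
  Real.rpow_le_rpow_of_exponent_ge_of_imp hl hl1 hab fun _ h => by linarith

/-- `c τ^κ` can be made small. -/
lemma exists_mul_rpow_le {κ : ℝ} (hκ : 0 < κ) (c : ℝ) {η : ℝ} (hη : 0 < η) :
    ∃ τ : ℝ, 0 < τ ∧ τ ≤ 1 ∧ ∀ l, 0 ≤ l → l ≤ τ → c * l ^ κ ≤ η := by
  have h : Tendsto (fun τ : ℝ => |c| * τ ^ κ) (𝓝[>] 0) (𝓝 (|c| * 0)) := by
    refine Tendsto.const_mul _ ?_
    have := (Real.continuousAt_rpow_const 0 κ (Or.inr hκ.le)).tendsto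
    rw [Real.zero_rpow hκ.ne'] at this
    exact this.mono_left nhdsWithin_le_nhds
  rw [mul_zero] at h
  have h1 : ∀ᶠ τ : ℝ in 𝓝[>] 0, |c| * τ ^ κ < η := h.eventually (gt_mem_nhds hη)
  have h2 : ∀ᶠ τ : ℝ in 𝓝[>] 0, τ ∈ Ioc (0 : ℝ) 1 := Ioc_mem_nhdsGT one_pos
  obtain ⟨τ, ⟨h1, h2⟩⟩ := (h1.and h2).exists
  refine ⟨τ, h2.1, h2.2, fun l hl hlτ => ?_⟩
  calc c * l ^ κ ≤ |c| * τ ^ κ := by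
        gcongr
        exact le_abs_self c
    _ ≤ η := h1.le

/-- This is the factor by which a bound of exponent `θ` changes when an interval is split at its
midpoint; sewing works because it is a contraction. -/
lemma two_mul_half_rpow_lt_one {θ : ℝ} (hθ : 1 < θ) : 2 * (1 / 2 : ℝ) ^ θ < 1 := by
  have : (1 / 2 : ℝ) ^ θ < (1 / 2 : ℝ) ^ (1 : ℝ) :=
    Real.rpow_lt_rpow_of_exponent_gt (by norm_num) (by norm_num) hθ
  rw [Real.rpow_one] at this
  linarith

/-- A minimum is at most the geometric mean with weights `r` and `1 - r`. This buys a power of `β`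
at the price of a lower exponent of the length. -/
lemma min_le_interpolation {β l κ r : ℝ} (hβ : 0 < β) (hl : 0 ≤ l) (hκ : 0 < κ) (hr0 : 0 ≤ r)
    (hr1 : r ≤ 1) :
    min (β * l ^ κ) (l ^ (κ + 2 / 3)) ≤ β ^ r * l ^ (κ + 2 / 3 - 2 / 3 * r) := by
  have ha : 0 ≤ β * l ^ κ := by positivity
  have hb : 0 ≤ l ^ (κ + 2 / 3) := by positivity
  have hm : 0 ≤ min (β * l ^ κ) (l ^ (κ + 2 / 3)) := le_min ha hb
  calc min (β * l ^ κ) (l ^ (κ + 2 / 3))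
      = min (β * l ^ κ) (l ^ (κ + 2 / 3)) ^ r
          * min (β * l ^ κ) (l ^ (κ + 2 / 3)) ^ (1 - r) := by
        rw [← Real.rpow_add_of_nonneg hm hr0 (by linarith)]
        simp
    _ ≤ (β * l ^ κ) ^ r * (l ^ (κ + 2 / 3)) ^ (1 - r) := by
        have h1r : 0 ≤ 1 - r := by linarith
        gcongr
        · exact min_le_left _ _
        · exact min_le_right _ _
    _ = β ^ r * l ^ (κ + 2 / 3 - 2 / 3 * r) := by
        rw [Real.mul_rpow hβ.le (by positivity), ← Real.rpow_mul hl, ← Real.rpow_mul hl, mul_assoc,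
          ← Real.rpow_add_of_nonneg hl (by positivity) (mul_nonneg (by positivity) (by linarith))]
        congr 2
        ring

/-- Propagation of a bound over short windows. -/
lemma le_of_windows {f : ℝ → ℝ} {a b τ e : ℝ} (hτ : 0 < τ)
    (h : ∀ u v, a ≤ u → u ≤ v → v ≤ b → v - u ≤ τ → f v ≤ 2 * f u + e) (n : ℕ) :
    ∀ v, a ≤ v → v ≤ b → v - a ≤ n * τ → f a + e ≥ 0 → e ≥ 0 → f v ≤ 2 ^ n * (f a + e) := by
  -- The extra `- e` makes the recursion `c ↦ 2 c + e` close exactly.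
  suffices H : ∀ v, a ≤ v → v ≤ b → v - a ≤ n * τ → f a + e ≥ 0 → f v ≤ 2 ^ n * (f a + e) - e by
    intro v h1 h2 h3 h4 h5
    linarith [H v h1 h2 h3 h4]
  induction n with
  | zero =>
    intro v h1 h2 h3 _
    have : v = a := by
      simp only [Nat.cast_zero, zero_mul] at h3
      linarith
    subst this
    simp
  | succ n ih =>
    intro v h1 h2 h3 h4
    have hu1 : a ≤ max a (v - τ) := le_max_left _ _
    have hu2 : max a (v - τ) ≤ v := max_le h1 (by linarith)
    have hu3 : max a (v - τ) - a ≤ n * τ := by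
      push_cast at h3
      rw [sub_le_iff_le_add]
      refine max_le ?_ (by linarith)
      have : 0 ≤ (n : ℝ) * τ := by positivity
      linarith
    have h5 := ih _ hu1 (hu2.trans h2) hu3 h4
    have h6 := h _ v hu1 hu2 h2 (by linarith [le_max_right a (v - τ)])
    calc f v ≤ 2 * f (max a (v - τ)) + e := h6
      _ ≤ 2 * (2 ^ n * (f a + e) - e) + e := by linarith
      _ = _ := by ring

/-- A local bound of power type for a bounded quantity is global. -/
lemma exists_global_bound {V : Type*} [NormedAddCommGroup V] {g : ℝ → ℝ → V} {a b τ p K N : ℝ}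
    (hτ : 0 < τ) (hp : 0 ≤ p) (hK : 0 ≤ K) (hN : 0 ≤ N)
    (hloc : ∀ u v, a ≤ u → u ≤ v → v ≤ b → v - u ≤ τ → ‖g u v‖ ≤ K * (v - u) ^ p)
    (hbd : ∀ u v, a ≤ u → u ≤ v → v ≤ b → ‖g u v‖ ≤ N) :
    ∃ C : ℝ, ∀ u v, a ≤ u → u ≤ v → v ≤ b → ‖g u v‖ ≤ C * (v - u) ^ p := by
  have hτp : 0 < τ ^ p := Real.rpow_pos_of_pos hτ p
  refine ⟨K + N / τ ^ p, fun u v h1 h2 h3 => ?_⟩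
  have h0 : 0 ≤ v - u := by linarith
  have hNτ : 0 ≤ N / τ ^ p := div_nonneg hN hτp.le
  have hp0 : 0 ≤ (v - u) ^ p := by positivity
  rcases le_total (v - u) τ with h | h
  · calc ‖g u v‖ ≤ K * (v - u) ^ p := hloc u v h1 h2 h3 h
      _ ≤ _ := by
        gcongr
        linarith
  · calc ‖g u v‖ ≤ N := hbd u v h1 h2 h3
      _ = N / τ ^ p * τ ^ p := by field_simp
      _ ≤ N / τ ^ p * (v - u) ^ p := by gcongr
      _ ≤ _ := by
        gcongr
        linarith

variable {V : Type*} [NormedAddCommGroup V]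

/-- Bound of a two-parameter map by its coboundary. -/
lemma sewing_bound {P : ℝ → ℝ → V} {a b θ A N₀ : ℝ} (hθ : 1 < θ) (hA : 0 ≤ A)
    (hfin : ∀ s t, a ≤ s → s ≤ t → t ≤ b → ‖P s t‖ ≤ N₀ * (t - s) ^ θ)
    (hstep : ∀ N, 0 ≤ N → (∀ s t, a ≤ s → s ≤ t → t ≤ b → ‖P s t‖ ≤ N * (t - s) ^ θ) →
      ∀ s u t, a ≤ s → s ≤ u → u ≤ t → t ≤ b →
        ‖P s t - P s u - P u t‖ ≤ (A + (1 - 2 * (1 / 2 : ℝ) ^ θ) / 2 * N) * (t - s) ^ θ) :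
    ∀ s t, a ≤ s → s ≤ t → t ≤ b →
      ‖P s t‖ ≤ 2 * A / (1 - 2 * (1 / 2 : ℝ) ^ θ) * (t - s) ^ θ := by
  set r : ℝ := 2 * (1 / 2 : ℝ) ^ θ with hr
  have hr1 : r < 1 := two_mul_half_rpow_lt_one hθ
  have hr0 : 0 ≤ r := by positivity
  let ι := {p : ℝ × ℝ // a ≤ p.1 ∧ p.1 ≤ p.2 ∧ p.2 ≤ b}
  -- The two halves contribute the factor `r` and the coboundary at most `(1 - r) / 2`, half of the
  -- remaining gap, so their sum stays below `1`.
  have key := le_mul_of_bootstrap (ι := ι) (f := fun i => ‖P i.1.1 i.1.2‖)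
    (w := fun i => (i.1.2 - i.1.1) ^ θ) (fun i => Real.rpow_nonneg (by linarith [i.2.2.1]) _)
    (A := A) (q := (1 - r) / 2 + r) (N₀ := N₀) hA (by linarith) (by linarith)
    (fun i => hfin _ _ i.2.1 i.2.2.1 i.2.2.2) ?_
  · intro s t h1 h2 h3
    have := key ⟨(s, t), h1, h2, h3⟩
    have h4 : A / (1 - ((1 - r) / 2 + r)) = 2 * A / (1 - r) := by
      have : (1 - r) ≠ 0 := by linarith
      have h5 : 1 - ((1 - r) / 2 + r) = (1 - r) / 2 := by ring
      rw [h5]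
      field_simp
    rw [h4] at this
    exact this
  · rintro N hN hNi ⟨⟨s, t⟩, h1, h2, h3⟩
    simp only at h1 h2 h3 ⊢
    have hN' : ∀ s t, a ≤ s → s ≤ t → t ≤ b → ‖P s t‖ ≤ N * (t - s) ^ θ :=
      fun s t h1 h2 h3 => hNi ⟨(s, t), h1, h2, h3⟩
    have hsu : s ≤ (s + t) / 2 := by linarith
    have hut : (s + t) / 2 ≤ t := by linarith
    have e1 := hN' s ((s + t) / 2) h1 hsu (hut.trans h3)
    have e2 := hN' ((s + t) / 2) t (h1.trans hsu) hut h3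
    have e3 := hstep N hN hN' s ((s + t) / 2) t h1 hsu hut h3
    have e4 : ((s + t) / 2 - s) ^ θ = (1 / 2 : ℝ) ^ θ * (t - s) ^ θ := by
      rw [← Real.mul_rpow (by norm_num) (by linarith)]
      congr 1
      ring
    have e5 : (t - (s + t) / 2) ^ θ = (1 / 2 : ℝ) ^ θ * (t - s) ^ θ := by
      rw [← Real.mul_rpow (by norm_num) (by linarith)]
      congr 1
      ring
    rw [e4] at e1
    rw [e5] at e2
    have e6 : ‖P s t‖ ≤ ‖P s t - P s ((s + t) / 2) - P ((s + t) / 2) t‖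
        + ‖P s ((s + t) / 2)‖ + ‖P ((s + t) / 2) t‖ := by
      have : P s t = (P s t - P s ((s + t) / 2) - P ((s + t) / 2) t)
        + P s ((s + t) / 2) + P ((s + t) / 2) t := by abel
      calc ‖P s t‖ = ‖(P s t - P s ((s + t) / 2) - P ((s + t) / 2) t)
            + P s ((s + t) / 2) + P ((s + t) / 2) t‖ := by rw [← this]
        _ ≤ _ := norm_add₃_le
    calc ‖P s t‖ ≤ _ := e6
      _ ≤ (A + (1 - r) / 2 * N) * (t - s) ^ θ + N * ((1 / 2 : ℝ) ^ θ * (t - s) ^ θ)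
          + N * ((1 / 2 : ℝ) ^ θ * (t - s) ^ θ) := by gcongr
      _ = (A + ((1 - r) / 2 + r) * N) * (t - s) ^ θ := by
        rw [hr]
        ring

end Elementary

/-! ### Germs and the remainders of differences of paths. -/

/-- A solution germ of order `κ`: an approximate flow `x ↦ x + Γ s t x` on `[0,T]` together with
its linearisation `Λ`, and the bounds on its coboundary and on differences of coboundaries. -/
structure IsGerm {V : Type*} [NormedAddCommGroup V] [NormedSpace ℝ V] (κ C T : ℝ)
    (Γ : ℝ → ℝ → V → V) (Λ : ℝ → ℝ → V → V → V) : Prop where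
  bound : ∀ s t, 0 ≤ s → s ≤ t → t ≤ T → ∀ x, ‖Γ s t x‖ ≤ C * (t - s) ^ κ
  lip : ∀ s t, 0 ≤ s → s ≤ t → t ≤ T → ∀ x x',
    ‖Γ s t x' - Γ s t x‖ ≤ C * (t - s) ^ κ * ‖x' - x‖
  taylor : ∀ s t, 0 ≤ s → s ≤ t → t ≤ T → ∀ x h,
    ‖Γ s t (x + h) - Γ s t x - Λ s t x h‖ ≤ C * (t - s) ^ κ * ‖h‖ ^ 2
  lin_sub : ∀ s t x h h', Λ s t x (h - h') = Λ s t x h - Λ s t x h'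
  lin_smul : ∀ s t x (c : ℝ) h, Λ s t x (c • h) = c • Λ s t x h
  lin_bound : ∀ s t, 0 ≤ s → s ≤ t → t ≤ T → ∀ x h, ‖Λ s t x h‖ ≤ C * (t - s) ^ κ * ‖h‖
  cob : ∀ s u t, 0 ≤ s → s ≤ u → u ≤ t → t ≤ T → t - s ≤ 1 → ∀ p q,
    ‖Γ s t p - Γ s u p - Γ u t q‖
      ≤ C * ((t - s) ^ (3 * κ) + ‖q - p - Γ s u p‖ * (t - s) ^ κ)
  cob_diff : ∀ s u t, 0 ≤ s → s ≤ u → u ≤ t → t ≤ T → t - s ≤ 1 → ∀ p q p' q',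
    ‖(Γ s t p' - Γ s t p) - (Γ s u p' - Γ s u p) - (Γ u t q' - Γ u t q)‖
      ≤ C * (t - s) ^ κ *
        (‖p' - p‖ * ((t - s) ^ (2 / 3 : ℝ) + ‖q - p - Γ s u p‖ + ‖q' - p' - Γ s u p'‖)
          + ‖q' - q‖ * (t - s) ^ (2 / 3 : ℝ)
          + ‖(q' - q) - (p' - p) - (Γ s u p' - Γ s u p)‖)
  cont : ∀ s t, 0 ≤ s → s < t → t ≤ T → ∀ x, ∀ a b : ℕ → ℝ, (∀ n, 0 ≤ a n) → (∀ n, a n ≤ s) →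
    (∀ n, b n ≤ t) → Tendsto a atTop (𝓝 s) → Tendsto b atTop (𝓝 t) →
    Tendsto (fun n => Γ (a n) (b n) x) atTop (𝓝 (Γ s t x))

section Germ

variable {V : Type*} [NormedAddCommGroup V] [NormedSpace ℝ V] {κ C T : ℝ}
  {Γ : ℝ → ℝ → V → V} {Λ : ℝ → ℝ → V → V → V}

/-- The Taylor error is quadratic in the increment, hence `O(r)` after division by `r`. Through this
limit, bounds on differences of `Γ` pass to `Λ`. -/
lemma IsGerm.tendsto_lin (hΓ : IsGerm κ C T Γ Λ) {s t : ℝ} (hs : 0 ≤ s) (hst : s ≤ t)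
    (ht : t ≤ T) (x h : V) :
    Tendsto (fun r : ℝ => r⁻¹ • (Γ s t (x + r • h) - Γ s t x)) (𝓝[>] 0) (𝓝 (Λ s t x h)) := by
  rw [tendsto_iff_norm_sub_tendsto_zero]
  have hlim : Tendsto (fun r : ℝ => C * (t - s) ^ κ * ‖h‖ ^ 2 * r) (𝓝[>] 0)
      (𝓝 (C * (t - s) ^ κ * ‖h‖ ^ 2 * 0)) :=
    (tendsto_id.mono_left nhdsWithin_le_nhds).const_mul _
  rw [mul_zero] at hlim
  refine squeeze_zero' (Eventually.of_forall fun _ => norm_nonneg _) ?_ hlim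
  filter_upwards [self_mem_nhdsWithin] with r hr
  have hr : 0 < r := hr
  have h1 := hΓ.taylor s t hs hst ht x (r • h)
  rw [hΓ.lin_smul, norm_smul, Real.norm_of_nonneg hr.le] at h1
  have h2 : r⁻¹ • (Γ s t (x + r • h) - Γ s t x) - Λ s t x h
      = r⁻¹ • (Γ s t (x + r • h) - Γ s t x - r • Λ s t x h) := by
    rw [smul_sub r⁻¹ _ (r • _), smul_smul, inv_mul_cancel₀ hr.ne', one_smul]
  rw [h2, norm_smul, norm_inv, Real.norm_of_nonneg hr.le]
  calc r⁻¹ * ‖Γ s t (x + r • h) - Γ s t x - r • Λ s t x h‖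
      ≤ r⁻¹ * (C * (t - s) ^ κ * (r * ‖h‖) ^ 2) := by gcongr
    _ = _ := by
      field_simp

/-- The coboundary of the linearised germ. -/
lemma IsGerm.cob_lin (hΓ : IsGerm κ C T Γ Λ) {s u t : ℝ} (hs : 0 ≤ s) (hsu : s ≤ u)
    (hut : u ≤ t) (ht : t ≤ T) (hl : t - s ≤ 1) (p q w z : V) :
    ‖Λ s t p w - Λ s u p w - Λ u t q z‖ ≤ C * (t - s) ^ κ *
        (‖w‖ * ((t - s) ^ (2 / 3 : ℝ) + ‖q - p - Γ s u p‖ + ‖q - p - Γ s u p‖)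
          + ‖z‖ * (t - s) ^ (2 / 3 : ℝ) + ‖z - w - Λ s u p w‖) := by
  have h1 := hΓ.tendsto_lin hs (hsu.trans hut) ht p w
  have h2 := hΓ.tendsto_lin hs hsu (hut.trans ht) p w
  have h3 := hΓ.tendsto_lin (hs.trans hsu) hut ht q z
  have hr : Tendsto (fun r : ℝ => r) (𝓝[>] 0) (𝓝 0) := tendsto_id.mono_left nhdsWithin_le_nhds
  have h4 : Tendsto (fun r : ℝ => Γ s u (p + r • w)) (𝓝[>] 0) (𝓝 (Γ s u p)) := by
    rw [tendsto_iff_norm_sub_tendsto_zero]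
    have : Tendsto (fun r : ℝ => C * (u - s) ^ κ * ‖r • w‖) (𝓝[>] 0)
        (𝓝 (C * (u - s) ^ κ * ‖(0 : ℝ) • w‖)) := ((hr.smul_const w).norm).const_mul _
    simp only [zero_smul, norm_zero, mul_zero] at this
    refine squeeze_zero (fun _ => norm_nonneg _) (fun r => ?_) this
    simpa using hΓ.lip s u hs hsu (hut.trans ht) p (p + r • w)
  have h5 : Tendsto (fun r : ℝ => (q + r • z) - (p + r • w) - Γ s u (p + r • w)) (𝓝[>] 0)
      (𝓝 (q - p - Γ s u p)) := by
    have := ((hr.smul_const z).const_add q).sub ((hr.smul_const w).const_add p) |>.sub h4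
    simpa using this
  -- `cob_diff` is applied to the pairs `(p, q)` and `(p + r • w, q + r • z)`, divided by `r`, and
  -- `r` tends to zero. The defects of both pairs have the same limit, which therefore occurs twice.
  refine le_of_tendsto_of_tendsto ((h1.sub h2).sub h3).norm
    ((((tendsto_const_nhds (x := (t - s) ^ (2 / 3 : ℝ) + ‖q - p - Γ s u p‖)).add
      h5.norm).const_mul ‖w‖ |>.add_const (‖z‖ * (t - s) ^ (2 / 3 : ℝ)) |>.add
      (h2.const_sub (z - w)).norm).const_mul (C * (t - s) ^ κ)) ?_
  filter_upwards [self_mem_nhdsWithin] with r hr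
  have hr : 0 < r := hr
  have h := hΓ.cob_diff s u t hs hsu hut ht hl p q (p + r • w) (q + r • z)
  simp only [add_sub_cancel_left] at h
  have e1 : r⁻¹ • (Γ s t (p + r • w) - Γ s t p) - r⁻¹ • (Γ s u (p + r • w) - Γ s u p)
      - r⁻¹ • (Γ u t (q + r • z) - Γ u t q)
      = r⁻¹ • ((Γ s t (p + r • w) - Γ s t p) - (Γ s u (p + r • w) - Γ s u p)
      - (Γ u t (q + r • z) - Γ u t q)) := by simp only [smul_sub]
  have e2 : r • z - r • w - (Γ s u (p + r • w) - Γ s u p)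
      = r • (z - w - r⁻¹ • (Γ s u (p + r • w) - Γ s u p)) := by
    rw [smul_sub r _ (r⁻¹ • _), smul_smul, mul_inv_cancel₀ hr.ne', one_smul, smul_sub]
  rw [e2, norm_smul, norm_smul, norm_smul, Real.norm_of_nonneg hr.le] at h
  rw [e1, norm_smul, norm_inv, Real.norm_of_nonneg hr.le]
  calc r⁻¹ * _ ≤ r⁻¹ * _ := mul_le_mul_of_nonneg_left h (by positivity)
    _ = _ := by
      field_simp

/-- The remainder of the difference of two paths driven by the same germ. -/
lemma IsGerm.exists_diff_bound (hΓ : IsGerm κ C T Γ Λ) (hκ : 1 / 3 < κ) (hC : 0 ≤ C) {C₁ : ℝ}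
    (hC₁ : 0 ≤ C₁) : ∃ K τ : ℝ, 0 ≤ K ∧ 0 < τ ∧ τ ≤ 1 ∧ ∀ a b : ℝ, 0 ≤ a → b ≤ T → b - a ≤ τ →
      ∀ (x x' : ℝ → V) (k : ℝ → ℝ → V) (D ε N₀ : ℝ), 0 ≤ D → 0 ≤ ε →
      (∀ u v, a ≤ u → u ≤ v → v ≤ b →
        ‖x v - x u - Γ u v (x u)‖ ≤ C₁ * (v - u) ^ (2 / 3 : ℝ)) →
      (∀ u v, a ≤ u → u ≤ v → v ≤ b →
        ‖x' v - x' u - Γ u v (x' u)‖ ≤ C₁ * (v - u) ^ (2 / 3 : ℝ)) →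
      (∀ s u t, a ≤ s → s ≤ u → u ≤ t → t ≤ b → k s t = k s u + k u t) →
      (∀ u v, a ≤ u → u ≤ v → v ≤ b → ‖k u v‖ ≤ ε * (v - u) ^ (2 / 3 : ℝ)) →
      (∀ u, a ≤ u → u ≤ b → ‖x' u - x u‖ ≤ D) →
      (∀ u v, a ≤ u → u ≤ v → v ≤ b →
        ‖(x' v - x v) - (x' u - x u) - k u v - (Γ u v (x' u) - Γ u v (x u))‖
          ≤ N₀ * (v - u) ^ (κ + 2 / 3)) →
      ∀ u v, a ≤ u → u ≤ v → v ≤ b →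
        ‖(x' v - x v) - (x' u - x u) - k u v - (Γ u v (x' u) - Γ u v (x u))‖
          ≤ K * (D + ε) * (v - u) ^ (κ + 2 / 3) := by
  have hθ : 1 < κ + 2 / 3 := by linarith
  have hr := two_mul_half_rpow_lt_one hθ
  -- On intervals of length at most `τ` the coefficient `C l^κ` of the unknown constant fits into
  -- the slack of `sewing_bound`.
  obtain ⟨τ, hτ0, hτ1, hτ⟩ := exists_mul_rpow_le (κ := κ) (by linarith) C
    (η := (1 - 2 * (1 / 2 : ℝ) ^ (κ + 2 / 3)) / 2) (by linarith)
  refine ⟨2 * (C * (2 + 2 * C₁)) / (1 - 2 * (1 / 2 : ℝ) ^ (κ + 2 / 3)), τ,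
    div_nonneg (by positivity) (by linarith), hτ0, hτ1, ?_⟩
  intro a b ha hb hab x x' k D ε N₀ hD hε hx hx' hk hkb hDb hfin
  have key := sewing_bound (P := fun u v =>
    (x' v - x v) - (x' u - x u) - k u v - (Γ u v (x' u) - Γ u v (x u)))
    (A := C * (2 + 2 * C₁) * (D + ε)) hθ (by positivity) hfin ?_
  · intro u v h1 h2 h3
    refine (key u v h1 h2 h3).trans_eq ?_
    ring
  intro N hN hNP s u t h1 h2 h3 h4
  have hl0 : 0 ≤ t - s := by linarith
  have hsl : u - s ≤ t - s := by linarith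
  have hsl0 : 0 ≤ u - s := by linarith
  set l := t - s with hl
  have h := hΓ.cob_diff s u t (ha.trans h1) h2 h3 (h4.trans hb) (by linarith) (x s) (x u)
    (x' s) (x' u)
  -- Path increments and `k` are additive, so only the germs have a coboundary.
  have e0 : ((x' t - x t) - (x' s - x s) - k s t - (Γ s t (x' s) - Γ s t (x s)))
      - ((x' u - x u) - (x' s - x s) - k s u - (Γ s u (x' s) - Γ s u (x s)))
      - ((x' t - x t) - (x' u - x u) - k u t - (Γ u t (x' u) - Γ u t (x u)))
      = -((Γ s t (x' s) - Γ s t (x s)) - (Γ s u (x' s) - Γ s u (x s))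
        - (Γ u t (x' u) - Γ u t (x u))) := by
    rw [hk s u t h1 h2 h3 h4]
    abel
  simp only [e0, norm_neg]
  refine h.trans ?_
  have q1 : (u - s) ^ (2 / 3 : ℝ) ≤ l ^ (2 / 3 : ℝ) := by gcongr
  have e1 : ‖x u - x s - Γ s u (x s)‖ ≤ C₁ * l ^ (2 / 3 : ℝ) :=
    (hx s u h1 h2 (h3.trans h4)).trans (by gcongr)
  have e2 : ‖x' u - x' s - Γ s u (x' s)‖ ≤ C₁ * l ^ (2 / 3 : ℝ) :=
    (hx' s u h1 h2 (h3.trans h4)).trans (by gcongr)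
  have hlκ : l ^ (κ + 2 / 3) = l ^ κ * l ^ (2 / 3 : ℝ) :=
    Real.rpow_add_of_nonneg hl0 (by linarith) (by norm_num)
  -- The defect in `cob_diff` is `k` plus the remainder under estimation; here the unknown `N`
  -- enters.
  have e3 : ‖(x' u - x u) - (x' s - x s) - (Γ s u (x' s) - Γ s u (x s))‖
      ≤ ε * l ^ (2 / 3 : ℝ) + N * l ^ (κ + 2 / 3) := by
    have e4 := hNP s u h1 h2 (h3.trans h4)
    have e5 := hkb s u h1 h2 (h3.trans h4)
    have e6 : (x' u - x u) - (x' s - x s) - (Γ s u (x' s) - Γ s u (x s))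
        = k s u + ((x' u - x u) - (x' s - x s) - k s u - (Γ s u (x' s) - Γ s u (x s))) := by abel
    rw [e6]
    refine (norm_add_le _ _).trans (add_le_add (e5.trans (by gcongr)) (e4.trans ?_))
    gcongr
  have e7 := hDb s h1 (h2.trans (h3.trans h4))
  have e8 := hDb u (h1.trans h2) (h3.trans h4)
  have hτl := hτ l hl0 (by linarith)
  calc C * l ^ κ * (‖x' s - x s‖ * (l ^ (2 / 3 : ℝ) + ‖x u - x s - Γ s u (x s)‖
          + ‖x' u - x' s - Γ s u (x' s)‖) + ‖x' u - x u‖ * l ^ (2 / 3 : ℝ)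
          + ‖(x' u - x u) - (x' s - x s) - (Γ s u (x' s) - Γ s u (x s))‖)
      ≤ C * l ^ κ * (D * (l ^ (2 / 3 : ℝ) + C₁ * l ^ (2 / 3 : ℝ) + C₁ * l ^ (2 / 3 : ℝ))
          + D * l ^ (2 / 3 : ℝ) + (ε * l ^ (2 / 3 : ℝ) + N * l ^ (κ + 2 / 3))) := by gcongr
    _ = (C * ((2 + 2 * C₁) * D + ε) + (C * l ^ κ) * N) * l ^ (κ + 2 / 3) := by
        rw [hlκ]
        ring
    _ ≤ _ := by
        have : (2 + 2 * C₁) * D + ε ≤ (2 + 2 * C₁) * (D + ε) := by nlinarith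
        rw [mul_assoc C (2 + 2 * C₁)]
        gcongr

set_option maxHeartbeats 1000000 in
/-- The remainder of the difference of two difference quotients along the same path. -/
lemma IsGerm.exists_quotient_diff_bound (hΓ : IsGerm κ C T Γ Λ) (hκ : 1 / 3 < κ)
    (hκ2 : κ ≤ 1 / 2) (hC : 0 ≤ C) {C₁ : ℝ} (hC₁ : 0 ≤ C₁) :
    ∃ K τ : ℝ, 0 ≤ K ∧ 0 < τ ∧ τ ≤ 1 ∧ ∀ a b : ℝ, 0 ≤ a → b ≤ T → b - a ≤ τ →
      ∀ (x D D' : ℝ → V) (g g' : ℝ → ℝ → V) (β β' ω ε : ℝ), 0 < β' → β' ≤ β → 0 ≤ ω → 0 ≤ ε →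
      (∀ u v, a ≤ u → u ≤ v → v ≤ b →
        ‖x v - x u - Γ u v (x u)‖ ≤ C₁ * (v - u) ^ (2 / 3 : ℝ)) →
      (∀ u, a ≤ u → u ≤ b → ‖D u‖ ≤ C₁) → (∀ u, a ≤ u → u ≤ b → ‖D' u‖ ≤ C₁) →
      (∀ s u t, a ≤ s → s ≤ u → u ≤ t → t ≤ b → g s t = g s u + g u t) →
      (∀ s u t, a ≤ s → s ≤ u → u ≤ t → t ≤ b → g' s t = g' s u + g' u t) →
      (∀ u v, a ≤ u → u ≤ v → v ≤ b →
        ‖D v - D u - g u v - β⁻¹ • (Γ u v (x u + β • D u) - Γ u v (x u))‖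
          ≤ C₁ * (v - u) ^ (κ + 2 / 3)) →
      (∀ u v, a ≤ u → u ≤ v → v ≤ b →
        ‖D' v - D' u - g' u v - β'⁻¹ • (Γ u v (x u + β' • D' u) - Γ u v (x u))‖
          ≤ C₁ * (v - u) ^ (κ + 2 / 3)) →
      (∀ u v, a ≤ u → u ≤ v → v ≤ b → ‖g u v - g' u v‖ ≤ ε * (v - u) ^ (2 / 3 : ℝ)) →
      (∀ u, a ≤ u → u ≤ b → ‖D u - D' u‖ ≤ ω) →
      ∀ u v, a ≤ u → u ≤ v → v ≤ b →
        ‖(D v - D' v) - (D u - D' u)‖ ≤ (ω + ε + β + β ^ (3 / 4 * (κ - 1 / 3))) * K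
          * (v - u) ^ κ := by
  -- This exponent lies halfway between `1` and `κ + 2 / 3`: it can still be sewn, and leaves room
  -- to gain a power of `β`.
  have hθ : 1 < κ / 2 + 5 / 6 := by linarith
  have hr := two_mul_half_rpow_lt_one hθ
  obtain ⟨τ, hτ0, hτ1, hτ⟩ := exists_mul_rpow_le (κ := κ) (by linarith) C
    (η := (1 - 2 * (1 / 2 : ℝ) ^ (κ / 2 + 5 / 6)) / 2) (by linarith)
  set A₀ : ℝ := C * (2 + 2 * C₁) + (6 * C₁ + 2 * C ^ 2 * C₁ ^ 2 + 6 * C * C₁ ^ 2) with hA₀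
  have hA₀0 : 0 ≤ A₀ := by positivity
  have hK0 : 0 ≤ 2 * A₀ / (1 - 2 * (1 / 2 : ℝ) ^ (κ / 2 + 5 / 6)) :=
    div_nonneg (by positivity) (by linarith)
  refine ⟨1 + C + 2 * C * C₁ ^ 2 + 2 * A₀ / (1 - 2 * (1 / 2 : ℝ) ^ (κ / 2 + 5 / 6)), τ,
    by positivity, hτ0, hτ1, ?_⟩
  intro a b ha hb hab x D D' g g' β β' ω ε hβ' hββ' hω hε hx hDb hDb' hg hg' hp hp' hgd hωb
  have hβ : 0 < β := hβ'.trans_le hββ'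
  -- Chosen so that the loss `2 / 3 * lam` in `min_le_interpolation` lowers `κ + 2 / 3` to `κ / 2 +
  -- 5 / 6`.
  set lam : ℝ := 3 / 4 * (κ - 1 / 3) with hlam
  set Y : ℝ → ℝ → V := fun u v => β⁻¹ • (Γ u v (x u + β • D u) - Γ u v (x u)) with hY
  set Y' : ℝ → ℝ → V := fun u v => β'⁻¹ • (Γ u v (x u + β' • D' u) - Γ u v (x u)) with hY'
  -- the linearisation error of the difference quotients
  have hE : ∀ u v, a ≤ u → u ≤ v → v ≤ b → ∀ (r : ℝ) (h : V), 0 < r → r ≤ β → ‖h‖ ≤ C₁ →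
      ‖r⁻¹ • (Γ u v (x u + r • h) - Γ u v (x u)) - Λ u v (x u) h‖
        ≤ β * (C * C₁ ^ 2) * (v - u) ^ κ := by
    intro u v h1 h2 h3 r h hr0 hrβ hh
    have hl0 : 0 ≤ v - u := by linarith
    have h4 := hΓ.taylor u v (ha.trans h1) h2 (h3.trans hb) (x u) (r • h)
    rw [hΓ.lin_smul, norm_smul, Real.norm_of_nonneg hr0.le] at h4
    have h5 : r⁻¹ • (Γ u v (x u + r • h) - Γ u v (x u)) - Λ u v (x u) h
        = r⁻¹ • (Γ u v (x u + r • h) - Γ u v (x u) - r • Λ u v (x u) h) := by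
      rw [smul_sub r⁻¹ _ (r • _), smul_smul, inv_mul_cancel₀ hr0.ne', one_smul]
    rw [h5, norm_smul, norm_inv, Real.norm_of_nonneg hr0.le]
    calc r⁻¹ * _ ≤ r⁻¹ * (C * (v - u) ^ κ * (r * ‖h‖) ^ 2) := by gcongr
      _ = r * (C * ‖h‖ ^ 2) * (v - u) ^ κ := by field_simp
      _ ≤ _ := by gcongr
  have hEE : ∀ u v, a ≤ u → u ≤ v → v ≤ b →
      ‖(Y u v - Y' u v) - Λ u v (x u) (D u - D' u)‖ ≤ 2 * (β * (C * C₁ ^ 2) * (v - u) ^ κ) := by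
    intro u v h1 h2 h3
    have h4 := hE u v h1 h2 h3 β (D u) hβ le_rfl (hDb u h1 (h2.trans h3))
    have h5 := hE u v h1 h2 h3 β' (D' u) hβ' hββ' (hDb' u h1 (h2.trans h3))
    have h6 : (Y u v - Y' u v) - Λ u v (x u) (D u - D' u)
        = (Y u v - Λ u v (x u) (D u)) - (Y' u v - Λ u v (x u) (D' u)) := by
      rw [hΓ.lin_sub]
      abel
    rw [h6, two_mul]
    exact (norm_sub_le _ _).trans (add_le_add h4 h5)
  set Q : ℝ → ℝ → V := fun u v =>
    (D v - D' v) - (D u - D' u) - (g u v - g' u v) - (Y u v - Y' u v) with hQ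
  have hQfin : ∀ u v, a ≤ u → u ≤ v → v ≤ b → ‖Q u v‖ ≤ 2 * C₁ * (v - u) ^ (κ + 2 / 3) := by
    intro u v h1 h2 h3
    have h4 : Q u v = (D v - D u - g u v - Y u v) - (D' v - D' u - g' u v - Y' u v) := by
      simp only [hQ]
      abel
    rw [h4, mul_assoc, two_mul]
    exact (norm_sub_le _ _).trans (add_le_add (hp u v h1 h2 h3) (hp' u v h1 h2 h3))
  have hθle : ∀ u v, a ≤ u → u ≤ v → v ≤ b →
      (v - u) ^ (κ + 2 / 3) ≤ (v - u) ^ (κ / 2 + 5 / 6) := fun u v h1 h2 h3 =>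
    rpow_le_rpow_of_le_one (by linarith) (by linarith) (by linarith) (by linarith)
  have key := sewing_bound (P := Q) (A := A₀ * (ω + ε + β ^ lam)) (N₀ := 2 * C₁) hθ
    (by positivity) (fun u v h1 h2 h3 => (hQfin u v h1 h2 h3).trans
      (mul_le_mul_of_nonneg_left (hθle u v h1 h2 h3) (by positivity))) ?_
  · intro u v h1 h2 h3
    have hl0 : 0 ≤ v - u := by linarith
    have hl1 : v - u ≤ 1 := by linarith
    have h4 := key u v h1 h2 h3
    have h5 := hEE u v h1 h2 h3
    have h6 := hgd u v h1 h2 h3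
    have h7 := hΓ.lin_bound u v (ha.trans h1) h2 (h3.trans hb) (x u) (D u - D' u)
    have h8 := hωb u h1 (h2.trans h3)
    have h9 : (D v - D' v) - (D u - D' u) = Q u v + (g u v - g' u v)
        + ((Y u v - Y' u v) - Λ u v (x u) (D u - D' u)) + Λ u v (x u) (D u - D' u) := by
      simp only [hQ]
      abel
    have w1 : (v - u) ^ (κ / 2 + 5 / 6) ≤ (v - u) ^ κ :=
      rpow_le_rpow_of_le_one hl0 hl1 (by linarith) (by linarith)
    have w2 : (v - u) ^ (2 / 3 : ℝ) ≤ (v - u) ^ κ :=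
      rpow_le_rpow_of_le_one hl0 hl1 (by linarith) (by linarith)
    have hβl : 0 ≤ β ^ lam := by positivity
    have hw0 : 0 ≤ (v - u) ^ κ := by positivity
    rw [h9]
    calc ‖Q u v + (g u v - g' u v) + ((Y u v - Y' u v) - Λ u v (x u) (D u - D' u))
          + Λ u v (x u) (D u - D' u)‖
        ≤ ‖Q u v‖ + ‖g u v - g' u v‖ + ‖(Y u v - Y' u v) - Λ u v (x u) (D u - D' u)‖
          + ‖Λ u v (x u) (D u - D' u)‖ := norm_add₄_le
      _ ≤ 2 * (A₀ * (ω + ε + β ^ lam)) / (1 - 2 * (1 / 2 : ℝ) ^ (κ / 2 + 5 / 6)) * (v - u) ^ κ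
          + ε * (v - u) ^ κ + 2 * (β * (C * C₁ ^ 2) * (v - u) ^ κ)
          + C * (v - u) ^ κ * ω := by
        refine add_le_add (add_le_add (add_le_add (h4.trans ?_) (h6.trans ?_)) h5) (h7.trans ?_)
        · have : 0 ≤ 2 * (A₀ * (ω + ε + β ^ lam)) / (1 - 2 * (1 / 2 : ℝ) ^ (κ / 2 + 5 / 6)) :=
            div_nonneg (by positivity) (by linarith)
          gcongr
        · gcongr
        · gcongr
      _ = (2 * A₀ / (1 - 2 * (1 / 2 : ℝ) ^ (κ / 2 + 5 / 6)) * (ω + ε + β ^ lam)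
          + ε + 2 * C * C₁ ^ 2 * β + C * ω) * (v - u) ^ κ := by ring
      _ ≤ _ := by
        refine mul_le_mul_of_nonneg_right ?_ hw0
        set K₀ := 2 * A₀ / (1 - 2 * (1 / 2 : ℝ) ^ (κ / 2 + 5 / 6))
        have z1 : 0 ≤ K₀ * β := by positivity
        have z2 : 0 ≤ C * (ε + β + β ^ lam) := by positivity
        have z3 : 0 ≤ 2 * C * C₁ ^ 2 * (ω + ε + β ^ lam) := by positivity
        have z4 : 0 ≤ ω + β + β ^ lam := by positivity
        nlinarith
  intro N hN hNP s u t h1 h2 h3 h4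
  have hl0 : 0 ≤ t - s := by linarith
  have hl1 : t - s ≤ 1 := by linarith
  have hus0 : 0 ≤ u - s := by linarith
  have hus : u - s ≤ t - s := by linarith
  have htu0 : 0 ≤ t - u := by linarith
  have htu : t - u ≤ t - s := by linarith
  have hlτ : t - s ≤ τ := by linarith
  set l := t - s with hl
  -- The bound of good order but without `β`: three values of `Q`, each at most `2 C₁ l^(κ+2/3)`.
  have b1 : ‖Q s t - Q s u - Q u t‖ ≤ 6 * C₁ * l ^ (κ + 2 / 3) := by
    have c1 := hQfin s t h1 (h2.trans h3) h4
    have c2 := (hQfin s u h1 h2 (h3.trans h4)).trans (b := 2 * C₁ * (u - s) ^ (κ + 2 / 3))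
      (c := 2 * C₁ * l ^ (κ + 2 / 3)) (by gcongr)
    have c3 := (hQfin u t (h1.trans h2) h3 h4).trans (b := 2 * C₁ * (t - u) ^ (κ + 2 / 3))
      (c := 2 * C₁ * l ^ (κ + 2 / 3)) (by gcongr)
    have c4 := norm_sub_le (Q s t - Q s u) (Q u t)
    have c5 := norm_sub_le (Q s t) (Q s u)
    linarith
  have q0 : l ^ κ * l ^ (2 / 3 : ℝ) = l ^ (κ + 2 / 3) :=
    (Real.rpow_add_of_nonneg hl0 (by linarith) (by norm_num)).symm
  have q1 : l ^ (κ + 2 / 3) ≤ l ^ (κ / 2 + 5 / 6) := hθle s t h1 (h2.trans h3) h4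
  have q2 : (u - s) ^ κ ≤ l ^ κ := by
    have : 0 ≤ κ := by linarith
    gcongr
  have q3 : (t - u) ^ κ ≤ l ^ κ := by
    have : 0 ≤ κ := by linarith
    gcongr
  have q4 : l ^ κ ≤ 1 := Real.rpow_le_one hl0 hl1 (by linarith)
  -- The bound with `β`: replacing `Y - Y'` by `Λ` applied to `D - D'` makes the coboundary linear
  -- in `D - D'`. The replacement errors are of order `β l^κ`, too low in `l` to be sewn.
  have b2 : ‖Q s t - Q s u - Q u t‖ ≤ (C * (2 + 2 * C₁) * (ω + ε)
      + (1 - 2 * (1 / 2 : ℝ) ^ (κ / 2 + 5 / 6)) / 2 * N) * l ^ (κ / 2 + 5 / 6)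
      + (2 * C ^ 2 * C₁ ^ 2 + 6 * C * C₁ ^ 2) * (β * l ^ κ) := by
    have c0 : Q s t - Q s u - Q u t
        = -((Λ s t (x s) (D s - D' s) - Λ s u (x s) (D s - D' s) - Λ u t (x u) (D u - D' u))
          + ((Y s t - Y' s t) - Λ s t (x s) (D s - D' s))
          + (-((Y s u - Y' s u) - Λ s u (x s) (D s - D' s)))
          + (-((Y u t - Y' u t) - Λ u t (x u) (D u - D' u)))) := by
      simp only [hQ]
      rw [hg s u t h1 h2 h3 h4, hg' s u t h1 h2 h3 h4]
      abel
    have c1 := hΓ.cob_lin (ha.trans h1) h2 h3 (h4.trans hb) hl1 (x s) (x u) (D s - D' s)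
      (D u - D' u)
    have c2 := hEE s t h1 (h2.trans h3) h4
    have c3 := hEE s u h1 h2 (h3.trans h4)
    have c4 := hEE u t (h1.trans h2) h3 h4
    have c5 : ‖x u - x s - Γ s u (x s)‖ ≤ C₁ * l ^ (2 / 3 : ℝ) :=
      (hx s u h1 h2 (h3.trans h4)).trans (by gcongr)
    have c6 : (D u - D' u) - (D s - D' s) - Λ s u (x s) (D s - D' s)
        = (g s u - g' s u) + Q s u + ((Y s u - Y' s u) - Λ s u (x s) (D s - D' s)) := by
      simp only [hQ]
      abel
    have c7 : ‖(D u - D' u) - (D s - D' s) - Λ s u (x s) (D s - D' s)‖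
        ≤ ε * l ^ (2 / 3 : ℝ) + N * l ^ (κ / 2 + 5 / 6) + 2 * (β * (C * C₁ ^ 2) * l ^ κ) := by
      rw [c6]
      refine norm_add₃_le.trans (add_le_add (add_le_add ?_ ?_) ?_)
      · exact (hgd s u h1 h2 (h3.trans h4)).trans (by gcongr)
      · exact (hNP s u h1 h2 (h3.trans h4)).trans (by gcongr)
      · exact c3.trans (by gcongr)
    have c8 := hωb s h1 (h2.trans (h3.trans h4))
    have c9 := hωb u (h1.trans h2) (h3.trans h4)
    rw [c0, norm_neg]
    calc _ ≤ ‖Λ s t (x s) (D s - D' s) - Λ s u (x s) (D s - D' s) - Λ u t (x u) (D u - D' u)‖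
          + ‖(Y s t - Y' s t) - Λ s t (x s) (D s - D' s)‖
          + ‖-((Y s u - Y' s u) - Λ s u (x s) (D s - D' s))‖
          + ‖-((Y u t - Y' u t) - Λ u t (x u) (D u - D' u))‖ := norm_add₄_le
      _ ≤ C * l ^ κ * (ω * (l ^ (2 / 3 : ℝ) + C₁ * l ^ (2 / 3 : ℝ) + C₁ * l ^ (2 / 3 : ℝ))
            + ω * l ^ (2 / 3 : ℝ)
            + (ε * l ^ (2 / 3 : ℝ) + N * l ^ (κ / 2 + 5 / 6) + 2 * (β * (C * C₁ ^ 2) * l ^ κ)))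
          + 2 * (β * (C * C₁ ^ 2) * l ^ κ) + 2 * (β * (C * C₁ ^ 2) * l ^ κ)
          + 2 * (β * (C * C₁ ^ 2) * l ^ κ) := by
        rw [norm_neg, norm_neg]
        refine add_le_add (add_le_add (add_le_add (c1.trans ?_) c2) (c3.trans ?_)) (c4.trans ?_)
        · gcongr
        · gcongr
        · gcongr
      _ = C * ((2 + 2 * C₁) * ω + ε) * (l ^ κ * l ^ (2 / 3 : ℝ))
          + (C * l ^ κ) * N * l ^ (κ / 2 + 5 / 6)
          + (2 * C ^ 2 * C₁ ^ 2 * l ^ κ + 6 * C * C₁ ^ 2) * (β * l ^ κ) := by ring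
      _ ≤ C * ((2 + 2 * C₁) * (ω + ε)) * l ^ (κ / 2 + 5 / 6)
          + (1 - 2 * (1 / 2 : ℝ) ^ (κ / 2 + 5 / 6)) / 2 * N * l ^ (κ / 2 + 5 / 6)
          + (2 * C ^ 2 * C₁ ^ 2 * 1 + 6 * C * C₁ ^ 2) * (β * l ^ κ) := by
        have d1 : (2 + 2 * C₁) * ω + ε ≤ (2 + 2 * C₁) * (ω + ε) := by nlinarith
        have d2 := hτ l hl0 hlτ
        rw [q0]
        gcongr
      _ = _ := by ring
  have b3 : ‖Q s t - Q s u - Q u t‖ ≤ (C * (2 + 2 * C₁) * (ω + ε)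
      + (1 - 2 * (1 / 2 : ℝ) ^ (κ / 2 + 5 / 6)) / 2 * N) * l ^ (κ / 2 + 5 / 6)
      -- Both bounds hold, so the minimum may be taken and then interpolated.
      + (6 * C₁ + 2 * C ^ 2 * C₁ ^ 2 + 6 * C * C₁ ^ 2) * min (β * l ^ κ) (l ^ (κ + 2 / 3)) := by
    have hr' : 0 ≤ (1 - 2 * (1 / 2 : ℝ) ^ (κ / 2 + 5 / 6)) / 2 := by linarith
    have d0 : 0 ≤ (C * (2 + 2 * C₁) * (ω + ε)
      + (1 - 2 * (1 / 2 : ℝ) ^ (κ / 2 + 5 / 6)) / 2 * N) * l ^ (κ / 2 + 5 / 6) := by positivity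
    rcases min_choice (β * l ^ κ) (l ^ (κ + 2 / 3)) with h | h
    · rw [h]
      have : 0 ≤ 6 * C₁ * (β * l ^ κ) := by positivity
      linarith
    · rw [h]
      have : 0 ≤ (2 * C ^ 2 * C₁ ^ 2 + 6 * C * C₁ ^ 2) * l ^ (κ + 2 / 3) := by positivity
      linarith
  have b4 := min_le_interpolation (κ := κ) (r := lam) hβ hl0 (by linarith)
    (by rw [hlam]; linarith) (by rw [hlam]; linarith)
  have b5 : κ + 2 / 3 - 2 / 3 * lam = κ / 2 + 5 / 6 := by
    rw [hlam]
    ring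
  rw [b5] at b4
  have d3 : 0 ≤ 6 * C₁ + 2 * C ^ 2 * C₁ ^ 2 + 6 * C * C₁ ^ 2 := by positivity
  have d4 := mul_le_mul_of_nonneg_left b4 d3
  have d5 : 0 ≤ l ^ (κ / 2 + 5 / 6) := by positivity
  have d6 : C * (2 + 2 * C₁) * (ω + ε)
      + (6 * C₁ + 2 * C ^ 2 * C₁ ^ 2 + 6 * C * C₁ ^ 2) * β ^ lam ≤ A₀ * (ω + ε + β ^ lam) := by
    have z1 : 0 ≤ C * (2 + 2 * C₁) * β ^ lam := by positivity
    have z2 : 0 ≤ (6 * C₁ + 2 * C ^ 2 * C₁ ^ 2 + 6 * C * C₁ ^ 2) * (ω + ε) := by positivity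
    rw [hA₀]
    nlinarith
  calc _ ≤ _ := b3
    _ ≤ (C * (2 + 2 * C₁) * (ω + ε) + (6 * C₁ + 2 * C ^ 2 * C₁ ^ 2 + 6 * C * C₁ ^ 2) * β ^ lam
      + (1 - 2 * (1 / 2 : ℝ) ^ (κ / 2 + 5 / 6)) / 2 * N) * l ^ (κ / 2 + 5 / 6) := by
        nlinarith
    _ ≤ _ := by gcongr

end Germ

/-! ### Local expansions of solutions, uniqueness and stability. -/

/-- A bounded drift, measurable in time and Lipschitz in space. -/
structure IsDriftField {V : Type*} [NormedAddCommGroup V] [MeasurableSpace V]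
    (M : ℝ) (B : ℝ → V → V) : Prop where
  measurable : ∀ x, Measurable fun r => B r x
  bound : ∀ r x, ‖B r x‖ ≤ M
  lip : ∀ r x x', ‖B r x' - B r x‖ ≤ M * ‖x' - x‖

/-- The local expansion of a solution of `dx = B(r,x) dr + Γ(x)` on `[a,b]`. -/
def RDEBound {V : Type*} [NormedAddCommGroup V] [NormedSpace ℝ V] (κ K τ : ℝ)
    (Γ : ℝ → ℝ → V → V) (B : ℝ → V → V) (a b : ℝ) (x : ℝ → V) : Prop :=
  ∀ u v, a ≤ u → u ≤ v → v ≤ b → v - u ≤ τ →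
    ‖x v - x u - (∫ r in u..v, B r (x r)) - Γ u v (x u)‖ ≤ K * (v - u) ^ (3 * κ)

section

variable {V : Type*} [NormedAddCommGroup V] [NormedSpace ℝ V] {κ C T : ℝ}
  {Γ : ℝ → ℝ → V → V} {Λ : ℝ → ℝ → V → V → V} {B B' : ℝ → V → V} {M K τ a b : ℝ} {x x' : ℝ → V}

lemma continuousOn_of_local_holder {f : ℝ → V} {N : ℝ} (hκ : 0 < κ) (hτ : 0 < τ)
    (h : ∀ u v, a ≤ u → u ≤ v → v ≤ b → v - u ≤ τ → ‖f v - f u‖ ≤ N * (v - u) ^ κ) :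
    ContinuousOn f (Icc a b) := by
  intro r hr
  rw [ContinuousWithinAt, tendsto_iff_norm_sub_tendsto_zero]
  have hlim : Tendsto (fun s : ℝ => N * |s - r| ^ κ) (𝓝[Icc a b] r) (𝓝 0) := by
    have h1 : Continuous fun s : ℝ => N * |s - r| ^ κ :=
      continuous_const.mul ((continuous_id.sub continuous_const).abs.rpow_const
        fun _ => Or.inr hκ.le)
    have h2 := h1.tendsto r
    simp only [sub_self, abs_zero, Real.zero_rpow hκ.ne', mul_zero] at h2
    exact h2.mono_left nhdsWithin_le_nhds
  refine squeeze_zero' (Eventually.of_forall fun _ => norm_nonneg _) ?_ hlim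
  have hnear : ∀ᶠ s in 𝓝[Icc a b] r, |s - r| < τ :=
    nhdsWithin_le_nhds (Metric.ball_mem_nhds r hτ)
  filter_upwards [self_mem_nhdsWithin, hnear] with s hs hsτ
  rcases le_total r s with hrs | hrs
  · rw [abs_of_nonneg (by linarith)] at hsτ ⊢
    exact h r s hr.1 hrs hs.2 hsτ.le
  · rw [abs_of_nonpos (by linarith)] at hsτ ⊢
    rw [norm_sub_rev]
    have := h s r hs.1 hrs hr.2 (by linarith)
    rwa [neg_sub]

variable [MeasurableSpace V]

lemma IsDriftField.nonneg (hB : IsDriftField M B) : 0 ≤ M := (norm_nonneg _).trans (hB.bound 0 0)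

lemma IsDriftField.norm_integral_le (hB : IsDriftField M B) (x : ℝ → V) {u v : ℝ} (h : u ≤ v) :
    ‖∫ r in u..v, B r (x r)‖ ≤ M * (v - u) := by
  have := intervalIntegral.norm_integral_le_of_norm_le_const (a := u) (b := v)
    (f := fun r => B r (x r)) (C := M) fun r _ => hB.bound r (x r)
  rwa [abs_of_nonneg (by linarith)] at this

/-- The drift integral has order `1` and the error order `3 * κ`. Both are weakened to `2 / 3`,
which suffices for sewing because `κ + 2 / 3 > 1`. -/
lemma RDEBound.remainder (hB : IsDriftField M B) (hκ : 1 / 3 < κ) (hK : 0 ≤ K)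
    (hx : RDEBound κ K τ Γ B a b x) {u v : ℝ} (h1 : a ≤ u) (h2 : u ≤ v) (h3 : v ≤ b)
    (h4 : v - u ≤ τ) (h5 : v - u ≤ 1) :
    ‖x v - x u - Γ u v (x u)‖ ≤ (M + K) * (v - u) ^ (2 / 3 : ℝ) := by
  have hl : 0 ≤ v - u := by linarith
  have e1 := hx u v h1 h2 h3 h4
  have e2 := hB.norm_integral_le x h2
  have e3 : x v - x u - Γ u v (x u) = (∫ r in u..v, B r (x r))
      + (x v - x u - (∫ r in u..v, B r (x r)) - Γ u v (x u)) := by abel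
  have hM := hB.nonneg
  rw [e3]
  calc _ ≤ M * (v - u) + K * (v - u) ^ (3 * κ) := (norm_add_le _ _).trans (add_le_add e2 e1)
    _ ≤ M * (v - u) ^ (2 / 3 : ℝ) + K * (v - u) ^ (2 / 3 : ℝ) := by
      have w1 : v - u ≤ (v - u) ^ (2 / 3 : ℝ) := by
        simpa using rpow_le_rpow_of_le_one (a := 1) hl h5 (by norm_num) (by norm_num)
      have w2 : (v - u) ^ (3 * κ) ≤ (v - u) ^ (2 / 3 : ℝ) :=
        rpow_le_rpow_of_le_one hl h5 (by norm_num) (by linarith)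
      gcongr
    _ = _ := by ring

lemma RDEBound.holder (hΓ : IsGerm κ C T Γ Λ) (hB : IsDriftField M B) (hκ : 1 / 3 < κ)
    (hκ2 : κ ≤ 1 / 2) (hK : 0 ≤ K) (ha : 0 ≤ a) (hb : b ≤ T)
    (hx : RDEBound κ K τ Γ B a b x) {u v : ℝ} (h1 : a ≤ u) (h2 : u ≤ v) (h3 : v ≤ b)
    (h4 : v - u ≤ τ) (h5 : v - u ≤ 1) :
    ‖x v - x u‖ ≤ (M + K + C) * (v - u) ^ κ := by
  have hl : 0 ≤ v - u := by linarith
  have e1 := hx.remainder hB hκ hK h1 h2 h3 h4 h5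
  have e2 := hΓ.bound u v (ha.trans h1) h2 (h3.trans hb) (x u)
  have e3 : x v - x u = (x v - x u - Γ u v (x u)) + Γ u v (x u) := by abel
  have hM := hB.nonneg
  rw [e3]
  calc _ ≤ (M + K) * (v - u) ^ (2 / 3 : ℝ) + C * (v - u) ^ κ :=
        (norm_add_le _ _).trans (add_le_add e1 e2)
    _ ≤ (M + K) * (v - u) ^ κ + C * (v - u) ^ κ := by
      have w2 : (v - u) ^ (2 / 3 : ℝ) ≤ (v - u) ^ κ :=
        rpow_le_rpow_of_le_one hl h5 (by linarith) (by linarith)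
      gcongr
    _ = _ := by ring

lemma RDEBound.continuousOn (hΓ : IsGerm κ C T Γ Λ) (hB : IsDriftField M B) (hκ : 1 / 3 < κ)
    (hκ2 : κ ≤ 1 / 2) (hK : 0 ≤ K) (hτ : 0 < τ) (ha : 0 ≤ a) (hb : b ≤ T)
    (hx : RDEBound κ K τ Γ B a b x) : ContinuousOn x (Icc a b) :=
  continuousOn_of_local_holder (κ := κ) (τ := min τ 1) (N := M + K + C) (by linarith)
    (lt_min hτ one_pos) fun _ _ h1 h2 h3 h4 =>
    hx.holder hΓ hB hκ hκ2 hK ha hb h1 h2 h3 (h4.trans (min_le_left _ _))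
      (h4.trans (min_le_right _ _))

lemma RDEBound.mono {a' b' : ℝ} (hx : RDEBound κ K τ Γ B a b x) (ha : a ≤ a') (hb : b' ≤ b) :
    RDEBound κ K τ Γ B a' b' x := fun u v h1 h2 h3 h4 =>
  hx u v (ha.trans h1) h2 (h3.trans hb) h4

/-- Integrals over `[u, v]` do not see the left endpoint. Excluding it matters for the spike, whose
drift is still the perturbed one at `t₀ + β` itself. -/
lemma RDEBound.congr (hx : RDEBound κ K τ Γ B a b x)
    (h : ∀ r, a < r → r ≤ b → B r (x r) = B' r (x r)) : RDEBound κ K τ Γ B' a b x := by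
  intro u v h1 h2 h3 h4
  have e : ∫ r in u..v, B' r (x r) = ∫ r in u..v, B r (x r) := by
    refine intervalIntegral.integral_congr_ae (Eventually.of_forall fun r hr => ?_)
    rw [uIoc_of_le h2] at hr
    exact (h r (h1.trans_lt hr.1) (hr.2.trans h3)).symm
  rw [e]
  exact hx u v h1 h2 h3 h4

lemma RDEBound.weaken {K' τ' : ℝ} (hx : RDEBound κ K τ Γ B a b x) (hK : K ≤ K') (hτ : τ' ≤ τ) :
    RDEBound κ K' τ' Γ B a b x := fun u v h1 h2 h3 h4 =>
  (hx u v h1 h2 h3 (h4.trans hτ)).trans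
    (mul_le_mul_of_nonneg_right hK (Real.rpow_nonneg (by linarith) _))

variable [BorelSpace V] [SecondCountableTopology V]

/-- A Carathéodory argument: measurable in time and continuous in space imply jointly measurable. -/
lemma IsDriftField.aestronglyMeasurable (hB : IsDriftField M B) {ν : Measure ℝ}
    (hx : AEMeasurable x ν) : AEStronglyMeasurable (fun r => B r (x r)) ν := by
  have h1 : Measurable (Function.uncurry fun (z : V) (r : ℝ) => B r z) := by
    refine measurable_uncurry_of_continuous_of_measurable (fun r => ?_) hB.measurable
    exact (LipschitzWith.of_dist_le_mul (K := M.toNNReal) fun z z' => by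
      rw [dist_eq_norm, dist_eq_norm, Real.coe_toNNReal _ hB.nonneg]
      exact hB.lip r z' z).continuous
  exact (h1.comp_aemeasurable (hx.prodMk aemeasurable_id)).aestronglyMeasurable

lemma IsDriftField.intervalIntegrable_of_aemeasurable (hB : IsDriftField M B) {u v : ℝ}
    (hx : AEMeasurable x (volume.restrict (uIoc u v))) :
    IntervalIntegrable (fun r => B r (x r)) volume u v := by
  rw [intervalIntegrable_iff]
  have : IsFiniteMeasure (volume.restrict (uIoc u v)) := ⟨by simp [uIoc]⟩
  exact Integrable.of_bound (hB.aestronglyMeasurable hx) M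
    (Eventually.of_forall fun r => hB.bound r (x r))

lemma IsDriftField.intervalIntegrable (hB : IsDriftField M B) (hx : ContinuousOn x (Icc a b))
    {u v : ℝ} (hu : u ∈ Icc a b) (hv : v ∈ Icc a b) :
    IntervalIntegrable (fun r => B r (x r)) volume u v := by
  refine hB.intervalIntegrable_of_aemeasurable ?_
  have hsub : uIoc u v ⊆ Icc a b := uIoc_subset_uIcc.trans (uIcc_subset_Icc hu hv)
  exact ((hx.mono hsub).aestronglyMeasurable measurableSet_uIoc).aemeasurable

/-- Stability of solutions with respect to the initial value. -/
lemma IsGerm.exists_stability (hΓ : IsGerm κ C T Γ Λ) (hκ : 1 / 3 < κ) (hκ2 : κ ≤ 1 / 2)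
    (hC : 0 ≤ C) {K₁ τ₁ : ℝ} (hM : 0 ≤ M) (hK₁ : 0 ≤ K₁) (hτ₁ : 0 < τ₁) :
    ∃ K τ : ℝ, 0 ≤ K ∧ 0 < τ ∧ τ ≤ 1 ∧ τ ≤ τ₁ ∧ ∀ (a b : ℝ) (B : ℝ → V → V) (x x' : ℝ → V),
      0 ≤ a → b ≤ T → IsDriftField M B → RDEBound κ K₁ τ₁ Γ B a b x →
      RDEBound κ K₁ τ₁ Γ B a b x' →
      (∀ u v, a ≤ u → u ≤ v → v ≤ b → v - u ≤ τ → ‖x' v - x v‖ ≤ 2 * ‖x' u - x u‖) ∧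
      ∀ D, 0 ≤ D → (∀ u, a ≤ u → u ≤ b → ‖x' u - x u‖ ≤ D) →
        ∀ u v, a ≤ u → u ≤ v → v ≤ b → v - u ≤ τ →
          ‖(x' v - x v) - (x' u - x u) - (∫ r in u..v, (B r (x' r) - B r (x r)))
            - (Γ u v (x' u) - Γ u v (x u))‖ ≤ K * D * (v - u) ^ (κ + 2 / 3) := by
  obtain ⟨K, τ₀, hK, hτ₀, hτ₀1, hmain⟩ := hΓ.exists_diff_bound hκ hC (C₁ := M + K₁) (by positivity)
  obtain ⟨τ₂, hτ₂, -, hsmall⟩ := exists_mul_rpow_le (κ := κ) (by linarith)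
    (M + C + K * (1 + M)) (η := 1 / 2) (by norm_num)
  refine ⟨K * (1 + M), min τ₂ (min τ₀ τ₁), by positivity, lt_min hτ₂ (lt_min hτ₀ hτ₁),
    (min_le_right _ _).trans ((min_le_left _ _).trans hτ₀1),
    (min_le_right _ _).trans (min_le_right _ _), ?_⟩
  intro a b B x x' ha hb hB hx hx'
  have hxc := hx.continuousOn hΓ hB hκ hκ2 hK₁ hτ₁ ha hb
  have hx'c := hx'.continuousOn hΓ hB hκ hκ2 hK₁ hτ₁ ha hb
  have hdom : ∀ s t, a ≤ s → s ≤ t → t ≤ b →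
      IntervalIntegrable (fun r => B r (x' r) - B r (x r)) volume s t := fun s t h1 h2 h3 =>
    (hB.intervalIntegrable hx'c ⟨h1, h2.trans h3⟩ ⟨h1.trans h2, h3⟩).sub
      (hB.intervalIntegrable hxc ⟨h1, h2.trans h3⟩ ⟨h1.trans h2, h3⟩)
  have hkD : ∀ D s t, a ≤ s → s ≤ t → t ≤ b → (∀ r, s ≤ r → r ≤ t → ‖x' r - x r‖ ≤ D) →
      ‖∫ r in s..t, (B r (x' r) - B r (x r))‖ ≤ M * D * (t - s) := by
    intro D s t h1 h2 h3 hD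
    have := intervalIntegral.norm_integral_le_of_norm_le_const (a := s) (b := t)
      (f := fun r => B r (x' r) - B r (x r)) (C := M * D) fun r hr => by
        rw [uIoc_of_le h2] at hr
        exact (hB.lip r _ _).trans (by
          have := hD r hr.1.le hr.2
          gcongr)
    rwa [abs_of_nonneg (by linarith)] at this
  have core : ∀ u v, a ≤ u → u ≤ v → v ≤ b → v - u ≤ min τ₂ (min τ₀ τ₁) → ∀ D, 0 ≤ D →
      (∀ r, u ≤ r → r ≤ v → ‖x' r - x r‖ ≤ D) → ∀ s t, u ≤ s → s ≤ t → t ≤ v →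
      ‖(x' t - x t) - (x' s - x s) - (∫ r in s..t, (B r (x' r) - B r (x r)))
            - (Γ s t (x' s) - Γ s t (x s))‖ ≤ K * (D + M * D) * (t - s) ^ (κ + 2 / 3) := by
    intro u v h1 h2 h3 h4 D hD hDb
    have hl2 : v - u ≤ τ₀ := h4.trans ((min_le_right _ _).trans (min_le_left _ _))
    have hl3 : v - u ≤ τ₁ := h4.trans ((min_le_right _ _).trans (min_le_right _ _))
    -- The integrated drift difference plays the role of `k`, with `ε = M D`. The a priori constant
    -- `2 * K₁` is available because `3 * κ ≥ κ + 2 / 3`.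
    refine hmain u v (ha.trans h1) (h3.trans hb) hl2 x x'
      (fun s t => ∫ r in s..t, (B r (x' r) - B r (x r))) D (M * D) (2 * K₁) hD (by positivity)
      ?_ ?_ ?_ ?_ hDb ?_
    · intro s t g1 g2 g3
      exact hx.remainder hB hκ hK₁ (h1.trans g1) g2 (g3.trans h3) (by linarith) (by linarith)
    · intro s t g1 g2 g3
      exact hx'.remainder hB hκ hK₁ (h1.trans g1) g2 (g3.trans h3) (by linarith) (by linarith)
    · intro s w t g1 g2 g3 g4
      exact (intervalIntegral.integral_add_adjacent_intervals
        (hdom s w (h1.trans g1) g2 (g3.trans (g4.trans h3)))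
        (hdom w t (h1.trans (g1.trans g2)) g3 (g4.trans h3))).symm
    · intro s t g1 g2 g3
      refine (hkD D s t (h1.trans g1) g2 (g3.trans h3) fun r r1 r2 =>
        hDb r (g1.trans r1) (r2.trans g3)).trans ?_
      have w1 : t - s ≤ (t - s) ^ (2 / 3 : ℝ) := by
        simpa using rpow_le_rpow_of_le_one (l := t - s) (a := 1) (b := 2 / 3) (by linarith)
          (by linarith) (by norm_num) (by norm_num)
      gcongr
    · intro s t g1 g2 g3
      have e1 := hx s t (h1.trans g1) g2 (g3.trans h3) (by linarith)
      have e2 := hx' s t (h1.trans g1) g2 (g3.trans h3) (by linarith)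
      have i1 := hB.intervalIntegrable hxc (u := s) (v := t) ⟨h1.trans g1, g2.trans (g3.trans h3)⟩
        ⟨h1.trans (g1.trans g2), g3.trans h3⟩
      have i2 := hB.intervalIntegrable hx'c (u := s) (v := t)
        ⟨h1.trans g1, g2.trans (g3.trans h3)⟩ ⟨h1.trans (g1.trans g2), g3.trans h3⟩
      rw [intervalIntegral.integral_sub i2 i1]
      have e3 : (x' t - x t) - (x' s - x s) - ((∫ r in s..t, B r (x' r)) - ∫ r in s..t, B r (x r))
            - (Γ s t (x' s) - Γ s t (x s))
          = (x' t - x' s - (∫ r in s..t, B r (x' r)) - Γ s t (x' s))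
            - (x t - x s - (∫ r in s..t, B r (x r)) - Γ s t (x s)) := by abel
      have w : (t - s) ^ (3 * κ) ≤ (t - s) ^ (κ + 2 / 3) :=
        rpow_le_rpow_of_le_one (by linarith) (by linarith) (by linarith) (by linarith)
      rw [e3]
      calc _ ≤ K₁ * (t - s) ^ (3 * κ) + K₁ * (t - s) ^ (3 * κ) :=
            (norm_sub_le _ _).trans (add_le_add e2 e1)
        _ = 2 * K₁ * (t - s) ^ (3 * κ) := by ring
        _ ≤ _ := by gcongr
  refine ⟨?_, ?_⟩
  · intro u v h1 h2 h3 h4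
    obtain ⟨N, hN⟩ := (isCompact_Icc (a := u) (b := v)).exists_bound_of_continuousOn
      (f := fun r => x' r - x r) ((hx'c.sub hxc).mono (Icc_subset_Icc h1 h3))
    -- A uniform bound `D` on the window improves to `‖x' u - x u‖ + D / 2`, whose fixed point is
    -- twice the initial distance.
    have key := le_mul_of_bootstrap (ι := Icc u v) (f := fun r => ‖x' r.1 - x r.1‖)
      (w := fun _ => 1) (fun _ => zero_le_one) (A := ‖x' u - x u‖) (q := 1 / 2) (N₀ := N)
      (norm_nonneg _) (by norm_num) (by norm_num) (fun r => by simpa using hN r.1 r.2) ?_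
    · have := key ⟨v, h2, le_rfl⟩
      simp only [mul_one] at this
      refine this.trans_eq ?_
      ring
    rintro D hD hDb ⟨t, ht1, ht2⟩
    simp only [mul_one] at hDb ⊢
    have hDb' : ∀ r, u ≤ r → r ≤ v → ‖x' r - x r‖ ≤ D := fun r r1 r2 => hDb ⟨r, r1, r2⟩
    have hl0 : 0 ≤ t - u := by linarith
    have hl1 : t - u ≤ 1 := by
      have := h4.trans ((min_le_right _ _).trans ((min_le_left _ _).trans hτ₀1))
      linarith
    have e1 := core u v h1 h2 h3 h4 D hD hDb' u t le_rfl ht1 ht2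
    have e2 := hkD D u t h1 ht1 (ht2.trans h3) fun r r1 r2 => hDb' r r1 (r2.trans ht2)
    have e3 := hΓ.lip u t (ha.trans h1) ht1 (ht2.trans (h3.trans hb)) (x u) (x' u)
    have e4 := hDb' u le_rfl h2
    have e5 : x' t - x t = (x' u - x u) + ((x' t - x t) - (x' u - x u)
        - (∫ r in u..t, (B r (x' r) - B r (x r))) - (Γ u t (x' u) - Γ u t (x u)))
        + (∫ r in u..t, (B r (x' r) - B r (x r))) + (Γ u t (x' u) - Γ u t (x u)) := by abel
    have w1 : t - u ≤ (t - u) ^ κ := by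
      simpa using rpow_le_rpow_of_le_one (l := t - u) (a := 1) (b := κ) hl0 hl1 (by linarith)
          (by linarith)
    have w2 : (t - u) ^ (κ + 2 / 3) ≤ (t - u) ^ κ :=
      rpow_le_rpow_of_le_one hl0 hl1 (by linarith) (by linarith)
    have w3 := hsmall (t - u) hl0 (by linarith [h4.trans (min_le_left _ _)])
    calc ‖x' t - x t‖ ≤ ‖x' u - x u‖ + K * (D + M * D) * (t - u) ^ (κ + 2 / 3)
          + M * D * (t - u) + C * (t - u) ^ κ * ‖x' u - x u‖ := by
          rw [e5]
          exact norm_add₄_le.trans (add_le_add (add_le_add (add_le_add le_rfl e1) e2) e3)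
      _ ≤ ‖x' u - x u‖ + K * (D + M * D) * (t - u) ^ κ + M * D * (t - u) ^ κ
          + C * (t - u) ^ κ * D := by gcongr
      _ = ‖x' u - x u‖ + (M + C + K * (1 + M)) * (t - u) ^ κ * D := by ring
      _ ≤ _ := by gcongr
  · intro D hD hDb u v h1 h2 h3 h4
    have := core u v h1 h2 h3 h4 D hD (fun r r1 r2 => hDb r (h1.trans r1) (r2.trans h3)) u v
      le_rfl h2 le_rfl
    refine this.trans_eq ?_
    ring

/-- Two solutions with the same initial value coincide. -/
lemma RDEBound.eqOn (hΓ : IsGerm κ C T Γ Λ) (hκ : 1 / 3 < κ) (hκ2 : κ ≤ 1 / 2) (hC : 0 ≤ C)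
    (hB : IsDriftField M B) (ha : 0 ≤ a) (hb : b ≤ T) {K' τ' : ℝ} (hτ : 0 < τ) (hτ' : 0 < τ')
    (hx : RDEBound κ K τ Γ B a b x) (hx' : RDEBound κ K' τ' Γ B a b x') (h0 : x' a = x a) :
    EqOn x' x (Icc a b) := by
  have hmax : 0 ≤ max (max K K') 0 := le_max_right _ _
  have hmin : 0 < min τ τ' := lt_min hτ hτ'
  obtain ⟨K₂, τ₂, -, hτ₂, -, -, H⟩ := hΓ.exists_stability hκ hκ2 hC hB.nonneg hmax hmin
  have h1 := (H a b B x x' ha hb hB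
    (hx.weaken ((le_max_left _ _).trans (le_max_left _ _)) (min_le_left _ _))
    (hx'.weaken ((le_max_right _ _).trans (le_max_left _ _)) (min_le_right _ _))).1
  intro v hv
  obtain ⟨n, hn⟩ := exists_nat_ge ((v - a) / τ₂)
  have h2 := le_of_windows (f := fun r => ‖x' r - x r‖) (e := 0) hτ₂
    (fun u v h2 h3 h4 h5 => by simpa using h1 u v h2 h3 h4 h5) n v hv.1 hv.2
    (by rwa [div_le_iff₀ hτ₂] at hn) (by positivity) le_rfl
  simp only [h0, sub_self, norm_zero, add_zero, mul_zero] at h2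
  exact sub_eq_zero.mp (norm_le_zero_iff.mp h2)

/-- Short time comparison of solutions with different drifts and the same initial value. -/
lemma IsGerm.exists_short_time (hΓ : IsGerm κ C T Γ Λ) (hκ : 1 / 3 < κ) (hκ2 : κ ≤ 1 / 2)
    (hC : 0 ≤ C) {K₁ τ₁ : ℝ} (hM : 0 ≤ M) (hK₁ : 0 ≤ K₁) (hτ₁ : 0 < τ₁) :
    ∃ K τ : ℝ, 0 ≤ K ∧ 0 < τ ∧ τ ≤ 1 ∧ ∀ (a b : ℝ) (B B' : ℝ → V → V) (x x' : ℝ → V),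
      0 ≤ a → b ≤ T → a ≤ b → b - a ≤ τ → IsDriftField M B → IsDriftField M B' →
      RDEBound κ K₁ τ₁ Γ B a b x → RDEBound κ K₁ τ₁ Γ B' a b x' → x' a = x a →
      (∀ v, a ≤ v → v ≤ b → ‖x' v - x v‖ ≤ K * (b - a)) ∧
      ‖(x' b - x b) - ∫ r in a..b, (B' r (x' r) - B r (x r))‖ ≤ K * (b - a) ^ (κ + 2 / 3) := by
  obtain ⟨K, τ₀, hK, hτ₀, hτ₀1, hmain⟩ := hΓ.exists_diff_bound hκ hC (C₁ := M + K₁) (by positivity)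
  obtain ⟨τ₂, hτ₂, -, hsmall⟩ := exists_mul_rpow_le (κ := κ) (by linarith)
    K (η := 1 / 2) (by norm_num)
  refine ⟨4 * M + 4 * M * K + K * (6 * M + 4 * M * K), min τ₂ (min τ₀ τ₁), by positivity,
    lt_min hτ₂ (lt_min hτ₀ hτ₁), (min_le_right _ _).trans ((min_le_left _ _).trans hτ₀1), ?_⟩
  intro a b B B' x x' ha hb hab hlen hB hB' hx hx' h0
  have hl2 : b - a ≤ τ₀ := hlen.trans ((min_le_right _ _).trans (min_le_left _ _))
  have hl3 : b - a ≤ τ₁ := hlen.trans ((min_le_right _ _).trans (min_le_right _ _))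
  have hl0 : 0 ≤ b - a := by linarith
  have hl1 : b - a ≤ 1 := by linarith
  have hxc := hx.continuousOn hΓ hB hκ hκ2 hK₁ hτ₁ ha hb
  have hx'c := hx'.continuousOn hΓ hB' hκ hκ2 hK₁ hτ₁ ha hb
  have hdom : ∀ s t, a ≤ s → s ≤ t → t ≤ b →
      IntervalIntegrable (fun r => B' r (x' r) - B r (x r)) volume s t := fun s t h1 h2 h3 =>
    (hB'.intervalIntegrable hx'c ⟨h1, h2.trans h3⟩ ⟨h1.trans h2, h3⟩).sub
      (hB.intervalIntegrable hxc ⟨h1, h2.trans h3⟩ ⟨h1.trans h2, h3⟩)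
  have hkD : ∀ s t, a ≤ s → s ≤ t → t ≤ b →
      ‖∫ r in s..t, (B' r (x' r) - B r (x r))‖ ≤ 2 * M * (t - s) := by
    intro s t h1 h2 h3
    have := intervalIntegral.norm_integral_le_of_norm_le_const (a := s) (b := t)
      (f := fun r => B' r (x' r) - B r (x r)) (C := 2 * M) fun r hr => by
        rw [two_mul]
        exact (norm_sub_le _ _).trans (add_le_add (hB'.bound _ _) (hB.bound _ _))
    rwa [abs_of_nonneg (by linarith)] at this
  -- The paths start together, so the germ difference at `a` vanishes and the rough part enters only
  -- at order `κ + 2 / 3 > 1`, beyond the linear order of the drift integral.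
  have core : ∀ D, 0 ≤ D → (∀ r, a ≤ r → r ≤ b → ‖x' r - x r‖ ≤ D) → ∀ t, a ≤ t → t ≤ b →
      ‖(x' t - x t) - (∫ r in a..t, (B' r (x' r) - B r (x r)))‖
        ≤ K * (D + 2 * M) * (t - a) ^ (κ + 2 / 3) := by
    intro D hD hDb t ht1 ht2
    have := hmain a b ha hb hl2 x x'
      (fun s t => ∫ r in s..t, (B' r (x' r) - B r (x r))) D (2 * M) (2 * K₁) hD (by positivity)
      ?_ ?_ ?_ ?_ hDb ?_ a t le_rfl ht1 ht2
    · simpa only [h0, sub_self, sub_zero] using this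
    · intro s t g1 g2 g3
      exact hx.remainder hB hκ hK₁ g1 g2 g3 (by linarith) (by linarith)
    · intro s t g1 g2 g3
      exact hx'.remainder hB' hκ hK₁ g1 g2 g3 (by linarith) (by linarith)
    · intro s w t g1 g2 g3 g4
      exact (intervalIntegral.integral_add_adjacent_intervals
        (hdom s w g1 g2 (g3.trans g4)) (hdom w t (g1.trans g2) g3 g4)).symm
    · intro s t g1 g2 g3
      refine (hkD s t g1 g2 g3).trans ?_
      have w1 : t - s ≤ (t - s) ^ (2 / 3 : ℝ) := by
        simpa using rpow_le_rpow_of_le_one (l := t - s) (a := 1) (b := 2 / 3) (by linarith)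
          (by linarith) (by norm_num) (by norm_num)
      gcongr
    · intro s t g1 g2 g3
      have e1 := hx s t g1 g2 g3 (by linarith)
      have e2 := hx' s t g1 g2 g3 (by linarith)
      have i1 := hB.intervalIntegrable hxc (u := s) (v := t) ⟨g1, g2.trans g3⟩ ⟨g1.trans g2, g3⟩
      have i2 := hB'.intervalIntegrable hx'c (u := s) (v := t) ⟨g1, g2.trans g3⟩ ⟨g1.trans g2, g3⟩
      rw [intervalIntegral.integral_sub i2 i1]
      have e3 : (x' t - x t) - (x' s - x s)
            - ((∫ r in s..t, B' r (x' r)) - ∫ r in s..t, B r (x r))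
            - (Γ s t (x' s) - Γ s t (x s))
          = (x' t - x' s - (∫ r in s..t, B' r (x' r)) - Γ s t (x' s))
            - (x t - x s - (∫ r in s..t, B r (x r)) - Γ s t (x s)) := by abel
      have w : (t - s) ^ (3 * κ) ≤ (t - s) ^ (κ + 2 / 3) :=
        rpow_le_rpow_of_le_one (by linarith) (by linarith) (by linarith) (by linarith)
      rw [e3]
      calc _ ≤ K₁ * (t - s) ^ (3 * κ) + K₁ * (t - s) ^ (3 * κ) :=
            (norm_sub_le _ _).trans (add_le_add e2 e1)
        _ = 2 * K₁ * (t - s) ^ (3 * κ) := by ring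
        _ ≤ _ := by gcongr
  have hwθ : (b - a) ^ (κ + 2 / 3) ≤ b - a := by
    simpa using rpow_le_rpow_of_le_one (l := b - a) (a := κ + 2 / 3) (b := 1) hl0 hl1 (by norm_num)
      (by linarith)
  have hwκ : (b - a) ^ (κ + 2 / 3) ≤ (b - a) ^ κ :=
    rpow_le_rpow_of_le_one hl0 hl1 (by linarith) (by linarith)
  have hDfin : ∀ v, a ≤ v → v ≤ b → ‖x' v - x v‖ ≤ (4 * M + 4 * M * K) * (b - a) := by
    obtain ⟨N, hN⟩ := (isCompact_Icc (a := a) (b := b)).exists_bound_of_continuousOn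
      (f := fun r => x' r - x r) (hx'c.sub hxc)
    -- A uniform bound `D` improves to `D / 2` plus a multiple of `b - a`, so the distance is linear
    -- in the elapsed time.
    have key := le_mul_of_bootstrap (ι := Icc a b) (f := fun r => ‖x' r.1 - x r.1‖)
      (w := fun _ => 1) (fun _ => zero_le_one) (A := (2 * M + 2 * M * K) * (b - a)) (q := 1 / 2)
      (N₀ := N) (by positivity) (by norm_num) (by norm_num) (fun r => by simpa using hN r.1 r.2) ?_
    · intro v hv1 hv2
      have := key ⟨v, hv1, hv2⟩
      simp only [mul_one] at this
      refine this.trans_eq ?_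
      ring
    rintro D hD hDb ⟨t, ht1, ht2⟩
    simp only [mul_one] at hDb ⊢
    have e1 := core D hD (fun r r1 r2 => hDb ⟨r, r1, r2⟩) t ht1 ht2
    have e2 := hkD a t le_rfl ht1 ht2
    have e3 := hsmall (b - a) hl0 (hlen.trans (min_le_left _ _))
    have hta : t - a ≤ b - a := by linarith
    have hta0 : 0 ≤ t - a := by linarith
    have e5 : x' t - x t = ((x' t - x t) - (∫ r in a..t, (B' r (x' r) - B r (x r))))
        + (∫ r in a..t, (B' r (x' r) - B r (x r))) := by abel
    rw [e5]
    calc _ ≤ K * (D + 2 * M) * (t - a) ^ (κ + 2 / 3) + 2 * M * (t - a) :=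
          (norm_add_le _ _).trans (add_le_add e1 e2)
      _ ≤ K * (D + 2 * M) * (b - a) ^ (κ + 2 / 3) + 2 * M * (b - a) := by
          have : 0 ≤ κ + 2 / 3 := by linarith
          gcongr
      _ = K * (b - a) ^ (κ + 2 / 3) * D + 2 * M * K * (b - a) ^ (κ + 2 / 3)
          + 2 * M * (b - a) := by ring
      _ ≤ K * (b - a) ^ κ * D + 2 * M * K * (b - a) + 2 * M * (b - a) := by gcongr
      _ ≤ 1 / 2 * D + 2 * M * K * (b - a) + 2 * M * (b - a) := by gcongr
      _ = _ := by ring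
  refine ⟨fun v hv1 hv2 => (hDfin v hv1 hv2).trans ?_, ?_⟩
  · refine mul_le_mul_of_nonneg_right ?_ hl0
    have : 0 ≤ K * (6 * M + 4 * M * K) := by positivity
    linarith
  · refine (core _ (by positivity) hDfin b hab le_rfl).trans ?_
    refine mul_le_mul_of_nonneg_right ?_ (Real.rpow_nonneg hl0 _)
    have z : (4 * M + 4 * M * K) * (b - a) ≤ 4 * M + 4 * M * K :=
      mul_le_of_le_one_right (by positivity) hl1
    calc K * ((4 * M + 4 * M * K) * (b - a) + 2 * M)
        ≤ K * ((4 * M + 4 * M * K) + 2 * M) := by gcongr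
      _ = K * (6 * M + 4 * M * K) := by ring
      _ ≤ _ := by
        have : 0 ≤ 4 * M + 4 * M * K := by positivity
        linarith

end

/-! ### The Euler scheme and its discrete sewing estimate. -/

section Euler

variable {V : Type*} [NormedAddCommGroup V] [NormedSpace ℝ V]

/-- The Euler scheme with step `δ` started in `y` at time `a`. -/
noncomputable def eulerSeq (Γ : ℝ → ℝ → V → V) (B : ℝ → V → V) (a δ : ℝ) (y : V) : ℕ → V
  | 0 => y
  | i + 1 => eulerSeq Γ B a δ y i
      + (∫ r in (a + i * δ)..(a + (i + 1 : ℕ) * δ), B r (eulerSeq Γ B a δ y i))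
      + Γ (a + i * δ) (a + (i + 1 : ℕ) * δ) (eulerSeq Γ B a δ y i)

/-- The Euler scheme as a step function. -/
noncomputable def eulerPath (Γ : ℝ → ℝ → V → V) (B : ℝ → V → V) (a δ : ℝ) (y : V) (r : ℝ) : V :=
  eulerSeq Γ B a δ y ⌊(r - a) / δ⌋₊

variable {κ C T : ℝ}
  {Γ : ℝ → ℝ → V → V} {Λ : ℝ → ℝ → V → V → V} {B B' : ℝ → V → V} {M K τ a b δ : ℝ} {y : V}

lemma eulerPath_of_mem {i : ℕ} {r : ℝ} (hδ : 0 < δ) (h1 : a + i * δ ≤ r)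
    (h2 : r < a + (i + 1 : ℕ) * δ) : eulerPath Γ B a δ y r = eulerSeq Γ B a δ y i := by
  have h3 : ⌊(r - a) / δ⌋₊ = i := by
    have h0 : 0 ≤ r - a := by
      have : 0 ≤ (i : ℝ) * δ := by positivity
      linarith
    rw [Nat.floor_eq_iff (div_nonneg h0 hδ.le), le_div_iff₀ hδ, div_lt_iff₀ hδ]
    push_cast at h2
    exact ⟨by linarith, by linarith⟩
  rw [eulerPath, h3]

/-- The step function is constant on a cell except perhaps at its right end, a null set. So the
frozen integral of the recursion is an integral along the path. -/
lemma integral_eulerPath (hδ : 0 < δ) (i : ℕ) :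
    ∫ r in (a + i * δ)..(a + (i + 1 : ℕ) * δ), B r (eulerPath Γ B a δ y r)
      = ∫ r in (a + i * δ)..(a + (i + 1 : ℕ) * δ), B r (eulerSeq Γ B a δ y i) := by
  refine intervalIntegral.integral_congr_Ioo_of_le ?_ fun r hr => ?_
  · push_cast
    linarith
  · rw [eulerPath_of_mem hδ hr.1.le hr.2]

variable [MeasurableSpace V] [BorelSpace V] [SecondCountableTopology V]

lemma measurable_eulerPath : Measurable (eulerPath Γ B a δ y) := by
  have h1 : Measurable (eulerSeq Γ B a δ y) := measurable_from_nat
  exact h1.comp (Nat.measurable_floor.comp ((measurable_id.sub_const a).div_const δ))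

/-- The local expansion of the Euler scheme, uniformly in the step. -/
lemma IsGerm.exists_euler_bound (hΓ : IsGerm κ C T Γ Λ) (hκ : 1 / 3 < κ) (hκ2 : κ ≤ 1 / 2)
    (hC : 0 ≤ C) (hM : 0 ≤ M) :
    ∃ K τ : ℝ, 0 ≤ K ∧ 0 < τ ∧ τ ≤ 1 ∧ ∀ (B : ℝ → V → V), IsDriftField M B →
      ∀ (a δ : ℝ) (y : V), 0 ≤ a → 0 < δ → ∀ n i : ℕ, a + (i + n : ℕ) * δ ≤ T → n * δ ≤ τ →
        ‖eulerSeq Γ B a δ y (i + n) - eulerSeq Γ B a δ y i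
          - (∫ r in (a + i * δ)..(a + (i + n : ℕ) * δ), B r (eulerPath Γ B a δ y r))
          - Γ (a + i * δ) (a + (i + n : ℕ) * δ) (eulerSeq Γ B a δ y i)‖
            ≤ K * (n * δ) ^ (3 * κ) := by
  -- If an interval is cut into two blocks of relative length at most `2 / 3`, their `3 * κ`-powers
  -- add up to at most `ρ` times that of the whole.
  set ρ : ℝ := (2 / 3 : ℝ) ^ (3 * κ - 1) with hρ
  have hρ1 : ρ < 1 := Real.rpow_lt_one (by norm_num) (by norm_num) (by linarith)
  have hρ0 : 0 ≤ ρ := by positivity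
  obtain ⟨τ, hτ, hτ1, hsmall⟩ := exists_mul_rpow_le (κ := κ) (by linarith) C
    (η := (1 - ρ) / 2) (by linarith)
  -- The solution of `K = K ρ + C (1 + M) + K (1 - ρ) / 2`, the balance of the induction step.
  set K : ℝ := 2 * C * (1 + M) / (1 - ρ) with hKdef
  have hK : 0 ≤ K := div_nonneg (by positivity) (by linarith)
  have hKeq : K * ((1 - ρ) / 2) = C * (1 + M) := by
    have : 1 - ρ ≠ 0 := by linarith
    rw [hKdef]
    field_simp
  refine ⟨K, τ, hK, hτ, hτ1, fun B hB a δ y ha hδ n => ?_⟩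
  set X := eulerSeq Γ B a δ y with hX
  set xs := eulerPath Γ B a δ y with hxs
  have hint : ∀ u v, IntervalIntegrable (fun r => B r (xs r)) volume u v := fun u v =>
    hB.intervalIntegrable_of_aemeasurable measurable_eulerPath.aemeasurable
  -- A single step is exact by construction. Longer runs are cut near the middle, a grid point,
  -- because the scheme satisfies its recursion only on the grid.
  induction n using Nat.strong_induction_on with
  | _ n ih =>
  intro i hT hnτ
  rcases Nat.lt_or_ge n 2 with hn | hn
  · interval_cases n
    · have := hΓ.bound (a + i * δ) (a + i * δ) (by positivity) le_rfl (by simpa using hT) (X i)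
      rw [sub_self, Real.zero_rpow (by linarith), mul_zero] at this
      simp only [add_zero, sub_self, intervalIntegral.integral_same, zero_sub, norm_neg]
      refine this.trans ?_
      positivity
    · rw [integral_eulerPath hδ i]
      have : X (i + 1) = X i
          + (∫ r in (a + i * δ)..(a + (i + 1 : ℕ) * δ), B r (X i))
          + Γ (a + i * δ) (a + (i + 1 : ℕ) * δ) (X i) := rfl
      rw [this]
      have e : ∀ p q r : V, p + q + r - p - q - r = 0 := fun p q r => by abel
      rw [e, norm_zero]
      positivity
  · obtain ⟨m, hm⟩ : ∃ m, m = n / 2 := ⟨_, rfl⟩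
    have hm1 : 1 ≤ m := by omega
    have hm2 : m < n := by omega
    have hm3 : 3 * m ≤ 2 * n := by omega
    have hm4 : 3 * (n - m) ≤ 2 * n := by omega
    have hnm : i + m + (n - m) = i + n := by omega
    have hmle : ((m : ℕ) : ℝ) ≤ n := by exact_mod_cast hm2.le
    have hcast : ((n - m : ℕ) : ℝ) = n - m := by rw [Nat.cast_sub hm2.le]
    set l : ℝ := n * δ with hl
    have hl0 : 0 ≤ l := by positivity
    have hl1 : l ≤ 1 := hnτ.trans hτ1
    set s := a + i * δ with hs
    set u := a + (i + m : ℕ) * δ with hu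
    set t := a + (i + n : ℕ) * δ with ht
    have hsu : u - s = m * δ := by
      rw [hu, hs]
      push_cast
      ring
    have hut : t - u = (n - m : ℕ) * δ := by
      rw [hu, ht, hcast]
      push_cast
      ring
    have hst : t - s = l := by
      rw [ht, hs, hl]
      push_cast
      ring
    have hs0 : 0 ≤ s := by positivity
    have hmδ : (m : ℝ) * δ ≤ l := by
      rw [hl]
      gcongr
    have hmδ0 : 0 ≤ (m : ℝ) * δ := by positivity
    have hnmδ0 : 0 ≤ ((n - m : ℕ) : ℝ) * δ := by positivity
    have hsumδ : (m : ℝ) * δ + ((n - m : ℕ) : ℝ) * δ = l := by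
      rw [hcast, hl]
      ring
    have hsu' : s ≤ u := by linarith
    have hut' : u ≤ t := by linarith
    have i1 := ih m hm2 i (by rw [← hu]; linarith) (by linarith)
    have i2 := ih (n - m) (by omega) (i + m) (by rw [hnm]; exact hT) (by linarith)
    rw [hnm] at i2
    have hpow : ∀ k : ℕ, 3 * k ≤ 2 * n → (k * δ) ^ (3 * κ) ≤ k * δ * (ρ * l ^ (3 * κ - 1)) := by
      intro k hk
      have hk' : (k : ℝ) * δ ≤ 2 / 3 * l := by
        have : (3 : ℝ) * k ≤ 2 * n := by exact_mod_cast hk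
        rw [hl]
        nlinarith
      have hk0 : 0 ≤ (k : ℝ) * δ := by positivity
      have e : (k * δ) ^ (3 * κ) = k * δ * ((k * δ) ^ (3 * κ - 1)) := by
        have := Real.rpow_add_of_nonneg hk0 zero_le_one (by linarith : 0 ≤ 3 * κ - 1)
        rw [Real.rpow_one] at this
        rw [← this]
        congr 1
        ring
      rw [e, hρ, ← Real.mul_rpow (by norm_num) hl0]
      have : 0 ≤ 3 * κ - 1 := by linarith
      gcongr
    have hsum : (m * δ) ^ (3 * κ) + ((n - m : ℕ) * δ) ^ (3 * κ) ≤ ρ * l ^ (3 * κ) := by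
      have e := Real.rpow_add_of_nonneg hl0 zero_le_one (by linarith : 0 ≤ 3 * κ - 1)
      rw [Real.rpow_one, show (1 : ℝ) + (3 * κ - 1) = 3 * κ by ring] at e
      calc _ ≤ m * δ * (ρ * l ^ (3 * κ - 1)) + (n - m : ℕ) * δ * (ρ * l ^ (3 * κ - 1)) :=
            add_le_add (hpow m hm3) (hpow (n - m) hm4)
        _ = (m * δ + (n - m : ℕ) * δ) * (ρ * l ^ (3 * κ - 1)) := by ring
        _ = _ := by
          rw [hsumδ, e]
          ring
    have hc := hΓ.cob s u t hs0 hsu' hut' hT (by linarith) (X i) (X (i + m))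
    rw [hst] at hc
    have hrem : ‖X (i + m) - X i - Γ s u (X i)‖ ≤ M * l + K * l ^ (3 * κ) := by
      have e : X (i + m) - X i - Γ s u (X i) = (∫ r in s..u, B r (xs r))
          + (X (i + m) - X i - (∫ r in s..u, B r (xs r)) - Γ s u (X i)) := by abel
      rw [e]
      refine (norm_add_le _ _).trans (add_le_add ((hB.norm_integral_le xs hsu').trans ?_)
        (i1.trans ?_))
      · rw [hsu]
        gcongr
      · gcongr
    have hdec : X (i + n) - X i - (∫ r in s..t, B r (xs r)) - Γ s t (X i)
        = (X (i + m) - X i - (∫ r in s..u, B r (xs r)) - Γ s u (X i))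
          + (X (i + n) - X (i + m) - (∫ r in u..t, B r (xs r)) - Γ u t (X (i + m)))
          + (-(Γ s t (X i) - Γ s u (X i) - Γ u t (X (i + m)))) := by
      rw [← intervalIntegral.integral_add_adjacent_intervals (hint s u) (hint u t)]
      abel
    have hlκ : l * l ^ κ ≤ l ^ (3 * κ) := by
      have e := Real.rpow_add_of_nonneg hl0 zero_le_one (by linarith : 0 ≤ κ)
      rw [Real.rpow_one] at e
      rw [← e]
      exact rpow_le_rpow_of_le_one hl0 hl1 (by linarith) (by linarith)
    rw [hdec]
    calc _ ≤ K * (m * δ) ^ (3 * κ) + K * ((n - m : ℕ) * δ) ^ (3 * κ)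
          + C * (l ^ (3 * κ) + (M * l + K * l ^ (3 * κ)) * l ^ κ) := by
          refine norm_add₃_le.trans (add_le_add (add_le_add i1 i2) ?_)
          rw [norm_neg]
          refine hc.trans ?_
          gcongr
      _ = K * ((m * δ) ^ (3 * κ) + ((n - m : ℕ) * δ) ^ (3 * κ))
          + C * (l ^ (3 * κ) + M * (l * l ^ κ)) + K * (C * l ^ κ) * l ^ (3 * κ) := by ring
      _ ≤ K * (ρ * l ^ (3 * κ)) + C * (l ^ (3 * κ) + M * l ^ (3 * κ))
          + K * ((1 - ρ) / 2) * l ^ (3 * κ) := by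
          have := hsmall l hl0 hnτ
          gcongr
      _ = (K * ρ + C * (1 + M) + K * ((1 - ρ) / 2)) * l ^ (3 * κ) := by ring
      _ = K * l ^ (3 * κ) := by
          rw [← hKeq]
          ring

/-- The local expansion of the Euler path between arbitrary times. -/
lemma eulerPath_bound (hδ : 0 < δ) (hT : T = b)
    (hE : ∀ n i : ℕ, a + (i + n : ℕ) * δ ≤ T → n * δ ≤ τ →
        ‖eulerSeq Γ B a δ y (i + n) - eulerSeq Γ B a δ y i
          - (∫ r in (a + i * δ)..(a + (i + n : ℕ) * δ), B r (eulerPath Γ B a δ y r))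
          - Γ (a + i * δ) (a + (i + n : ℕ) * δ) (eulerSeq Γ B a δ y i)‖
            ≤ K * (n * δ) ^ (3 * κ)) {u v : ℝ} (hu : a ≤ u) (huv : u ≤ v) (hv : v ≤ b)
    (hl : v - u + δ ≤ τ) :
    ‖eulerPath Γ B a δ y v - eulerPath Γ B a δ y u
      - (∫ r in (a + ⌊(u - a) / δ⌋₊ * δ)..(a + ⌊(v - a) / δ⌋₊ * δ), B r (eulerPath Γ B a δ y r))
      - Γ (a + ⌊(u - a) / δ⌋₊ * δ) (a + ⌊(v - a) / δ⌋₊ * δ) (eulerPath Γ B a δ y u)‖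
        ≤ K * ((a + ⌊(v - a) / δ⌋₊ * δ) - (a + ⌊(u - a) / δ⌋₊ * δ)) ^ (3 * κ) := by
  have h1 : ⌊(u - a) / δ⌋₊ ≤ ⌊(v - a) / δ⌋₊ := Nat.floor_le_floor (by gcongr)
  obtain ⟨n, hn⟩ := Nat.exists_eq_add_of_le h1
  have hv' : (⌊(v - a) / δ⌋₊ : ℝ) ≤ (v - a) / δ :=
    Nat.floor_le (div_nonneg (by linarith) hδ.le)
  have hu' : (u - a) / δ < ⌊(u - a) / δ⌋₊ + 1 := Nat.lt_floor_add_one _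
  rw [le_div_iff₀ hδ] at hv'
  rw [div_lt_iff₀ hδ] at hu'
  have hnc : (⌊(v - a) / δ⌋₊ : ℝ) = ⌊(u - a) / δ⌋₊ + n := by exact_mod_cast hn
  -- Rounding both times down to the grid may lengthen the interval, but by less than one step `δ`.
  have := hE n ⌊(u - a) / δ⌋₊ (by rw [← hn]; linarith) (by
    rw [hnc] at hv'
    linarith)
  rw [← hn] at this
  refine this.trans_eq ?_
  rw [hnc]
  congr 2
  ring

end Euler

/-! ### Existence of solutions by compactness of the Euler paths. -/

section Existence

/-- Sequences of bounded, asymptotically equicontinuous paths in a proper space have a pointwise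
convergent subsequence. -/
lemma exists_subseq_tendsto {V : Type*} [NormedAddCommGroup V] [ProperSpace V] {a b R : ℝ}
    (hab : a ≤ b) {f : ℕ → ℝ → V} (hR : ∀ n r, a ≤ r → r ≤ b → ‖f n r‖ ≤ R)
    (hf : ∀ ε > 0, ∃ η > 0, ∀ᶠ n in atTop, ∀ u v, a ≤ u → u ≤ v → v ≤ b → v - u < η →
      ‖f n v - f n u‖ < ε) :
    ∃ (φ : ℕ → ℕ) (x : ℝ → V), StrictMono φ ∧
      ∀ r, a ≤ r → r ≤ b → Tendsto (fun n => f (φ n) r) atTop (𝓝 (x r)) := by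
  -- A countable dense set of times, clamped to `[a, b]`; a diagonal subsequence converges on it,
  -- and asymptotic equicontinuity carries convergence to every time.
  let pr : ℚ → ℝ := fun q => max a (min b q)
  have hpr : ∀ q, a ≤ pr q ∧ pr q ≤ b := fun q =>
    ⟨le_max_left _ _, max_le hab (min_le_left _ _)⟩
  have hcomp : IsCompact (Set.pi univ fun _ : ℚ => Metric.closedBall (0 : V) R) :=
    isCompact_univ_pi fun _ => isCompact_closedBall _ _
  obtain ⟨g, -, φ, hφ, hg⟩ := hcomp.tendsto_subseq (x := fun n q => f n (pr q)) fun n q _ => by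
    rw [mem_closedBall_zero_iff]
    exact hR n _ (hpr q).1 (hpr q).2
  rw [tendsto_pi_nhds] at hg
  have hlim : ∀ r, ∃ z, a ≤ r → r ≤ b → Tendsto (fun n => f (φ n) r) atTop (𝓝 z) := by
    intro r
    by_cases hr : a ≤ r ∧ r ≤ b
    · have hC : CauchySeq fun n => f (φ n) r := by
        rw [Metric.cauchySeq_iff']
        intro ε hε
        obtain ⟨η, hη, hη'⟩ := hf (ε / 3) (by linarith)
        obtain ⟨q, hq1, hq2⟩ := exists_rat_btwn (show r < r + η by linarith)
        have hqr : r ≤ pr q ∨ pr q = b := by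
          rcases le_total b q with h | h
          · right
            simp only [pr, min_eq_left h, max_eq_right hab]
          · left
            exact le_max_of_le_right (by rw [min_eq_right h]; exact hq1.le)
        have hrq : r ≤ pr q := hqr.elim id fun h => h ▸ hr.2
        have hqη : pr q - r < η := by
          have : pr q ≤ max r q := max_le (hr.1.trans (le_max_left _ _))
            ((min_le_right _ _).trans (le_max_right _ _))
          rw [max_eq_right hq1.le] at this
          linarith
        have h1 := hφ.tendsto_atTop.eventually hη'
        have h2 := (hg q).cauchySeq
        rw [Metric.cauchySeq_iff] at h2
        obtain ⟨N₁, hN₁⟩ := h2 (ε / 3) (by linarith)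
        obtain ⟨N₂, hN₂⟩ := eventually_atTop.mp h1
        refine ⟨max N₁ N₂, fun n hn => ?_⟩
        have e1 := hN₂ n ((le_max_right _ _).trans hn) r (pr q) hr.1 hrq (hpr q).2 hqη
        have e2 := hN₂ (max N₁ N₂) (le_max_right _ _) r (pr q) hr.1 hrq (hpr q).2 hqη
        have e3 := hN₁ n ((le_max_left _ _).trans hn) (max N₁ N₂) (le_max_left _ _)
        simp only [Function.comp_apply] at e3
        rw [← dist_eq_norm] at e1 e2
        have t1 := dist_triangle (f (φ n) r) (f (φ n) (pr q)) (f (φ (max N₁ N₂)) r)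
        have t2 := dist_triangle (f (φ n) (pr q)) (f (φ (max N₁ N₂)) (pr q))
          (f (φ (max N₁ N₂)) r)
        rw [dist_comm] at e1
        linarith
      obtain ⟨z, hz⟩ := cauchySeq_tendsto_of_complete hC
      exact ⟨z, fun _ _ => hz⟩
    · exact ⟨0, fun h1 h2 => absurd ⟨h1, h2⟩ hr⟩
  choose x hx using hlim
  exact ⟨φ, x, hφ, hx⟩

variable {V : Type*} [NormedAddCommGroup V] [NormedSpace ℝ V] {κ C T : ℝ}
  {Γ : ℝ → ℝ → V → V} {Λ : ℝ → ℝ → V → V → V} {M : ℝ}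
  [MeasurableSpace V] [BorelSpace V] [ProperSpace V]

/-- Existence of solutions, with bounds that depend on the germ and the bound of the drift. -/
theorem IsGerm.exists_solution (hΓ : IsGerm κ C T Γ Λ) (hκ : 1 / 3 < κ) (hκ2 : κ ≤ 1 / 2)
    (hC : 0 ≤ C) (hM : 0 ≤ M) :
    ∃ K τ : ℝ, 0 ≤ K ∧ 0 < τ ∧ τ ≤ 1 ∧ ∀ (B : ℝ → V → V), IsDriftField M B →
      ∀ (a : ℝ) (y : V), 0 ≤ a → a < T → ∃ x : ℝ → V, x a = y ∧ RDEBound κ K τ Γ B a T x := by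
  obtain ⟨K, τ, hK, hτ, hτ1, hE⟩ := hΓ.exists_euler_bound hκ hκ2 hC hM
  refine ⟨K, τ / 2, hK, by linarith, by linarith, fun B hB a y ha haT => ?_⟩
  have hTa : 0 < T - a := by linarith
  obtain ⟨n₀, hn₀⟩ := exists_nat_ge ((T - a) / (τ / 2))
  -- The offset `n₀` keeps every step below `τ / 2`, so windows of length `τ / 2` satisfy the Euler
  -- bound even after rounding.
  set δ : ℕ → ℝ := fun n => (T - a) / ((n + n₀ : ℕ) + 1) with hδdef
  have hδ : ∀ n, 0 < δ n := fun n => by positivity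
  have hδlim : Tendsto δ atTop (𝓝 0) := by
    have h1 : Tendsto (fun n : ℕ => (T - a) / ((n : ℝ) + 1)) atTop (𝓝 0) := by
      have := (tendsto_one_div_add_atTop_nhds_zero_nat (𝕜 := ℝ)).const_mul (T - a)
      simpa [div_eq_mul_inv] using this
    exact h1.comp (tendsto_add_atTop_nat n₀)
  have hδτ : ∀ n, δ n ≤ τ / 2 := by
    intro n
    rw [div_le_iff₀ (by linarith)] at hn₀
    rw [hδdef]
    simp only
    rw [div_le_iff₀ (by positivity)]
    push_cast
    have : 0 ≤ τ / 2 * (n : ℝ) := by positivity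
    nlinarith
  set f : ℕ → ℝ → V := fun n => eulerPath Γ B a (δ n) y with hf
  set fl : ℕ → ℝ → ℝ := fun n r => a + ⌊(r - a) / δ n⌋₊ * δ n with hfl
  have hflle : ∀ n r, a ≤ r → fl n r ≤ r := by
    intro n r hr
    have := Nat.floor_le (div_nonneg (sub_nonneg.mpr hr) (hδ n).le)
    rw [le_div_iff₀ (hδ n)] at this
    simp only [hfl]
    linarith
  have hfla : ∀ n r, a ≤ fl n r := fun n r => by
    have : 0 ≤ (⌊(r - a) / δ n⌋₊ : ℝ) * δ n := mul_nonneg (Nat.cast_nonneg _) (hδ n).le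
    simp only [hfl]
    linarith
  have hflδ : ∀ n r, r - δ n ≤ fl n r := by
    intro n r
    have := Nat.lt_floor_add_one ((r - a) / δ n)
    rw [div_lt_iff₀ (hδ n)] at this
    simp only [hfl]
    linarith
  have hflmono : ∀ n u v, u ≤ v → fl n u ≤ fl n v := by
    intro n u v huv
    have h1 : (⌊(u - a) / δ n⌋₊ : ℝ) ≤ ⌊(v - a) / δ n⌋₊ := by
      exact_mod_cast Nat.floor_le_floor (div_le_div_of_nonneg_right (by linarith) (hδ n).le)
    simp only [hfl]
    have := (hδ n).le
    gcongr
  have hbd : ∀ n u v, a ≤ u → u ≤ v → v ≤ T → v - u + δ n ≤ τ →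
      ‖f n v - f n u - (∫ r in (fl n u)..(fl n v), B r (f n r)) - Γ (fl n u) (fl n v) (f n u)‖
        ≤ K * (fl n v - fl n u) ^ (3 * κ) := fun n u v h1 h2 h3 h4 =>
    eulerPath_bound (hδ n) rfl (fun k i => hE B hB a (δ n) y ha (hδ n) k i) h1 h2 h3 h4
  have hhol : ∀ n u v, a ≤ u → u ≤ v → v ≤ T → v - u + δ n ≤ τ →
      ‖f n v - f n u‖ ≤ (M + C + K) * (v - u + δ n) ^ κ := by
    intro n u v h1 h2 h3 h4
    have hl0 : 0 ≤ v - u + δ n := by linarith [hδ n]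
    have e1 := hbd n u v h1 h2 h3 h4
    have e2 := hB.norm_integral_le (f n) (hflmono n u v h2)
    have e3 := hΓ.bound (fl n u) (fl n v) (ha.trans (hfla n u)) (hflmono n u v h2)
      ((hflle n v (h1.trans h2)).trans h3) (f n u)
    have hle : fl n v - fl n u ≤ v - u + δ n := by linarith [hflle n v (h1.trans h2), hflδ n u]
    have hle0 : 0 ≤ fl n v - fl n u := by linarith [hflmono n u v h2]
    have e4 : f n v - f n u = (f n v - f n u - (∫ r in (fl n u)..(fl n v), B r (f n r))
        - Γ (fl n u) (fl n v) (f n u)) + (∫ r in (fl n u)..(fl n v), B r (f n r))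
        + Γ (fl n u) (fl n v) (f n u) := by abel
    have hκ0 : 0 ≤ κ := by linarith
    have w1 : v - u + δ n ≤ (v - u + δ n) ^ κ := by
      simpa using rpow_le_rpow_of_le_one (l := v - u + δ n) (a := 1) (b := κ) hl0 (by linarith)
        hκ0 (by linarith)
    have w2 : (v - u + δ n) ^ (3 * κ) ≤ (v - u + δ n) ^ κ :=
      rpow_le_rpow_of_le_one hl0 (by linarith) hκ0 (by linarith)
    rw [e4]
    calc _ ≤ K * (fl n v - fl n u) ^ (3 * κ) + M * (fl n v - fl n u)
          + C * (fl n v - fl n u) ^ κ := norm_add₃_le.trans (add_le_add (add_le_add e1 e2) e3)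
      _ ≤ K * (v - u + δ n) ^ (3 * κ) + M * (v - u + δ n) + C * (v - u + δ n) ^ κ := by gcongr
      _ ≤ K * (v - u + δ n) ^ κ + M * (v - u + δ n) ^ κ + C * (v - u + δ n) ^ κ := by gcongr
      _ = _ := by ring
  have hfa : ∀ n, f n a = y := by
    intro n
    simp [hf, eulerPath, eulerSeq]
  set N : ℝ := M + C + K with hN
  have hN0 : 0 ≤ N := by positivity
  have hbounded : ∀ n r, a ≤ r → r ≤ T → ‖f n r‖ ≤ 2 ^ n₀ * (‖y‖ + N) := by
    intro n r h1 h2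
    have := le_of_windows (f := fun r => ‖f n r‖) (a := a) (b := T) (τ := τ / 2) (e := N)
      (by linarith) (fun u v g1 g2 g3 g4 => ?_) n₀ r h1 h2 ?_ (by positivity) hN0
    · simpa only [hfa] using this
    · have e1 := hhol n u v g1 g2 g3 (by linarith [hδτ n])
      have hl0 : 0 ≤ v - u + δ n := by linarith [hδ n]
      have e2 : (v - u + δ n) ^ κ ≤ 1 :=
        Real.rpow_le_one hl0 (by linarith [hδτ n]) (by linarith)
      have e3 : ‖f n v‖ ≤ ‖f n u‖ + ‖f n v - f n u‖ := by
        have : f n v = f n u + (f n v - f n u) := by abel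
        calc ‖f n v‖ = ‖f n u + (f n v - f n u)‖ := by rw [← this]
          _ ≤ _ := norm_add_le _ _
      have e4 : (M + C + K) * (v - u + δ n) ^ κ ≤ N := mul_le_of_le_one_right hN0 e2
      linarith [norm_nonneg (f n u)]
    · rw [div_le_iff₀ (by linarith)] at hn₀
      linarith
  obtain ⟨φ, x, hφ, hx⟩ := exists_subseq_tendsto haT.le hbounded (by
      intro ε hε
      obtain ⟨η, hη, hη1, hsm⟩ := exists_mul_rpow_le (κ := κ) (by linarith) N (half_pos hε)
      refine ⟨min (η / 2) (τ / 2), lt_min (by linarith) (by linarith), ?_⟩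
      filter_upwards [hδlim.eventually (gt_mem_nhds (half_pos hη))] with n hn u v h1 h2 h3 h4
      have h5 := lt_of_lt_of_le h4 (min_le_left _ _)
      have h6 := lt_of_lt_of_le h4 (min_le_right _ _)
      have h7 := hhol n u v h1 h2 h3 (by linarith [hδτ n])
      have h8 := hsm (v - u + δ n) (by linarith [hδ n]) (by linarith)
      linarith)
  refine ⟨x, ?_, ?_⟩
  · have := hx a le_rfl haT.le
    simp only [hfa] at this
    exact (tendsto_nhds_unique this tendsto_const_nhds)
  intro u v h1 h2 h3 h4
  -- The continuity of the germ is available for `u < v` only; at `u = v` the germ vanishes by its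
  -- size bound.
  rcases h2.eq_or_lt with rfl | huv
  · have := hΓ.bound u u (ha.trans h1) le_rfl h3 (x u)
    rw [sub_self, Real.zero_rpow (by linarith), mul_zero] at this
    simp only [sub_self, intervalIntegral.integral_same, zero_sub, norm_neg]
    refine this.trans ?_
    positivity
  have hflt : ∀ r, a ≤ r → Tendsto (fun n => fl (φ n) r) atTop (𝓝 r) := by
    intro r hr
    have h5 : Tendsto (fun n => r - δ (φ n)) atTop (𝓝 (r - 0)) :=
      (hδlim.comp hφ.tendsto_atTop).const_sub r
    rw [sub_zero] at h5
    exact tendsto_of_tendsto_of_tendsto_of_le_of_le h5 tendsto_const_nhds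
      (fun n => hflδ (φ n) r) (fun n => hflle (φ n) r hr)
  have hint : ∀ n s t, IntervalIntegrable (fun r => B r (f n r)) volume s t := fun n s t =>
    hB.intervalIntegrable_of_aemeasurable measurable_eulerPath.aemeasurable
  have hlim1 : Tendsto (fun n => ∫ r in u..v, B r (f (φ n) r)) atTop
      (𝓝 (∫ r in u..v, B r (x r))) := by
    refine intervalIntegral.tendsto_integral_filter_of_dominated_convergence (fun _ => M)
      (Eventually.of_forall fun n =>
        hB.aestronglyMeasurable measurable_eulerPath.aemeasurable)
      (Eventually.of_forall fun n => Eventually.of_forall fun r _ => hB.bound _ _)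
      intervalIntegrable_const (Eventually.of_forall fun r hr => ?_)
    rw [uIoc_of_le h2] at hr
    rw [tendsto_iff_norm_sub_tendsto_zero]
    have h5 := tendsto_iff_norm_sub_tendsto_zero.mp (hx r (h1.trans hr.1.le) (hr.2.trans h3))
    refine squeeze_zero (fun _ => norm_nonneg _) (fun n => hB.lip r _ _) ?_
    simpa using h5.const_mul M
  -- The gap between a time and its grid point shrinks, so the drift integral over it vanishes.
  have hzero : ∀ r, a ≤ r → Tendsto (fun n => ∫ r' in (fl (φ n) r)..r, B r' (f (φ n) r')) atTop
      (𝓝 0) := by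
    intro r hr
    have h5 : Tendsto (fun n => M * (r - fl (φ n) r)) atTop (𝓝 (M * (r - r))) :=
      ((hflt r hr).const_sub r).const_mul M
    rw [sub_self, mul_zero] at h5
    exact squeeze_zero_norm (fun n => hB.norm_integral_le (f (φ n)) (hflle (φ n) r hr)) h5
  have hlim2 : Tendsto (fun n => ∫ r in (fl (φ n) u)..(fl (φ n) v), B r (f (φ n) r)) atTop
      (𝓝 (∫ r in u..v, B r (x r))) := by
    have h5 := ((hzero u h1).add hlim1).sub (hzero v (h1.trans h2))
    rw [zero_add, sub_zero] at h5
    refine h5.congr fun n => ?_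
    rw [intervalIntegral.integral_add_adjacent_intervals (hint _ _ _) (hint _ _ _),
      sub_eq_iff_eq_add,
      intervalIntegral.integral_add_adjacent_intervals (hint _ _ _) (hint _ _ _)]
  -- Grid points approach from the left, so one-sided continuity of the germ is enough; the moving
  -- space argument is handled by its Lipschitz bound.
  have hlim3 : Tendsto (fun n => Γ (fl (φ n) u) (fl (φ n) v) (f (φ n) u)) atTop
      (𝓝 (Γ u v (x u))) := by
    have h5 := hΓ.cont u v (ha.trans h1) huv h3 (x u) (fun n => fl (φ n) u) (fun n => fl (φ n) v)
      (fun n => ha.trans (hfla _ _)) (fun n => hflle _ u h1) (fun n => hflle _ v (h1.trans h2))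
      (hflt u h1) (hflt v (h1.trans h2))
    have h6 : Tendsto (fun n => Γ (fl (φ n) u) (fl (φ n) v) (f (φ n) u)
        - Γ (fl (φ n) u) (fl (φ n) v) (x u)) atTop (𝓝 0) := by
      have h7 := tendsto_iff_norm_sub_tendsto_zero.mp (hx u h1 (h2.trans h3))
      have h8 : Tendsto (fun n => C * (fl (φ n) v - fl (φ n) u) ^ κ * ‖f (φ n) u - x u‖) atTop
          (𝓝 (C * (v - u) ^ κ * 0)) :=
        ((((hflt v (h1.trans h2)).sub (hflt u h1)).rpow_const
          (Or.inr (by linarith))).const_mul C).mul h7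
      rw [mul_zero] at h8
      exact squeeze_zero_norm (fun n => hΓ.lip _ _ (ha.trans (hfla _ _)) (hflmono _ u v h2)
        ((hflle _ v (h1.trans h2)).trans h3) _ _) h8
    simpa using h6.add h5
  refine le_of_tendsto_of_tendsto
    ((((hx v (h1.trans h2) h3).sub (hx u h1 (h2.trans h3))).sub hlim2).sub hlim3).norm
    ((((hflt v (h1.trans h2)).sub (hflt u h1)).rpow_const (Or.inr (by linarith))).const_mul K)
    (Eventually.of_forall fun n => ?_)
  exact hbd (φ n) u v h1 h2 h3 (by linarith [hδτ (φ n)])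

end Existence

/-! ### Mean value, second difference and interpolation inequalities. -/

section Calculus

variable {V W : Type*} [NormedAddCommGroup V] [NormedSpace ℝ V] [NormedAddCommGroup W]
  [NormedSpace ℝ W] {g : V → W} {M : ℝ}

lemma norm_sub_le_of_fderiv_le (hg : Differentiable ℝ g) (hM : ∀ x, ‖fderiv ℝ g x‖ ≤ M)
    (x y : V) : ‖g y - g x‖ ≤ M * ‖y - x‖ :=
  convex_univ.norm_image_sub_le_of_norm_fderiv_le (fun z _ => hg z) (fun z _ => hM z)
    (mem_univ x) (mem_univ y)

lemma norm_sub_sub_fderiv_le (hg : Differentiable ℝ g)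
    (hM : ∀ x y, ‖fderiv ℝ g y - fderiv ℝ g x‖ ≤ M * ‖y - x‖) (hM0 : 0 ≤ M) {p x y : V} {r : ℝ}
    (hx : ‖x - p‖ ≤ r) (hy : ‖y - p‖ ≤ r) :
    ‖g y - g x - fderiv ℝ g p (y - x)‖ ≤ M * r * ‖y - x‖ := by
  refine (convex_closedBall p r).norm_image_sub_le_of_norm_hasFDerivWithin_le'
    (f' := fderiv ℝ g) (fun z _ => (hg z).hasFDerivAt.hasFDerivWithinAt) (fun z hz => ?_)
    (by rwa [mem_closedBall_iff_norm]) (by rwa [mem_closedBall_iff_norm])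
  rw [mem_closedBall_iff_norm] at hz
  exact (hM p z).trans (by gcongr)

lemma norm_taylor_le (hg : Differentiable ℝ g)
    (hM : ∀ x y, ‖fderiv ℝ g y - fderiv ℝ g x‖ ≤ M * ‖y - x‖) (hM0 : 0 ≤ M) (x h : V) :
    ‖g (x + h) - g x - fderiv ℝ g x h‖ ≤ M * ‖h‖ ^ 2 := by
  have := norm_sub_sub_fderiv_le hg hM hM0 (p := x) (x := x) (y := x + h) (r := ‖h‖) (by simp)
    (by simp)
  rw [add_sub_cancel_left] at this
  refine this.trans_eq ?_
  ring

/-- The second difference of a function with Lipschitz derivative. -/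
lemma norm_four_point_le (hg : Differentiable ℝ g) (hM1 : ∀ x, ‖fderiv ℝ g x‖ ≤ M)
    (hM : ∀ x y, ‖fderiv ℝ g y - fderiv ℝ g x‖ ≤ M * ‖y - x‖) (p q p' q' : V) :
    ‖(g q' - g q) - (g p' - g p)‖
      ≤ M * ‖(q' - q) - (p' - p)‖ + M * ‖q - p‖ * ‖p' - p‖ := by
  -- The mean value inequality is applied to the translation difference `z ↦ g (z + (q - p)) - g z`,
  -- with derivative of norm at most `M ‖q - p‖`; the failure of the four points to form a
  -- parallelogram costs the first term.
  have hd : ∀ z, HasFDerivAt (fun z => g (z + (q - p)) - g z)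
      (fderiv ℝ g (z + (q - p)) - fderiv ℝ g z) z := fun z =>
    ((hasFDerivAt_comp_add_right (q - p)).mpr (hg (z + (q - p))).hasFDerivAt).fun_sub
      (hg z).hasFDerivAt
  have h1 := convex_univ.norm_image_sub_le_of_norm_hasFDerivWithin_le (C := M * ‖q - p‖)
    (fun z _ => (hd z).hasFDerivWithinAt) (fun z _ => by simpa using hM z (z + (q - p)))
    (mem_univ p) (mem_univ p')
  have h2 := norm_sub_le_of_fderiv_le hg hM1 (p' + (q - p)) q'
  have e1 : (g q' - g q) - (g p' - g p) = (g q' - g (p' + (q - p)))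
      + ((g (p' + (q - p)) - g p') - (g (p + (q - p)) - g p)) := by
    rw [add_sub_cancel]
    abel
  have e2 : q' - (p' + (q - p)) = (q' - q) - (p' - p) := by abel
  rw [e1]
  rw [e2] at h2
  exact (norm_add_le _ _).trans (add_le_add h2 h1)

/-- Second-order terms cancel in a centred difference, so the error is cubic. The derivative in `z`
is a sum of values of `fderiv ℝ g` at opposite points, where the linear terms cancel. -/
lemma norm_centered_le (hg : Differentiable ℝ g) (hg' : Differentiable ℝ (fderiv ℝ g))
    (hM : ∀ x y, ‖fderiv ℝ (fderiv ℝ g) y - fderiv ℝ (fderiv ℝ g) x‖ ≤ M * ‖y - x‖)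
    (hM0 : 0 ≤ M) (x h : V) :
    ‖g (x + h) - g (x - h) - (2 : ℝ) • fderiv ℝ g x h‖ ≤ 2 * M * ‖h‖ ^ 3 := by
  have hd : ∀ z, HasFDerivAt (fun z => g (x + z) - g (x - z))
      (fderiv ℝ g (x + z) + fderiv ℝ g (x - z)) z := by
    intro z
    have h1 : HasFDerivAt (fun z => g (x + z)) (fderiv ℝ g (x + z)) z := by
      exact (hg (x + z)).hasFDerivAt.comp z ((hasFDerivAt_id z).const_add x)
    have h2 : HasFDerivAt (fun z => g (x - z)) (-fderiv ℝ g (x - z)) z := by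
      have := (hg (x - z)).hasFDerivAt.comp z ((hasFDerivAt_id z).const_sub x)
      rwa [ContinuousLinearMap.comp_neg] at this
    have h3 := h1.fun_sub h2
    rwa [sub_neg_eq_add] at h3
  have h0 : (0 : V) ∈ Metric.closedBall (0 : V) ‖h‖ := by simp
  have hh : h ∈ Metric.closedBall (0 : V) ‖h‖ := by simp
  have := (convex_closedBall (0 : V) ‖h‖).norm_image_sub_le_of_norm_hasFDerivWithin_le'
    (φ := (2 : ℝ) • fderiv ℝ g x) (C := 2 * M * ‖h‖ ^ 2)
    (fun z _ => (hd z).hasFDerivWithinAt) (fun z hz => ?_) h0 hh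
  · simp only [add_zero, sub_zero, sub_self] at this
    refine this.trans_eq ?_
    ring
  · rw [mem_closedBall_zero_iff] at hz
    have e1 := norm_taylor_le hg' hM hM0 x z
    have e2 := norm_taylor_le hg' hM hM0 x (-z)
    have e3 : fderiv ℝ g (x + z) + fderiv ℝ g (x - z) - (2 : ℝ) • fderiv ℝ g x
        = (fderiv ℝ g (x + z) - fderiv ℝ g x - fderiv ℝ (fderiv ℝ g) x z)
          + (fderiv ℝ g (x + -z) - fderiv ℝ g x - fderiv ℝ (fderiv ℝ g) x (-z)) := by
      rw [map_neg, two_smul, ← sub_eq_add_neg x z]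
      abel
    rw [e3]
    rw [norm_neg] at e2
    calc _ ≤ M * ‖z‖ ^ 2 + M * ‖z‖ ^ 2 := (norm_add_le _ _).trans (add_le_add e1 e2)
      _ = 2 * M * ‖z‖ ^ 2 := by ring
      _ ≤ _ := by gcongr

/-- Interpolation of the first derivative between order zero and order three. -/
lemma norm_fderiv_le_of_third (hg : Differentiable ℝ g) (hg' : Differentiable ℝ (fderiv ℝ g))
    (hM : ∀ x y, ‖fderiv ℝ (fderiv ℝ g) y - fderiv ℝ (fderiv ℝ g) x‖ ≤ M * ‖y - x‖)
    (hM0 : 0 ≤ M) {δ : ℝ} (hδ : 0 < δ) (hg0 : ∀ x, ‖g x‖ ≤ M * δ ^ 3) (x : V) :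
    ‖fderiv ℝ g x‖ ≤ 2 * M * δ ^ 2 := by
  refine ContinuousLinearMap.opNorm_le_of_unit_norm (by positivity) fun e he => ?_
  -- At step `δ` the values of `g` and the centred error each contribute `2 M δ ^ 3`; dividing by `2
  -- δ` gives the claim.
  have h1 := norm_centered_le hg hg' hM hM0 x (δ • e)
  rw [norm_smul, he, mul_one, Real.norm_of_nonneg hδ.le, map_smul] at h1
  have h2 : ‖(2 : ℝ) • δ • fderiv ℝ g x e‖ = 2 * δ * ‖fderiv ℝ g x e‖ := by
    rw [norm_smul, norm_smul, Real.norm_of_nonneg hδ.le, Real.norm_ofNat, mul_assoc]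
  have h3 : ‖(2 : ℝ) • δ • fderiv ℝ g x e‖ ≤ 4 * M * δ ^ 3 := by
    have e1 : (2 : ℝ) • δ • fderiv ℝ g x e = g (x + δ • e) - g (x - δ • e)
      - (g (x + δ • e) - g (x - δ • e) - (2 : ℝ) • δ • fderiv ℝ g x e) := by abel
    rw [e1]
    have e2 := norm_sub_le (g (x + δ • e) - g (x - δ • e))
      (g (x + δ • e) - g (x - δ • e) - (2 : ℝ) • δ • fderiv ℝ g x e)
    have e3 := norm_sub_le (g (x + δ • e)) (g (x - δ • e))
    linarith [hg0 (x + δ • e), hg0 (x - δ • e)]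
  rw [h2] at h3
  have h4 : 2 * δ * ‖fderiv ℝ g x e‖ ≤ 2 * δ * (2 * M * δ ^ 2) := by
    refine h3.trans_eq ?_
    ring
  exact le_of_mul_le_mul_left h4 (by positivity)

/-- Interpolation of the first derivative between order zero and order two. -/
lemma norm_fderiv_le_of_second (hg : Differentiable ℝ g)
    (hM : ∀ x y, ‖fderiv ℝ g y - fderiv ℝ g x‖ ≤ M * ‖y - x‖)
    (hM0 : 0 ≤ M) {δ A : ℝ} (hA : 0 ≤ A) (hδ : 0 < δ) (hg0 : ∀ x, ‖g x‖ ≤ A * δ ^ 2) (x : V) :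
    ‖fderiv ℝ g x‖ ≤ (2 * A + M) * δ := by
  refine ContinuousLinearMap.opNorm_le_of_unit_norm (by positivity) fun e he => ?_
  have h1 := norm_taylor_le hg hM hM0 x (δ • e)
  rw [norm_smul, he, mul_one, Real.norm_of_nonneg hδ.le, map_smul] at h1
  have h2 : ‖δ • fderiv ℝ g x e‖ = δ * ‖fderiv ℝ g x e‖ := by
    rw [norm_smul, Real.norm_of_nonneg hδ.le]
  have h3 : ‖δ • fderiv ℝ g x e‖ ≤ 2 * A * δ ^ 2 + M * δ ^ 2 := by
    have e1 : δ • fderiv ℝ g x e = g (x + δ • e) - g x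
      - (g (x + δ • e) - g x - δ • fderiv ℝ g x e) := by abel
    rw [e1]
    have e2 := norm_sub_le (g (x + δ • e) - g x) (g (x + δ • e) - g x - δ • fderiv ℝ g x e)
    have e3 := norm_sub_le (g (x + δ • e)) (g x)
    linarith [hg0 (x + δ • e), hg0 x]
  rw [h2] at h3
  have h4 : δ * ‖fderiv ℝ g x e‖ ≤ δ * ((2 * A + M) * δ) := by
    refine h3.trans_eq ?_
    ring
  exact le_of_mul_le_mul_left h4 hδ

end Calculus

/-! ### Regularity of the diffusion coefficient in time. -/

/-- Uniform bounds for a coefficient that is `C³` in space and Lipschitz in time. -/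
structure IsRegular {V W : Type*} [NormedAddCommGroup V] [NormedSpace ℝ V]
    [NormedAddCommGroup W] [NormedSpace ℝ W] (M T : ℝ) (σ : ℝ → V → W) : Prop where
  diff : ∀ t, 0 ≤ t → t ≤ T → Differentiable ℝ (σ t)
  diff' : ∀ t, 0 ≤ t → t ≤ T → Differentiable ℝ (fderiv ℝ (σ t))
  bound : ∀ t, 0 ≤ t → t ≤ T → ∀ x, ‖σ t x‖ ≤ M
  bound' : ∀ t, 0 ≤ t → t ≤ T → ∀ x, ‖fderiv ℝ (σ t) x‖ ≤ M
  bound'' : ∀ t, 0 ≤ t → t ≤ T → ∀ x, ‖fderiv ℝ (fderiv ℝ (σ t)) x‖ ≤ M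
  lip'' : ∀ t, 0 ≤ t → t ≤ T → ∀ x y,
    ‖fderiv ℝ (fderiv ℝ (σ t)) y - fderiv ℝ (fderiv ℝ (σ t)) x‖ ≤ M * ‖y - x‖
  time : ∀ s t, 0 ≤ s → s ≤ t → t ≤ T → ∀ x, ‖σ t x - σ s x‖ ≤ M * (t - s)
  time' : ∀ s t, 0 ≤ s → s ≤ t → t ≤ T → ∀ x,
    ‖fderiv ℝ (σ t) x - fderiv ℝ (σ s) x‖ ≤ M * (t - s) ^ (2 / 3 : ℝ)
  time'' : ∀ s t, 0 ≤ s → s ≤ t → t ≤ T → ∀ x,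
    ‖fderiv ℝ (fderiv ℝ (σ t)) x - fderiv ℝ (fderiv ℝ (σ s)) x‖ ≤ M * (t - s) ^ (1 / 3 : ℝ)

-- No mixed derivative is at hand. But `σ t - σ s` is of size `t - s` and has bounded space
-- derivatives up to order three, so interpolation at the scale `δ = (t - s)^(1/3)` bounds its first
-- derivative by `δ ^ 2` and its second by `δ`, up to constants.
set_option maxSynthPendingDepth 4 in
lemma exists_isRegular {V W : Type*} [NormedAddCommGroup V] [NormedSpace ℝ V]
    [NormedAddCommGroup W] [NormedSpace ℝ W] {T : ℝ} {σ : ℝ → V → W}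
    (hσ : ∀ t ∈ Icc 0 T, ContDiff ℝ 3 (σ t))
    (hσb : ∀ j ≤ 3, ∃ M : ℝ, ∀ t ∈ Icc 0 T, ∀ x, ‖iteratedFDeriv ℝ j (σ t) x‖ ≤ M)
    {Dt : ℝ × V → W}
    (hDt : ∀ t ∈ Icc 0 T, ∀ x, HasDerivWithinAt (fun r => σ r x) (Dt (t, x)) (Icc 0 T) t)
    {M4 : ℝ} (h4 : ∀ t ∈ Icc 0 T, ∀ x, ‖Dt (t, x)‖ ≤ M4) :
    ∃ M : ℝ, 0 ≤ M ∧ IsRegular M T σ := by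
  obtain ⟨M0, h0⟩ := hσb 0 (by norm_num)
  obtain ⟨M1, h1⟩ := hσb 1 (by norm_num)
  obtain ⟨M2, h2⟩ := hσb 2 (by norm_num)
  obtain ⟨M3, h3⟩ := hσb 3 le_rfl
  set M : ℝ := |M0| + |M1| + |M2| + |M3| + |M4| with hM
  have a0 := abs_nonneg M0
  have a1 := abs_nonneg M1
  have a2 := abs_nonneg M2
  have a3 := abs_nonneg M3
  have a4 := abs_nonneg M4
  have hM0 : 0 ≤ M := by positivity
  have hc : ∀ t, 0 ≤ t → t ≤ T → ContDiff ℝ 3 (σ t) := fun t g1 g2 =>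
    hσ t ⟨g1, g2⟩
  have hc' : ∀ t, 0 ≤ t → t ≤ T → ContDiff ℝ 2 (fderiv ℝ (σ t)) := fun t g1 g2 =>
    (hc t g1 g2).fderiv_right (by norm_num)
  have hc'' : ∀ t, 0 ≤ t → t ≤ T → ContDiff ℝ 1 (fderiv ℝ (fderiv ℝ (σ t))) := fun t g1 g2 =>
    (hc' t g1 g2).fderiv_right (by norm_num)
  have d0 : ∀ t, 0 ≤ t → t ≤ T → Differentiable ℝ (σ t) := fun t g1 g2 =>
    (hc t g1 g2).differentiable (by norm_num)
  have d1 : ∀ t, 0 ≤ t → t ≤ T → Differentiable ℝ (fderiv ℝ (σ t)) := fun t g1 g2 =>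
    (hc' t g1 g2).differentiable (by norm_num)
  have d2 : ∀ t, 0 ≤ t → t ≤ T → Differentiable ℝ (fderiv ℝ (fderiv ℝ (σ t))) :=
    fun t g1 g2 => (hc'' t g1 g2).differentiable (by norm_num)
  have b0 : ∀ t, 0 ≤ t → t ≤ T → ∀ x, ‖σ t x‖ ≤ M := fun t g1 g2 x => by
    have := h0 t ⟨g1, g2⟩ x
    rw [norm_iteratedFDeriv_zero] at this
    linarith [le_abs_self M0]
  have b1 : ∀ t, 0 ≤ t → t ≤ T → ∀ x, ‖fderiv ℝ (σ t) x‖ ≤ M := fun t g1 g2 x => by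
    have := h1 t ⟨g1, g2⟩ x
    rw [← norm_iteratedFDeriv_fderiv, norm_iteratedFDeriv_zero] at this
    linarith [le_abs_self M1]
  have b2 : ∀ t, 0 ≤ t → t ≤ T → ∀ x, ‖fderiv ℝ (fderiv ℝ (σ t)) x‖ ≤ M := fun t g1 g2 x => by
    have := h2 t ⟨g1, g2⟩ x
    rw [← norm_iteratedFDeriv_fderiv, ← norm_iteratedFDeriv_fderiv,
      norm_iteratedFDeriv_zero] at this
    linarith [le_abs_self M2]
  have b3 : ∀ t, 0 ≤ t → t ≤ T → ∀ x, ‖fderiv ℝ (fderiv ℝ (fderiv ℝ (σ t))) x‖ ≤ M :=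
    fun t g1 g2 x => by
    have := h3 t ⟨g1, g2⟩ x
    rw [← norm_iteratedFDeriv_fderiv, ← norm_iteratedFDeriv_fderiv,
      ← norm_iteratedFDeriv_fderiv, norm_iteratedFDeriv_zero] at this
    linarith [le_abs_self M3]
  have l2 : ∀ t, 0 ≤ t → t ≤ T → ∀ x y,
      ‖fderiv ℝ (fderiv ℝ (σ t)) y - fderiv ℝ (fderiv ℝ (σ t)) x‖ ≤ M * ‖y - x‖ :=
    fun t g1 g2 x y => norm_sub_le_of_fderiv_le (d2 t g1 g2) (b3 t g1 g2) x y
  have ti0 : ∀ s t, 0 ≤ s → s ≤ t → t ≤ T → ∀ x, ‖σ t x - σ s x‖ ≤ M * (t - s) := by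
    intro s t g1 g2 g3 x
    have := (convex_Icc (0 : ℝ) T).norm_image_sub_le_of_norm_hasDerivWithin_le (C := M)
      (f := fun r => σ r x) (fun r hr => hDt r hr x) (fun r hr => by
        have := h4 r hr x
        linarith [le_abs_self M4]) (x := s) (y := t) ⟨g1, g2.trans g3⟩ ⟨g1.trans g2, g3⟩
    rwa [Real.norm_of_nonneg (by linarith)] at this
  have key : ∀ s t, 0 ≤ s → s ≤ t → t ≤ T → ∀ x,
      ‖fderiv ℝ (σ t) x - fderiv ℝ (σ s) x‖ ≤ 4 * M * (t - s) ^ (2 / 3 : ℝ) ∧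
      ‖fderiv ℝ (fderiv ℝ (σ t)) x - fderiv ℝ (fderiv ℝ (σ s)) x‖
        ≤ 10 * M * (t - s) ^ (1 / 3 : ℝ) := by
    intro s t g1 g2 g3 x
    rcases g2.eq_or_lt with rfl | hst
    · simp
    have gs := g2.trans g3
    have gt := g1.trans g2
    set δ : ℝ := (t - s) ^ (1 / 3 : ℝ) with hδ
    have hl : 0 < t - s := by linarith
    have hδ0 : 0 < δ := Real.rpow_pos_of_pos hl _
    have hδ2 : δ ^ 2 = (t - s) ^ (2 / 3 : ℝ) := by
      rw [hδ, ← Real.rpow_natCast, ← Real.rpow_mul hl.le]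
      norm_num
    have hδ3 : δ ^ 3 = t - s := by
      rw [hδ, ← Real.rpow_natCast, ← Real.rpow_mul hl.le]
      norm_num
    have f1 : fderiv ℝ (fun x => σ t x - σ s x) = fun x => fderiv ℝ (σ t) x - fderiv ℝ (σ s) x :=
      funext fun x => fderiv_fun_sub (d0 t gt g3 x) (d0 s g1 gs x)
    have f2 : fderiv ℝ (fun x => fderiv ℝ (σ t) x - fderiv ℝ (σ s) x)
        = fun x => fderiv ℝ (fderiv ℝ (σ t)) x - fderiv ℝ (fderiv ℝ (σ s)) x :=
      funext fun x => fderiv_fun_sub (d1 t gt g3 x) (d1 s g1 gs x)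
    have hD1 : Differentiable ℝ fun x => fderiv ℝ (σ t) x - fderiv ℝ (σ s) x :=
      (d1 t gt g3).sub (d1 s g1 gs)
    have hl2 : ∀ x y, ‖(fderiv ℝ (fderiv ℝ (σ t)) y - fderiv ℝ (fderiv ℝ (σ s)) y)
        - (fderiv ℝ (fderiv ℝ (σ t)) x - fderiv ℝ (fderiv ℝ (σ s)) x)‖ ≤ 2 * M * ‖y - x‖ := by
      intro x y
      have e := norm_sub_le (fderiv ℝ (fderiv ℝ (σ t)) y - fderiv ℝ (fderiv ℝ (σ t)) x)
        (fderiv ℝ (fderiv ℝ (σ s)) y - fderiv ℝ (fderiv ℝ (σ s)) x)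
      rw [sub_sub_sub_comm]
      linarith [l2 t gt g3 x y, l2 s g1 gs x y]
    have r1 : ∀ x, ‖fderiv ℝ (σ t) x - fderiv ℝ (σ s) x‖ ≤ 4 * M * δ ^ 2 := by
      intro x
      have := norm_fderiv_le_of_third (g := fun x => σ t x - σ s x) (M := 2 * M)
        ((d0 t gt g3).sub (d0 s g1 gs)) (by rw [f1]; exact hD1)
        (by rw [f1, f2]; exact hl2) (by positivity) hδ0 (fun x => by
          rw [hδ3]
          refine (ti0 s t g1 g2 g3 x).trans ?_
          gcongr
          linarith) x
      rw [f1] at this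
      refine this.trans_eq ?_
      ring
    refine ⟨by rw [← hδ2]; exact r1 x, ?_⟩
    -- The bound just obtained for the first derivative is the input for the second; `2 * 4 + 2`
    -- produces the constant `10`.
    have := norm_fderiv_le_of_second (g := fun x => fderiv ℝ (σ t) x - fderiv ℝ (σ s) x)
      (M := 2 * M) hD1 (by rw [f2]; exact hl2) (by positivity) (A := 4 * M) (by positivity) hδ0 r1 x
    rw [f2] at this
    refine this.trans_eq ?_
    ring
  have hw : ∀ {r : ℝ}, 0 ≤ r → ∀ {c : ℝ}, c ≤ 10 → c * M * r ≤ 10 * M * r := by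
    intro r hr c hc
    gcongr
  have hle : ∀ r : ℝ, r ≤ M → r ≤ 10 * M := fun r hr => by linarith
  have hle' : ∀ r l : ℝ, 0 ≤ l → r ≤ M * l → r ≤ 10 * M * l := fun r l hl hr => by
    have : 0 ≤ M * l := by positivity
    linarith
  exact ⟨10 * M, by positivity,
    { diff := d0
      diff' := d1
      bound := fun t g1 g2 x => hle _ (b0 t g1 g2 x)
      bound' := fun t g1 g2 x => hle _ (b1 t g1 g2 x)
      bound'' := fun t g1 g2 x => hle _ (b2 t g1 g2 x)
      lip'' := fun t g1 g2 x y => hle' _ _ (norm_nonneg _) (l2 t g1 g2 x y)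
      time := fun s t g1 g2 g3 x => hle' _ _ (by linarith) (ti0 s t g1 g2 g3 x)
      time' := fun s t g1 g2 g3 x => ((key s t g1 g2 g3 x).1).trans
        (hw (Real.rpow_nonneg (by linarith) _) (by norm_num))
      time'' := fun s t g1 g2 g3 x => (key s t g1 g2 g3 x).2 }⟩

lemma IsDiffusion.exists_isRegular {m d : ℕ} {T : ℝ} {σ : ℝ → E m → E d →L[ℝ] E m}
    (hσ : IsDiffusion T σ) : ∃ M : ℝ, 0 ≤ M ∧ IsRegular M T σ := by
  obtain ⟨Dt, hDt, -, M4, h4⟩ := hσ.deriv_time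
  exact RoughControl.exists_isRegular hσ.contDiff_space hσ.bounded_space hDt h4

/-! ### Expansions of `σ` and of the second order coefficient `Dσ σ`. -/

section Coefficients

variable {V : Type*} [NormedAddCommGroup V] [NormedSpace ℝ V] {M T : ℝ}

section

variable {W : Type*} [NormedAddCommGroup W] [NormedSpace ℝ W] {σ : ℝ → V → W}

lemma IsRegular.lip (hσ : IsRegular M T σ) {t : ℝ} (h0 : 0 ≤ t) (hT : t ≤ T) (x y : V) :
    ‖σ t y - σ t x‖ ≤ M * ‖y - x‖ :=
  norm_sub_le_of_fderiv_le (hσ.diff t h0 hT) (hσ.bound' t h0 hT) x y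

lemma IsRegular.lip' (hσ : IsRegular M T σ) {t : ℝ} (h0 : 0 ≤ t) (hT : t ≤ T) (x y : V) :
    ‖fderiv ℝ (σ t) y - fderiv ℝ (σ t) x‖ ≤ M * ‖y - x‖ :=
  norm_sub_le_of_fderiv_le (hσ.diff' t h0 hT) (hσ.bound'' t h0 hT) x y

lemma IsRegular.time_lip (hσ : IsRegular M T σ) {s u : ℝ} (hs : 0 ≤ s) (hsu : s ≤ u)
    (hu : u ≤ T) (q q' : V) :
    ‖(σ u q' - σ u q) - (σ s q' - σ s q)‖ ≤ M * (u - s) ^ (2 / 3 : ℝ) * ‖q' - q‖ := by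
  have h1 := hσ.diff u (hs.trans hsu) hu
  have h2 := hσ.diff s hs (hsu.trans hu)
  have := norm_sub_le_of_fderiv_le (g := fun x => σ u x - σ s x)
    (M := M * (u - s) ^ (2 / 3 : ℝ)) (h1.sub h2) (fun x => by
      rw [fderiv_fun_sub (h1 x) (h2 x)]
      exact hσ.time' s u hs hsu hu x) q q'
  rwa [sub_sub_sub_comm]

lemma IsRegular.time_lip' (hσ : IsRegular M T σ) {s u : ℝ} (hs : 0 ≤ s) (hsu : s ≤ u)
    (hu : u ≤ T) (q q' : V) :
    ‖(fderiv ℝ (σ u) q' - fderiv ℝ (σ u) q) - (fderiv ℝ (σ s) q' - fderiv ℝ (σ s) q)‖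
      ≤ M * (u - s) ^ (1 / 3 : ℝ) * ‖q' - q‖ := by
  have h1 := hσ.diff' u (hs.trans hsu) hu
  have h2 := hσ.diff' s hs (hsu.trans hu)
  have := norm_sub_le_of_fderiv_le (g := fun x => fderiv ℝ (σ u) x - fderiv ℝ (σ s) x)
    (M := M * (u - s) ^ (1 / 3 : ℝ)) (h1.sub h2) (fun x => by
      rw [fderiv_fun_sub (h1 x) (h2 x)]
      exact hσ.time'' s u hs hsu hu x) q q'
  rwa [sub_sub_sub_comm]

lemma IsRegular.four_point (hσ : IsRegular M T σ) {s u : ℝ} (hs : 0 ≤ s) (hsu : s ≤ u)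
    (hu : u ≤ T) (p q p' q' : V) :
    ‖(σ u q' - σ u q) - (σ s p' - σ s p)‖
      ≤ M * (u - s) ^ (2 / 3 : ℝ) * ‖q' - q‖
        + (M * ‖(q' - q) - (p' - p)‖ + M * ‖q - p‖ * ‖p' - p‖) := by
  have h1 := hσ.time_lip hs hsu hu q q'
  have h2 := norm_four_point_le (hσ.diff s hs (hsu.trans hu)) (hσ.bound' s hs (hsu.trans hu))
    (hσ.lip' hs (hsu.trans hu)) p q p' q'
  rw [← sub_add_sub_cancel _ (σ s q' - σ s q)]
  exact (norm_add_le _ _).trans (add_le_add h1 h2)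

lemma IsRegular.four_point' (hσ : IsRegular M T σ) {s u : ℝ} (hs : 0 ≤ s) (hsu : s ≤ u)
    (hu : u ≤ T) (p q p' q' : V) :
    ‖(fderiv ℝ (σ u) q' - fderiv ℝ (σ u) q) - (fderiv ℝ (σ s) p' - fderiv ℝ (σ s) p)‖
      ≤ M * (u - s) ^ (1 / 3 : ℝ) * ‖q' - q‖
        + (M * ‖(q' - q) - (p' - p)‖ + M * ‖q - p‖ * ‖p' - p‖) := by
  have h1 := hσ.time_lip' hs hsu hu q q'
  have h2 := norm_four_point_le (hσ.diff' s hs (hsu.trans hu)) (hσ.bound'' s hs (hsu.trans hu))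
    (hσ.lip'' s hs (hsu.trans hu)) p q p' q'
  rw [← sub_add_sub_cancel _ (fderiv ℝ (σ s) q' - fderiv ℝ (σ s) q)]
  exact (norm_add_le _ _).trans (add_le_add h1 h2)

/-- First order expansion of a coefficient along a step `φ` with error. -/
lemma IsRegular.expansion_le (hσ : IsRegular M T σ) (hM : 0 ≤ M) {s u : ℝ} (hs : 0 ≤ s)
    (hsu : s ≤ u) (hu : u ≤ T) (p q φ : V) :
    ‖σ u q - σ s p - fderiv ℝ (σ s) p φ‖
      ≤ M * (u - s) + M * ‖q - p - φ‖ + M * ‖φ‖ ^ 2 := by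
  have hsT := hsu.trans hu
  have h1 := hσ.time s u hs hsu hu q
  have h2 := hσ.lip hs hsT (p + φ) q
  have h3 := norm_taylor_le (hσ.diff s hs hsT) (hσ.lip' hs hsT) hM p φ
  have e : σ u q - σ s p - fderiv ℝ (σ s) p φ = (σ u q - σ s q) + (σ s q - σ s (p + φ))
      + (σ s (p + φ) - σ s p - fderiv ℝ (σ s) p φ) := by abel
  rw [e]
  rw [← sub_sub] at h2
  exact norm_add₃_le.trans (add_le_add (add_le_add h1 h2) h3)

/-- Differences of first order expansions. -/
lemma IsRegular.expansion_diff_le (hσ : IsRegular M T σ) (hM : 0 ≤ M) {s u e : ℝ} (hs : 0 ≤ s)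
    (hsu : s ≤ u) (hu : u ≤ T) (p q p' q' φ φ' : V) (h1 : ‖φ‖ ≤ e) (h2 : ‖φ'‖ ≤ e)
    (h3 : ‖φ' - φ‖ ≤ e * ‖p' - p‖) :
    ‖(σ u q' - σ s p' - fderiv ℝ (σ s) p' φ') - (σ u q - σ s p - fderiv ℝ (σ s) p φ)‖
      ≤ M * (u - s) ^ (2 / 3 : ℝ) * ‖q' - q‖
        + (M * ‖(q' - p' - φ') - (q - p - φ)‖ + M * ‖q - p - φ‖ * ((1 + e) * ‖p' - p‖))
        + M * e ^ 2 * ‖p' - p‖ + M * e ^ 2 * ‖p' - p‖ := by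
  have hsT := hsu.trans hu
  have he : 0 ≤ e := (norm_nonneg _).trans h1
  set f := σ s with hf
  have hfd := hσ.diff s hs hsT
  have hfd' := hσ.diff' s hs hsT
  have g1 := hσ.time_lip hs hsu hu q q'
  have g2 := norm_four_point_le hfd (hσ.bound' s hs hsT) (hσ.lip' hs hsT) (p + φ) q (p' + φ') q'
  have e2 : (q' - q) - ((p' + φ') - (p + φ)) = (q' - p' - φ') - (q - p - φ) := by abel
  have e3 : ‖(p' + φ') - (p + φ)‖ ≤ (1 + e) * ‖p' - p‖ := by
    rw [add_sub_add_comm]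
    calc _ ≤ ‖p' - p‖ + e * ‖p' - p‖ := (norm_add_le _ _).trans (add_le_add le_rfl h3)
      _ = _ := by ring
  rw [e2, ← sub_sub] at g2
  have g3 := norm_sub_sub_fderiv_le hfd (hσ.lip' hs hsT) hM (p := p') (x := p' + φ) (y := p' + φ')
    (r := e) (by simpa using h1) (by simpa using h2)
  rw [add_sub_add_left_eq_sub] at g3
  have hd : ∀ z, HasFDerivAt (fun z => f (p' + z) - f (p + z))
      (fderiv ℝ f (p' + z) - fderiv ℝ f (p + z)) z := by
    intro z
    have k1 : HasFDerivAt (fun z => f (p' + z)) (fderiv ℝ f (p' + z)) z :=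
      (hfd (p' + z)).hasFDerivAt.comp z ((hasFDerivAt_id z).const_add p')
    have k2 : HasFDerivAt (fun z => f (p + z)) (fderiv ℝ f (p + z)) z :=
      (hfd (p + z)).hasFDerivAt.comp z ((hasFDerivAt_id z).const_add p)
    exact k1.fun_sub k2
  have g4 := (convex_closedBall (0 : V) e).norm_image_sub_le_of_norm_hasFDerivWithin_le'
    (φ := fderiv ℝ f p' - fderiv ℝ f p) (C := M * e * ‖p' - p‖)
    (fun z _ => (hd z).hasFDerivWithinAt) (fun z hz => by
      rw [mem_closedBall_zero_iff] at hz
      have k := norm_four_point_le hfd' (hσ.bound'' s hs hsT) (hσ.lip'' s hs hsT) p (p + z) p'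
        (p' + z)
      rw [add_sub_add_right_eq_sub, sub_self, norm_zero, mul_zero, zero_add,
        add_sub_cancel_left] at k
      exact k.trans (by gcongr)) (x := 0) (y := φ) (by simpa using he) (by simpa using h1)
  simp only [add_zero, sub_zero] at g4
  -- Four sources of error: the change of time, the deviation of `q` from `p + φ`, the change of `φ`
  -- at the base point `p'`, and the change of base point with `φ` fixed.
  have e5 : (σ u q' - f p' - fderiv ℝ f p' φ') - (σ u q - f p - fderiv ℝ f p φ)
      = ((σ u q' - σ u q) - (f q' - f q))
        + ((f q' - f q) - (f (p' + φ') - f (p + φ)))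
        + (f (p' + φ') - f (p' + φ) - fderiv ℝ f p' (φ' - φ))
        + (f (p' + φ) - f (p + φ) - (f p' - f p) - (fderiv ℝ f p' - fderiv ℝ f p) φ) := by
    rw [map_sub, sub_apply]
    abel
  rw [e5]
  refine norm_add₄_le.trans (add_le_add (add_le_add (add_le_add g1 (g2.trans ?_)) (g3.trans ?_))
    (g4.trans ?_))
  · gcongr
  · calc M * e * ‖φ' - φ‖ ≤ M * e * (e * ‖p' - p‖) := by gcongr
      _ = _ := by ring
  · calc M * e * ‖p' - p‖ * ‖φ‖ ≤ M * e * ‖p' - p‖ * e := by gcongr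
      _ = _ := by ring

end

variable {d : ℕ} {σ : ℝ → V → E d →L[ℝ] V}

/-- The second order coefficient `Dσ σ`. -/
noncomputable def secondCoef (σ : ℝ → V → E d →L[ℝ] V) (t : ℝ) (x : V) :
    E d →L[ℝ] E d →L[ℝ] V :=
  (fderiv ℝ (σ t) x).comp (σ t x)

/-- The space derivative of the second order coefficient. -/
noncomputable def secondCoefDeriv (σ : ℝ → V → E d →L[ℝ] V) (t : ℝ) (x h : V) :
    E d →L[ℝ] E d →L[ℝ] V :=
  (fderiv ℝ (fderiv ℝ (σ t)) x h).comp (σ t x) + (fderiv ℝ (σ t) x).comp (fderiv ℝ (σ t) x h)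

lemma norm_comp_le_of_le {F G H : Type*} [NormedAddCommGroup F] [NormedSpace ℝ F]
    [NormedAddCommGroup G] [NormedSpace ℝ G] [NormedAddCommGroup H] [NormedSpace ℝ H]
    {A : G →L[ℝ] H} {B : F →L[ℝ] G} {a b : ℝ} (hA : ‖A‖ ≤ a) (hB : ‖B‖ ≤ b) :
    ‖A.comp B‖ ≤ a * b :=
  (ContinuousLinearMap.opNorm_comp_le A B).trans
    (mul_le_mul hA hB (norm_nonneg _) ((norm_nonneg _).trans hA))

lemma IsRegular.secondCoef_bound (hσ : IsRegular M T σ) {t : ℝ} (h0 : 0 ≤ t) (hT : t ≤ T)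
    (x : V) : ‖secondCoef σ t x‖ ≤ M ^ 2 := by
  rw [sq]
  exact norm_comp_le_of_le (hσ.bound' t h0 hT x) (hσ.bound t h0 hT x)

lemma IsRegular.secondCoef_sub_le (hσ : IsRegular M T σ) (hM : 0 ≤ M) {s u : ℝ} (hs : 0 ≤ s)
    (hsu : s ≤ u) (hu : u ≤ T) (hl : u - s ≤ 1) (p q : V) :
    ‖secondCoef σ u q - secondCoef σ s p‖
      ≤ 2 * M ^ 2 * ((u - s) ^ (2 / 3 : ℝ) + ‖q - p‖) := by
  have hsT := hsu.trans hu
  have hl0 : 0 ≤ u - s := by linarith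
  have hw : u - s ≤ (u - s) ^ (2 / 3 : ℝ) := by
    simpa using rpow_le_rpow_of_le_one (a := 1) (b := 2 / 3) hl0 hl (by norm_num) (by norm_num)
  have a1 : ‖fderiv ℝ (σ u) q - fderiv ℝ (σ s) p‖ ≤ M * (u - s) ^ (2 / 3 : ℝ) + M * ‖q - p‖ := by
    rw [← sub_add_sub_cancel _ (fderiv ℝ (σ s) q)]
    exact (norm_add_le _ _).trans (add_le_add (hσ.time' s u hs hsu hu q) (hσ.lip' hs hsT p q))
  have a2 : ‖σ u q - σ s p‖ ≤ M * (u - s) ^ (2 / 3 : ℝ) + M * ‖q - p‖ := by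
    rw [← sub_add_sub_cancel _ (σ s q)]
    refine (norm_add_le _ _).trans (add_le_add ((hσ.time s u hs hsu hu q).trans ?_)
      (hσ.lip hs hsT p q))
    gcongr
  have e : secondCoef σ u q - secondCoef σ s p
      = (fderiv ℝ (σ u) q - fderiv ℝ (σ s) p).comp (σ u q)
        + (fderiv ℝ (σ s) p).comp (σ u q - σ s p) := by
    simp only [secondCoef, ContinuousLinearMap.sub_comp, ContinuousLinearMap.comp_sub]
    abel
  rw [e]
  calc _ ≤ (M * (u - s) ^ (2 / 3 : ℝ) + M * ‖q - p‖) * M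
        + M * (M * (u - s) ^ (2 / 3 : ℝ) + M * ‖q - p‖) :=
        (norm_add_le _ _).trans (add_le_add
          (norm_comp_le_of_le a1 (hσ.bound u (hs.trans hsu) hu q))
          (norm_comp_le_of_le (hσ.bound' s hs hsT p) a2))
    _ = _ := by ring

lemma IsRegular.secondCoef_lip (hσ : IsRegular M T σ) (hM : 0 ≤ M) {t : ℝ} (h0 : 0 ≤ t)
    (hT : t ≤ T) (x y : V) : ‖secondCoef σ t y - secondCoef σ t x‖ ≤ 2 * M ^ 2 * ‖y - x‖ := by
  simpa using hσ.secondCoef_sub_le hM h0 le_rfl hT (by simp) x y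

/-- A discrete Leibniz rule for a mixed second difference of a product. The time exponent is only `1
/ 3`, that of `D²σ`; it suffices because this coefficient is paired with the area, of order `2 κ`.
-/
lemma IsRegular.secondCoef_four_point (hσ : IsRegular M T σ) (hM : 0 ≤ M) {s u : ℝ} (hs : 0 ≤ s)
    (hsu : s ≤ u) (hu : u ≤ T) (hl : u - s ≤ 1) (p q p' q' : V) :
    ‖(secondCoef σ u q' - secondCoef σ u q) - (secondCoef σ s p' - secondCoef σ s p)‖
      ≤ 4 * M ^ 2 * (‖(q' - q) - (p' - p)‖ + ‖q - p‖ * ‖p' - p‖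
        + (‖p' - p‖ + ‖q' - q‖) * (u - s) ^ (1 / 3 : ℝ)) := by
  have hsT := hsu.trans hu
  have hu0 := hs.trans hsu
  have hl0 : 0 ≤ u - s := by linarith
  set w := (u - s) ^ (1 / 3 : ℝ) with hw
  have hw0 : 0 ≤ w := by positivity
  have hw1 : u - s ≤ w := by
    have := rpow_le_rpow_of_le_one (a := 1) (b := 1 / 3) hl0 hl (by norm_num) (by norm_num)
    rwa [Real.rpow_one] at this
  have hw2 : (u - s) ^ (2 / 3 : ℝ) ≤ w :=
    rpow_le_rpow_of_le_one hl0 hl (by norm_num) (by norm_num)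
  set ρ := ‖(q' - q) - (p' - p)‖ with hρ
  have hρ0 : 0 ≤ ρ := norm_nonneg _
  have b1 : ‖(σ u q' - σ u q) - (σ s p' - σ s p)‖
      ≤ M * w * ‖q' - q‖ + (M * ρ + M * ‖q - p‖ * ‖p' - p‖) :=
    (hσ.four_point hs hsu hu p q p' q').trans (by gcongr)
  have b2 := hσ.four_point' hs hsu hu p q p' q'
  have b3 : ‖fderiv ℝ (σ u) q' - fderiv ℝ (σ s) p'‖ ≤ M * w + M * (‖q - p‖ + ρ) := by
    rw [← sub_add_sub_cancel _ (fderiv ℝ (σ s) q')]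
    refine (norm_add_le _ _).trans (add_le_add ((hσ.time' s u hs hsu hu q').trans (by gcongr))
      ((hσ.lip' hs hsT p' q').trans ?_))
    have : q' - p' = (q - p) + ((q' - q) - (p' - p)) := by abel
    rw [this]
    gcongr
    exact norm_add_le _ _
  have b4 := hσ.lip hs hsT p p'
  have b5 : ‖σ s p' - σ s p‖ ≤ 2 * M := by
    have := norm_sub_le (σ s p') (σ s p)
    linarith [hσ.bound s hs hsT p', hσ.bound s hs hsT p]
  have b6 := hσ.lip' hs hsT p p'
  have b7 : ‖σ u q - σ s p‖ ≤ M * w + M * ‖q - p‖ := by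
    rw [← sub_add_sub_cancel _ (σ s q)]
    refine (norm_add_le _ _).trans (add_le_add ((hσ.time s u hs hsu hu q).trans ?_)
      (hσ.lip hs hsT p q))
    gcongr
  -- Against `ρ` the increment of `σ` is bounded by the constant `2 * M` instead of its Lipschitz
  -- bound; this avoids the product `ρ ‖p' - p‖`.
  have c2 : ‖(fderiv ℝ (σ u) q' - fderiv ℝ (σ s) p').comp (σ s p' - σ s p)‖
      ≤ (M * w + M * ‖q - p‖) * (M * ‖p' - p‖) + M * ρ * (2 * M) := by
    refine (norm_comp_le_of_le b3 le_rfl).trans ?_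
    calc (M * w + M * (‖q - p‖ + ρ)) * ‖σ s p' - σ s p‖
        = (M * w + M * ‖q - p‖) * ‖σ s p' - σ s p‖ + M * ρ * ‖σ s p' - σ s p‖ := by ring
      _ ≤ _ := by gcongr
  have e : (secondCoef σ u q' - secondCoef σ u q) - (secondCoef σ s p' - secondCoef σ s p)
      = (fderiv ℝ (σ u) q').comp ((σ u q' - σ u q) - (σ s p' - σ s p))
        + (fderiv ℝ (σ u) q' - fderiv ℝ (σ s) p').comp (σ s p' - σ s p)
        + ((fderiv ℝ (σ u) q' - fderiv ℝ (σ u) q)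
            - (fderiv ℝ (σ s) p' - fderiv ℝ (σ s) p)).comp (σ u q)
        + (fderiv ℝ (σ s) p' - fderiv ℝ (σ s) p).comp (σ u q - σ s p) := by
    simp only [secondCoef, ContinuousLinearMap.sub_comp, ContinuousLinearMap.comp_sub]
    abel
  rw [e]
  calc _ ≤ M * (M * w * ‖q' - q‖ + (M * ρ + M * ‖q - p‖ * ‖p' - p‖))
        + ((M * w + M * ‖q - p‖) * (M * ‖p' - p‖) + M * ρ * (2 * M))
        + (M * w * ‖q' - q‖ + (M * ρ + M * ‖q - p‖ * ‖p' - p‖)) * M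
        + M * ‖p' - p‖ * (M * w + M * ‖q - p‖) :=
        norm_add₄_le.trans (add_le_add (add_le_add (add_le_add
          (norm_comp_le_of_le (hσ.bound' u hu0 hu q') b1) c2)
          (norm_comp_le_of_le b2 (hσ.bound u hu0 hu q))) (norm_comp_le_of_le b6 b7))
    _ = M ^ 2 * (4 * ρ + 4 * (‖q - p‖ * ‖p' - p‖) + 2 * (‖p' - p‖ + ‖q' - q‖) * w) := by ring
    _ ≤ M ^ 2 * (4 * ρ + 4 * (‖q - p‖ * ‖p' - p‖) + 4 * (‖p' - p‖ + ‖q' - q‖) * w) := by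
        gcongr
        norm_num
    _ = _ := by ring

lemma IsRegular.secondCoef_taylor (hσ : IsRegular M T σ) (hM : 0 ≤ M) {t : ℝ} (h0 : 0 ≤ t)
    (hT : t ≤ T) (x h : V) :
    ‖secondCoef σ t (x + h) - secondCoef σ t x - secondCoefDeriv σ t x h‖
      ≤ 3 * M ^ 2 * ‖h‖ ^ 2 := by
  have a1 := norm_taylor_le (hσ.diff' t h0 hT) (hσ.lip'' t h0 hT) hM x h
  have a2 := norm_taylor_le (hσ.diff t h0 hT) (hσ.lip' h0 hT) hM x h
  have a3 : ‖fderiv ℝ (fderiv ℝ (σ t)) x h‖ ≤ M * ‖h‖ :=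
    ContinuousLinearMap.le_of_opNorm_le _ (hσ.bound'' t h0 hT x) h
  have a4 := hσ.lip h0 hT x (x + h)
  rw [add_sub_cancel_left] at a4
  have e : secondCoef σ t (x + h) - secondCoef σ t x - secondCoefDeriv σ t x h
      = (fderiv ℝ (σ t) (x + h) - fderiv ℝ (σ t) x
          - fderiv ℝ (fderiv ℝ (σ t)) x h).comp (σ t (x + h))
        + (fderiv ℝ (fderiv ℝ (σ t)) x h).comp (σ t (x + h) - σ t x)
        + (fderiv ℝ (σ t) x).comp (σ t (x + h) - σ t x - fderiv ℝ (σ t) x h) := by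
    simp only [secondCoef, secondCoefDeriv, ContinuousLinearMap.sub_comp,
      ContinuousLinearMap.comp_sub]
    abel
  rw [e]
  calc _ ≤ M * ‖h‖ ^ 2 * M + M * ‖h‖ * (M * ‖h‖) + M * (M * ‖h‖ ^ 2) :=
        norm_add₃_le.trans (add_le_add (add_le_add
          (norm_comp_le_of_le a1 (hσ.bound t h0 hT _)) (norm_comp_le_of_le a3 a4))
          (norm_comp_le_of_le (hσ.bound' t h0 hT x) a2))
    _ = _ := by ring

lemma IsRegular.secondCoefDeriv_bound (hσ : IsRegular M T σ) {t : ℝ} (h0 : 0 ≤ t)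
    (hT : t ≤ T) (x h : V) : ‖secondCoefDeriv σ t x h‖ ≤ 2 * M ^ 2 * ‖h‖ := by
  have a3 : ‖fderiv ℝ (fderiv ℝ (σ t)) x h‖ ≤ M * ‖h‖ :=
    ContinuousLinearMap.le_of_opNorm_le _ (hσ.bound'' t h0 hT x) h
  have a4 : ‖fderiv ℝ (σ t) x h‖ ≤ M * ‖h‖ :=
    ContinuousLinearMap.le_of_opNorm_le _ (hσ.bound' t h0 hT x) h
  calc _ ≤ M * ‖h‖ * M + M * (M * ‖h‖) :=
        (norm_add_le _ _).trans (add_le_add (norm_comp_le_of_le a3 (hσ.bound t h0 hT x))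
          (norm_comp_le_of_le (hσ.bound' t h0 hT x) a4))
    _ = _ := by ring

lemma secondCoef_apply (t : ℝ) (x : V) (a b : E d) :
    secondCoef σ t x a b = fderiv ℝ (σ t) x (σ t x a) b := rfl

end Coefficients

/-! ### The rough driver, its germ and the coboundary of the germ. -/

section Driver

variable {d : ℕ} {V : Type*} [NormedAddCommGroup V] [NormedSpace ℝ V]

lemma contract_sub (μ ν : E d →L[ℝ] E d →L[ℝ] V) (A : Matrix (Fin d) (Fin d) ℝ) :
    contract (μ - ν) A = contract μ A - contract ν A := by
  simp only [contract, sub_apply, smul_sub, Finset.sum_sub_distrib]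

lemma contract_smul (c : ℝ) (μ : E d →L[ℝ] E d →L[ℝ] V) (A : Matrix (Fin d) (Fin d) ℝ) :
    contract (c • μ) A = c • contract μ A := by
  simp only [contract, smul_apply, Finset.smul_sum]
  refine Finset.sum_congr rfl fun i _ => Finset.sum_congr rfl fun j _ => smul_comm _ _ _

lemma contract_add_right (μ : E d →L[ℝ] E d →L[ℝ] V) (A B : Matrix (Fin d) (Fin d) ℝ) :
    contract μ (A + B) = contract μ A + contract μ B := by
  simp only [contract, Matrix.add_apply, add_smul, Finset.sum_add_distrib]

/-- Expansion in the standard basis; it evaluates the cross term of Chen's relation. -/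
lemma contract_vecMulVec (μ : E d →L[ℝ] E d →L[ℝ] V) (a b : E d) :
    contract μ (Matrix.vecMulVec a b) = μ a b := by
  have ha : a = ∑ i, a i • EuclideanSpace.single i (1 : ℝ) := by
    ext j
    simp [Pi.single_apply]
  have hb : b = ∑ i, b i • EuclideanSpace.single i (1 : ℝ) := by
    ext j
    simp [Pi.single_apply]
  conv_rhs => rw [ha, hb]
  simp only [map_sum, map_smul, contract, Matrix.vecMulVec_apply, sum_apply,
    smul_apply, Finset.smul_sum, smul_smul]
  refine Finset.sum_congr rfl fun i _ => Finset.sum_congr rfl fun j _ => ?_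
  rw [mul_comm]

lemma norm_contract_le (μ : E d →L[ℝ] E d →L[ℝ] V) {A : Matrix (Fin d) (Fin d) ℝ} {c : ℝ}
    (hA : ∀ i j, |A i j| ≤ c) : ‖contract μ A‖ ≤ d * d * c * ‖μ‖ := by
  have h1 : ∀ i j : Fin d,
      ‖A j i • μ (EuclideanSpace.single j 1) (EuclideanSpace.single i 1)‖ ≤ c * ‖μ‖ := by
    intro i j
    rw [norm_smul]
    have e1 := μ.le_opNorm₂ (EuclideanSpace.single j (1 : ℝ)) (EuclideanSpace.single i (1 : ℝ))
    simp only [PiLp.norm_single, norm_one, mul_one] at e1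
    exact mul_le_mul (hA j i) e1 (norm_nonneg _) ((abs_nonneg _).trans (hA j i))
  calc ‖contract μ A‖ ≤ ∑ _i : Fin d, ∑ _j : Fin d, c * ‖μ‖ :=
        norm_sum_le_of_le _ fun i _ => norm_sum_le_of_le _ fun j _ => h1 i j
    _ = _ := by
      simp only [Finset.sum_const, Finset.card_univ, Fintype.card_fin, nsmul_eq_mul]
      ring

/-- The bounds on a rough path that enter the expansion of a rough integral. -/
structure IsDriver (κ R T : ℝ) (ζ : ℝ → E d) (ζ2 : ℝ → ℝ → Matrix (Fin d) (Fin d) ℝ) : Prop where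
  path : ∀ u v, 0 ≤ u → u ≤ v → v ≤ T → ‖ζ v - ζ u‖ ≤ R * (v - u) ^ κ
  area : ∀ u v, 0 ≤ u → u ≤ v → v ≤ T → ∀ i j, d * d * |ζ2 u v i j| ≤ R * (v - u) ^ (2 * κ)
  chen : ∀ s u t, 0 ≤ s → s ≤ u → u ≤ t → t ≤ T →
    ζ2 s t = ζ2 s u + ζ2 u t + Matrix.vecMulVec (ζ u - ζ s) (ζ t - ζ u)

lemma IsGeometricRoughPath.exists_isDriver {α κ T : ℝ} {ζ : ℝ → E d}
    {ζ2 : ℝ → ℝ → Matrix (Fin d) (Fin d) ℝ} (hζ : IsGeometricRoughPath α T ζ ζ2) (hT : 0 < T)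
    (hκ : 0 < κ) (hκα : κ < α) : ∃ R : ℝ, 0 ≤ R ∧ IsDriver κ R T ζ ζ2 := by
  obtain ⟨C1, h1⟩ := hζ.holder
  obtain ⟨C2, h2⟩ := hζ.area_holder
  have hpow : ∀ u v : ℝ, 0 ≤ u → u ≤ v → v ≤ T → ∀ p q : ℝ, 0 ≤ p → 0 ≤ q →
      (v - u) ^ (p + q) ≤ T ^ q * (v - u) ^ p := by
    intro u v g1 g2 g3 p q hp hq
    rw [Real.rpow_add_of_nonneg (by linarith) hp hq, mul_comm]
    have : v - u ≤ T := by linarith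
    have h0 : 0 ≤ v - u := by linarith
    gcongr
  refine ⟨|C1| * T ^ (α - κ) + d * d * (|C2| * T ^ (2 * (α - κ))), by positivity, ?_, ?_, ?_⟩
  · intro u v g1 g2 g3
    have h0 : 0 ≤ v - u := by linarith
    have := hpow u v g1 g2 g3 κ (α - κ) hκ.le (by linarith)
    rw [add_sub_cancel] at this
    calc _ ≤ C1 * (v - u) ^ α := h1 u v g1 g2 g3
      _ ≤ |C1| * (T ^ (α - κ) * (v - u) ^ κ) := by
        gcongr
        exact le_abs_self C1
      _ = |C1| * T ^ (α - κ) * (v - u) ^ κ := by ring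
      _ ≤ _ := by
        gcongr
        have : 0 ≤ (d : ℝ) * d * (|C2| * T ^ (2 * (α - κ))) := by positivity
        linarith
  · intro u v g1 g2 g3 i j
    have h0 : 0 ≤ v - u := by linarith
    have := hpow u v g1 g2 g3 (2 * κ) (2 * (α - κ)) (by linarith) (by linarith)
    rw [show 2 * κ + 2 * (α - κ) = 2 * α by ring] at this
    calc _ ≤ d * d * (C2 * (v - u) ^ (2 * α)) := by
          gcongr
          exact h2 u v g1 g2 g3 i j
      _ ≤ d * d * (|C2| * (T ^ (2 * (α - κ)) * (v - u) ^ (2 * κ))) := by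
        gcongr
        exact le_abs_self C2
      _ = d * d * (|C2| * T ^ (2 * (α - κ))) * (v - u) ^ (2 * κ) := by ring
      _ ≤ _ := by
        gcongr
        have : 0 ≤ |C1| * T ^ (α - κ) := by positivity
        linarith
  · intro s u t g1 g2 g3 g4
    ext i j
    have := hζ.chen s u t g1 g2 g3 g4 i j
    simp only [Matrix.add_apply, Matrix.vecMulVec_apply, PiLp.sub_apply]
    linarith

/-- The germ `σ(u,x) δζ_{uv} + (Dσ σ)(u,x) ζ2_{uv}`. -/
noncomputable def germ (σ : ℝ → V → E d →L[ℝ] V) (ζ : ℝ → E d)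
    (ζ2 : ℝ → ℝ → Matrix (Fin d) (Fin d) ℝ) (u v : ℝ) (x : V) : V :=
  σ u x (ζ v - ζ u) + contract (secondCoef σ u x) (ζ2 u v)

/-- The linearisation of `germ` in the space variable. -/
noncomputable def germLin (σ : ℝ → V → E d →L[ℝ] V) (ζ : ℝ → E d)
    (ζ2 : ℝ → ℝ → Matrix (Fin d) (Fin d) ℝ) (u v : ℝ) (x h : V) : V :=
  fderiv ℝ (σ u) x h (ζ v - ζ u) + contract (secondCoefDeriv σ u x h) (ζ2 u v)

variable {κ R M T : ℝ} {ζ : ℝ → E d} {ζ2 : ℝ → ℝ → Matrix (Fin d) (Fin d) ℝ}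
  {σ : ℝ → V → E d →L[ℝ] V}

lemma IsDriver.contract_le (hζ : IsDriver κ R T ζ ζ2) {u v : ℝ} (h0 : 0 ≤ u) (h1 : u ≤ v)
    (h2 : v ≤ T) {μ : E d →L[ℝ] E d →L[ℝ] V} {c : ℝ} (hμ : ‖μ‖ ≤ c) (hR : 0 ≤ R) :
    ‖contract μ (ζ2 u v)‖ ≤ R * (v - u) ^ (2 * κ) * c := by
  have hl : 0 ≤ v - u := by linarith
  have h : ‖contract μ (ζ2 u v)‖ ≤ R * (v - u) ^ (2 * κ) * ‖μ‖ := by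
    -- The general bound divides by `d * d`; in dimension zero the contraction is an empty sum.
    rcases Nat.eq_zero_or_pos d with rfl | hd
    · simp only [contract, Finset.univ_eq_empty, Finset.sum_empty, norm_zero]
      positivity
    · have hd' : (0 : ℝ) < d * d := by positivity
      have := norm_contract_le μ (A := ζ2 u v) (c := R * (v - u) ^ (2 * κ) / (d * d))
        fun i j => by
          rw [le_div_iff₀ hd', mul_comm]
          exact hζ.area u v h0 h1 h2 i j
      refine this.trans_eq ?_
      field_simp
  exact h.trans (by gcongr)

lemma apply_le_of_le {F G : Type*} [NormedAddCommGroup F] [NormedSpace ℝ F]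
    [NormedAddCommGroup G] [NormedSpace ℝ G] {A : F →L[ℝ] G} {v : F} {a b : ℝ} (hA : ‖A‖ ≤ a)
    (hv : ‖v‖ ≤ b) : ‖A v‖ ≤ a * b :=
  (A.le_opNorm v).trans (mul_le_mul hA hv (norm_nonneg _) ((norm_nonneg _).trans hA))

/-- The cross term in Chen's relation supplies exactly the first-order term in the expansion of `σ u
q - σ s p`. What is left is a second-order error paired with `δζ` and a first-order increment paired
with the area. -/
lemma germ_cob (hζ : IsDriver κ R T ζ ζ2) {s u t : ℝ} (h0 : 0 ≤ s) (h1 : s ≤ u) (h2 : u ≤ t)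
    (h3 : t ≤ T) (p q : V) :
    germ σ ζ ζ2 s t p - germ σ ζ ζ2 s u p - germ σ ζ ζ2 u t q
      = -((σ u q - σ s p - fderiv ℝ (σ s) p (σ s p (ζ u - ζ s))) (ζ t - ζ u)
        + contract (secondCoef σ u q - secondCoef σ s p) (ζ2 u t)) := by
  have e : ζ t - ζ s = (ζ u - ζ s) + (ζ t - ζ u) := by abel
  rw [germ, germ, germ, hζ.chen s u t h0 h1 h2 h3, contract_add_right, contract_add_right,
    contract_vecMulVec, contract_sub, secondCoef_apply, e, map_add]
  simp only [sub_apply]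
  abel


lemma IsDriver.germ_bound (hζ : IsDriver κ R T ζ ζ2) (hσ : IsRegular M T σ) (hR : 0 ≤ R)
    {u v : ℝ} (h0 : 0 ≤ u) (h1 : u ≤ v) (h2 : v ≤ T) (x : V) :
    ‖germ σ ζ ζ2 u v x‖ ≤ M * (R * (v - u) ^ κ) + R * (v - u) ^ (2 * κ) * M ^ 2 :=
  (norm_add_le _ _).trans (add_le_add
    (apply_le_of_le (hσ.bound u h0 (h1.trans h2) x) (hζ.path u v h0 h1 h2))
    (hζ.contract_le h0 h1 h2 (hσ.secondCoef_bound h0 (h1.trans h2) x) hR))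

lemma IsDriver.germ_lip (hζ : IsDriver κ R T ζ ζ2) (hσ : IsRegular M T σ) (hR : 0 ≤ R)
    (hM : 0 ≤ M) {u v : ℝ} (h0 : 0 ≤ u) (h1 : u ≤ v) (h2 : v ≤ T) (x x' : V) :
    ‖germ σ ζ ζ2 u v x' - germ σ ζ ζ2 u v x‖
      ≤ M * ‖x' - x‖ * (R * (v - u) ^ κ) + R * (v - u) ^ (2 * κ) * (2 * M ^ 2 * ‖x' - x‖) := by
  have e : germ σ ζ ζ2 u v x' - germ σ ζ ζ2 u v x = (σ u x' - σ u x) (ζ v - ζ u)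
      + contract (secondCoef σ u x' - secondCoef σ u x) (ζ2 u v) := by
    rw [germ, germ, contract_sub, sub_apply]
    abel
  rw [e]
  exact (norm_add_le _ _).trans (add_le_add
    (apply_le_of_le (hσ.lip h0 (h1.trans h2) x x') (hζ.path u v h0 h1 h2))
    (hζ.contract_le h0 h1 h2 (hσ.secondCoef_lip hM h0 (h1.trans h2) x x') hR))

lemma IsDriver.germ_taylor (hζ : IsDriver κ R T ζ ζ2) (hσ : IsRegular M T σ) (hR : 0 ≤ R)
    (hM : 0 ≤ M) {u v : ℝ} (h0 : 0 ≤ u) (h1 : u ≤ v) (h2 : v ≤ T) (x h : V) :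
    ‖germ σ ζ ζ2 u v (x + h) - germ σ ζ ζ2 u v x - germLin σ ζ ζ2 u v x h‖
      ≤ M * ‖h‖ ^ 2 * (R * (v - u) ^ κ) + R * (v - u) ^ (2 * κ) * (3 * M ^ 2 * ‖h‖ ^ 2) := by
  have e : germ σ ζ ζ2 u v (x + h) - germ σ ζ ζ2 u v x - germLin σ ζ ζ2 u v x h
      = (σ u (x + h) - σ u x - fderiv ℝ (σ u) x h) (ζ v - ζ u)
      + contract (secondCoef σ u (x + h) - secondCoef σ u x - secondCoefDeriv σ u x h)
        (ζ2 u v) := by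
    rw [germ, germ, germLin, contract_sub, contract_sub, sub_apply, sub_apply]
    abel
  rw [e]
  exact (norm_add_le _ _).trans (add_le_add
    (apply_le_of_le (norm_taylor_le (hσ.diff u h0 (h1.trans h2)) (hσ.lip' h0 (h1.trans h2)) hM x h)
      (hζ.path u v h0 h1 h2))
    (hζ.contract_le h0 h1 h2 (hσ.secondCoef_taylor hM h0 (h1.trans h2) x h) hR))

lemma IsDriver.germLin_bound (hζ : IsDriver κ R T ζ ζ2) (hσ : IsRegular M T σ) (hR : 0 ≤ R)
    {u v : ℝ} (h0 : 0 ≤ u) (h1 : u ≤ v) (h2 : v ≤ T) (x h : V) :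
    ‖germLin σ ζ ζ2 u v x h‖
      ≤ M * ‖h‖ * (R * (v - u) ^ κ) + R * (v - u) ^ (2 * κ) * (2 * M ^ 2 * ‖h‖) :=
  (norm_add_le _ _).trans (add_le_add
    (apply_le_of_le (ContinuousLinearMap.le_of_opNorm_le _ (hσ.bound' u h0 (h1.trans h2) x) h)
      (hζ.path u v h0 h1 h2))
    (hζ.contract_le h0 h1 h2 (hσ.secondCoefDeriv_bound h0 (h1.trans h2) x h) hR))

/-- Orders add up: `2κ + κ` for the expansion error against the path, `κ + 2κ` for the coefficient
increment against the area. The defect of `q` enters linearly, with at least a factor of order `κ`.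
-/
lemma IsDriver.germ_cob_le (hζ : IsDriver κ R T ζ ζ2) (hσ : IsRegular M T σ) (hR : 0 ≤ R)
    (hM : 0 ≤ M) (hκ : 1 / 3 < κ) (hκ2 : κ ≤ 1 / 2) {s u t : ℝ} (h0 : 0 ≤ s) (h1 : s ≤ u)
    (h2 : u ≤ t) (h3 : t ≤ T) (hl : t - s ≤ 1) (p q : V) :
    ‖germ σ ζ ζ2 s t p - germ σ ζ ζ2 s u p - germ σ ζ ζ2 u t q‖
      ≤ ((M + M * (R * M ^ 2) + M * (M * R) ^ 2) * R
          + R * (2 * M ^ 2 * (1 + (M * R + R * M ^ 2))) + M * R + 2 * R * M ^ 2)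
        * ((t - s) ^ (3 * κ) + ‖q - p - germ σ ζ ζ2 s u p‖ * (t - s) ^ κ) := by
  have hl0 : 0 ≤ t - s := by linarith
  have hus0 : 0 ≤ u - s := by linarith
  have hus : u - s ≤ t - s := by linarith
  have htu0 : 0 ≤ t - u := by linarith
  have htu : t - u ≤ t - s := by linarith
  have hκ0 : 0 ≤ κ := by linarith
  have hsT : s ≤ T := by linarith
  have huT : u ≤ T := by linarith
  have hu0 : 0 ≤ u := by linarith
  set l := t - s with hldef
  set ρ := ‖q - p - germ σ ζ ζ2 s u p‖ with hρ
  have hρ0 : 0 ≤ ρ := norm_nonneg _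
  -- The Lipschitz error in time has order `1`, which is at least `2 * κ` because `κ ≤ 1 / 2`.
  have hlu : u - s ≤ l ^ (2 * κ) := by
    have := rpow_le_rpow_of_le_one (l := l) (a := 1) (b := 2 * κ) hl0 hl (by linarith)
      (by linarith)
    rw [Real.rpow_one] at this
    linarith
  have w1 : (u - s) ^ κ ≤ l ^ κ := by gcongr
  have w2 : (u - s) ^ (2 * κ) ≤ l ^ (2 * κ) := by gcongr
  have w3 : (t - u) ^ κ ≤ l ^ κ := by gcongr
  have w4 : (t - u) ^ (2 * κ) ≤ l ^ (2 * κ) := by gcongr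
  have w5 : l ^ (2 * κ) ≤ l ^ κ := rpow_le_rpow_of_le_one hl0 hl hκ0 (by linarith)
  have w6 : (u - s) ^ (2 / 3 : ℝ) ≤ l ^ κ :=
    (Real.rpow_le_rpow hus0 hus (by norm_num)).trans
      (rpow_le_rpow_of_le_one hl0 hl hκ0 (by linarith))
  have w7 : l ^ (2 * κ) = l ^ κ * l ^ κ := by
    rw [← Real.rpow_add_of_nonneg hl0 hκ0 hκ0]
    congr 1
    ring
  have w8 : l ^ (3 * κ) = l ^ (2 * κ) * l ^ κ := by
    rw [← Real.rpow_add_of_nonneg hl0 (by linarith) hκ0]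
    congr 1
    ring
  have hφ : ‖σ s p (ζ u - ζ s)‖ ≤ M * (R * l ^ κ) :=
    (apply_le_of_le (hσ.bound s h0 hsT p) (hζ.path s u h0 h1 huT)).trans (by gcongr)
  have hc : ‖contract (secondCoef σ s p) (ζ2 s u)‖ ≤ R * l ^ (2 * κ) * M ^ 2 :=
    (hζ.contract_le h0 h1 huT (hσ.secondCoef_bound h0 hsT p) hR).trans (by gcongr)
  have hrem : ‖q - p - σ s p (ζ u - ζ s)‖ ≤ ρ + R * l ^ (2 * κ) * M ^ 2 := by
    have e : q - p - σ s p (ζ u - ζ s) = (q - p - germ σ ζ ζ2 s u p)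
        + contract (secondCoef σ s p) (ζ2 s u) := by
      rw [germ]
      abel
    rw [e]
    exact (norm_add_le _ _).trans (add_le_add le_rfl hc)
  have hqp : ‖q - p‖ ≤ ρ + (M * (R * l ^ κ) + R * l ^ κ * M ^ 2) := by
    have e : q - p = (q - p - germ σ ζ ζ2 s u p) + germ σ ζ ζ2 s u p := by abel
    rw [e]
    refine (norm_add_le _ _).trans (add_le_add le_rfl ((hζ.germ_bound hσ hR h0 h1 huT p).trans ?_))
    have := w2.trans w5
    gcongr
  have k1 : ‖σ u q - σ s p - fderiv ℝ (σ s) p (σ s p (ζ u - ζ s))‖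
      ≤ M * l ^ (2 * κ) + M * (ρ + R * l ^ (2 * κ) * M ^ 2) + M * (M * (R * l ^ κ)) ^ 2 :=
    (hσ.expansion_le hM h0 h1 huT p q _).trans (by gcongr)
  have k2 : ‖secondCoef σ u q - secondCoef σ s p‖
      ≤ 2 * M ^ 2 * (l ^ κ + (ρ + (M * (R * l ^ κ) + R * l ^ κ * M ^ 2))) :=
    (hσ.secondCoef_sub_le hM h0 h1 huT (by linarith) p q).trans (by gcongr)
  rw [germ_cob hζ h0 h1 h2 h3, norm_neg]
  calc _ ≤ (M * l ^ (2 * κ) + M * (ρ + R * l ^ (2 * κ) * M ^ 2) + M * (M * (R * l ^ κ)) ^ 2)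
          * (R * l ^ κ)
        + R * l ^ (2 * κ) * (2 * M ^ 2 * (l ^ κ + (ρ + (M * (R * l ^ κ) + R * l ^ κ * M ^ 2)))) :=
        (norm_add_le _ _).trans (add_le_add
          (apply_le_of_le k1 ((hζ.path u t hu0 h2 h3).trans (by gcongr)))
          ((hζ.contract_le hu0 h2 h3 k2 hR).trans (by gcongr)))
    _ = ((M + M * (R * M ^ 2) + M * (M * R) ^ 2) * R
          + R * (2 * M ^ 2 * (1 + (M * R + R * M ^ 2)))) * l ^ (3 * κ)
        + (M * R) * (ρ * l ^ κ) + 2 * R * M ^ 2 * (ρ * l ^ (2 * κ)) := by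
        rw [w8, w7]
        ring
    _ ≤ ((M + M * (R * M ^ 2) + M * (M * R) ^ 2) * R
          + R * (2 * M ^ 2 * (1 + (M * R + R * M ^ 2)))) * l ^ (3 * κ)
        + (M * R) * (ρ * l ^ κ) + 2 * R * M ^ 2 * (ρ * l ^ κ) := by gcongr
    _ ≤ _ := by
        set c := (M + M * (R * M ^ 2) + M * (M * R) ^ 2) * R
          + R * (2 * M ^ 2 * (1 + (M * R + R * M ^ 2))) with hcdef
        have hc0 : 0 ≤ c := by positivity
        have p1 : 0 ≤ (M * R + 2 * R * M ^ 2) * l ^ (3 * κ) := by positivity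
        have p2 : 0 ≤ c * (ρ * l ^ κ) := by positivity
        linarith

/-- The two terms of `germ_cob` are differenced between `(p, q)` and `(p', q')`. To keep every
contribution linear in these differences, one more derivative is spent than in `germ_cob_le`, which
is where the Lipschitz bound on `D²σ` enters. -/
lemma IsDriver.germ_cob_diff_le (hζ : IsDriver κ R T ζ ζ2) (hσ : IsRegular M T σ) (hR : 0 ≤ R)
    (hM : 0 ≤ M) (hκ : 1 / 3 < κ) {s u t : ℝ} (h0 : 0 ≤ s) (h1 : s ≤ u)
    (h2 : u ≤ t) (h3 : t ≤ T) (hl : t - s ≤ 1) (p q p' q' : V) :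
    ‖(germ σ ζ ζ2 s t p' - germ σ ζ ζ2 s t p) - (germ σ ζ ζ2 s u p' - germ σ ζ ζ2 s u p)
        - (germ σ ζ ζ2 u t q' - germ σ ζ ζ2 u t q)‖
      ≤ (M * (1 + 2 * R * M ^ 2 + (1 + M * R) * (1 + R * M ^ 2) + 2 * (M * R) ^ 2) * R
          + 4 * M ^ 2 * R * (2 + 2 * (M * R + 2 * R * M ^ 2))) * (t - s) ^ κ *
        (‖p' - p‖ * ((t - s) ^ (2 / 3 : ℝ) + ‖q - p - germ σ ζ ζ2 s u p‖)
          + ‖q' - q‖ * (t - s) ^ (2 / 3 : ℝ)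
          + ‖(q' - q) - (p' - p) - (germ σ ζ ζ2 s u p' - germ σ ζ ζ2 s u p)‖) := by
  have hl0 : 0 ≤ t - s := by linarith
  have hus0 : 0 ≤ u - s := by linarith
  have hus : u - s ≤ t - s := by linarith
  have htu0 : 0 ≤ t - u := by linarith
  have htu : t - u ≤ t - s := by linarith
  have hκ0 : 0 ≤ κ := by linarith
  have hsT : s ≤ T := by linarith
  have huT : u ≤ T := by linarith
  have hu0 : 0 ≤ u := by linarith
  set l := t - s with hldef
  set ρ := ‖q - p - germ σ ζ ζ2 s u p‖ with hρ
  set r := ‖(q' - q) - (p' - p) - (germ σ ζ ζ2 s u p' - germ σ ζ ζ2 s u p)‖ with hr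
  set P := ‖p' - p‖ with hP
  set Q := ‖q' - q‖ with hQ
  have hρ0 : 0 ≤ ρ := norm_nonneg _
  have hr0 : 0 ≤ r := norm_nonneg _
  have hP0 : 0 ≤ P := norm_nonneg _
  have hQ0 : 0 ≤ Q := norm_nonneg _
  have w1 : (u - s) ^ κ ≤ l ^ κ := by gcongr
  have w2 : (u - s) ^ (2 * κ) ≤ l ^ (2 * κ) := by gcongr
  have w3 : (t - u) ^ κ ≤ l ^ κ := by gcongr
  have w4 : (t - u) ^ (2 * κ) ≤ l ^ (2 * κ) := by gcongr
  have w5 : l ^ (2 * κ) ≤ l ^ κ := rpow_le_rpow_of_le_one hl0 hl hκ0 (by linarith)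
  have w6 : l ^ (2 * κ) ≤ l ^ (2 / 3 : ℝ) :=
    rpow_le_rpow_of_le_one hl0 hl (by norm_num) (by linarith)
  have w7 : l ^ (2 * κ) = l ^ κ * l ^ κ := by
    rw [← Real.rpow_add_of_nonneg hl0 hκ0 hκ0]
    congr 1
    ring
  have w8 : l ^ κ ≤ 1 := Real.rpow_le_one hl0 hl hκ0
  -- The weak time exponent of `Dσ σ`, helped by one of the two factors `l ^ κ` of the area, reaches
  -- `2 / 3` since `κ > 1 / 3`.
  have w9 : l ^ κ * l ^ (1 / 3 : ℝ) ≤ l ^ (2 / 3 : ℝ) := by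
    rw [← Real.rpow_add_of_nonneg hl0 hκ0 (by norm_num)]
    exact rpow_le_rpow_of_le_one hl0 hl (by norm_num) (by linarith)
  have w10 : (u - s) ^ (2 / 3 : ℝ) ≤ l ^ (2 / 3 : ℝ) := by gcongr
  have w11 : (u - s) ^ (1 / 3 : ℝ) ≤ l ^ (1 / 3 : ℝ) := by gcongr
  set c := l ^ (2 / 3 : ℝ) with hc
  have hc0 : 0 ≤ c := by positivity
  have hlκ0 : 0 ≤ l ^ κ := by positivity
  have hφ : ∀ z, ‖σ s z (ζ u - ζ s)‖ ≤ M * (R * l ^ κ) := fun z =>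
    (apply_le_of_le (hσ.bound s h0 hsT z) (hζ.path s u h0 h1 huT)).trans (by gcongr)
  have hφd : ‖σ s p' (ζ u - ζ s) - σ s p (ζ u - ζ s)‖ ≤ M * (R * l ^ κ) * P := by
    rw [← sub_apply]
    refine (apply_le_of_le (hσ.lip h0 hsT p p') (hζ.path s u h0 h1 huT)).trans ?_
    calc M * P * (R * (u - s) ^ κ) ≤ M * P * (R * l ^ κ) := by gcongr
      _ = _ := by ring
  have hcon : ‖contract (secondCoef σ s p) (ζ2 s u)‖ ≤ R * c * M ^ 2 :=
    (hζ.contract_le h0 h1 huT (hσ.secondCoef_bound h0 hsT p) hR).trans (by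
      have := w2.trans w6
      gcongr)
  have hcond : ‖contract (secondCoef σ s p' - secondCoef σ s p) (ζ2 s u)‖
      ≤ R * c * (2 * M ^ 2 * P) :=
    (hζ.contract_le h0 h1 huT (hσ.secondCoef_lip hM h0 hsT p p') hR).trans (by
      have := w2.trans w6
      gcongr)
  have hrem : ‖q - p - σ s p (ζ u - ζ s)‖ ≤ ρ + R * c * M ^ 2 := by
    have e : q - p - σ s p (ζ u - ζ s) = (q - p - germ σ ζ ζ2 s u p)
        + contract (secondCoef σ s p) (ζ2 s u) := by
      rw [germ]
      abel
    rw [e]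
    exact (norm_add_le _ _).trans (add_le_add le_rfl hcon)
  have hremd : ‖(q' - p' - σ s p' (ζ u - ζ s)) - (q - p - σ s p (ζ u - ζ s))‖
      ≤ r + R * c * (2 * M ^ 2 * P) := by
    have e : (q' - p' - σ s p' (ζ u - ζ s)) - (q - p - σ s p (ζ u - ζ s))
        = ((q' - q) - (p' - p) - (germ σ ζ ζ2 s u p' - germ σ ζ ζ2 s u p))
        + contract (secondCoef σ s p' - secondCoef σ s p) (ζ2 s u) := by
      rw [germ, germ, contract_sub]
      abel
    rw [e]
    exact (norm_add_le _ _).trans (add_le_add le_rfl hcond)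
  set g : ℝ := M * R + 2 * R * M ^ 2 with hg
  have hg0 : 0 ≤ g := by positivity
  have hqp : ‖q - p‖ ≤ ρ + g * l ^ κ := by
    have e : q - p = (q - p - germ σ ζ ζ2 s u p) + germ σ ζ ζ2 s u p := by abel
    rw [e]
    refine (norm_add_le _ _).trans (add_le_add le_rfl ((hζ.germ_bound hσ hR h0 h1 huT p).trans ?_))
    calc _ ≤ M * (R * l ^ κ) + R * l ^ κ * M ^ 2 := by
          have := w2.trans w5
          gcongr
      _ ≤ _ := by
          have : 0 ≤ R * M ^ 2 * l ^ κ := by positivity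
          rw [hg]
          linarith
  have hdd : ‖(q' - q) - (p' - p)‖ ≤ r + g * l ^ κ * P := by
    have e : (q' - q) - (p' - p)
        = ((q' - q) - (p' - p) - (germ σ ζ ζ2 s u p' - germ σ ζ ζ2 s u p))
          + (germ σ ζ ζ2 s u p' - germ σ ζ ζ2 s u p) := by abel
    rw [e]
    refine (norm_add_le _ _).trans (add_le_add le_rfl
      ((hζ.germ_lip hσ hR hM h0 h1 huT p p').trans ?_))
    calc _ ≤ M * P * (R * l ^ κ) + R * l ^ κ * (2 * M ^ 2 * P) := by
          have := w2.trans w5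
          gcongr
      _ = _ := by
          rw [hg]
          ring
  have k1 := hσ.expansion_diff_le hM (e := M * (R * l ^ κ)) h0 h1 huT p q p' q'
    (σ s p (ζ u - ζ s)) (σ s p' (ζ u - ζ s)) (hφ p) (hφ p') hφd
  have k1' : ‖(σ u q' - σ s p' - fderiv ℝ (σ s) p' (σ s p' (ζ u - ζ s)))
      - (σ u q - σ s p - fderiv ℝ (σ s) p (σ s p (ζ u - ζ s)))‖
      ≤ M * (1 + 2 * R * M ^ 2 + (1 + M * R) * (1 + R * M ^ 2) + 2 * (M * R) ^ 2)
        * (P * (c + ρ) + Q * c + r) := by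
    have he1 : M * (R * l ^ κ) ≤ M * R := by
      rw [← mul_assoc]
      exact mul_le_of_le_one_right (by positivity) w8
    have he2 : (M * (R * l ^ κ)) ^ 2 ≤ (M * R) ^ 2 * c := by
      calc (M * (R * l ^ κ)) ^ 2 = (M * R) ^ 2 * (l ^ κ * l ^ κ) := by ring
        _ ≤ _ := by
          rw [← w7]
          gcongr
    calc _ ≤ M * (u - s) ^ (2 / 3 : ℝ) * Q
          + (M * ‖(q' - p' - σ s p' (ζ u - ζ s)) - (q - p - σ s p (ζ u - ζ s))‖
            + M * ‖q - p - σ s p (ζ u - ζ s)‖ * ((1 + M * (R * l ^ κ)) * P))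
          + M * (M * (R * l ^ κ)) ^ 2 * P + M * (M * (R * l ^ κ)) ^ 2 * P := k1
      _ ≤ M * c * Q + (M * (r + R * c * (2 * M ^ 2 * P))
            + M * (ρ + R * c * M ^ 2) * ((1 + M * R) * P))
          + M * ((M * R) ^ 2 * c) * P + M * ((M * R) ^ 2 * c) * P := by gcongr
      _ = M * (Q * c + r + 2 * R * M ^ 2 * (P * c)
          + (1 + M * R) * (P * ρ + R * M ^ 2 * (P * c)) + 2 * (M * R) ^ 2 * (P * c)) := by ring
      _ ≤ M * (1 * (P * (c + ρ) + Q * c + r)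
          + 2 * R * M ^ 2 * (P * (c + ρ) + Q * c + r)
          + (1 + M * R) * ((P * (c + ρ) + Q * c + r) + R * M ^ 2 * (P * (c + ρ) + Q * c + r))
          + 2 * (M * R) ^ 2 * (P * (c + ρ) + Q * c + r)) := by
        have q1 : 0 ≤ P * c := by positivity
        have q2 : 0 ≤ P * ρ := by positivity
        have q3 : 0 ≤ Q * c := by positivity
        have z1 : P * c ≤ P * (c + ρ) + Q * c + r := by linarith
        have z2 : P * ρ ≤ P * (c + ρ) + Q * c + r := by linarith
        have z3 : Q * c + r ≤ 1 * (P * (c + ρ) + Q * c + r) := by linarith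
        gcongr
      _ = _ := by ring
  have k2 := hσ.secondCoef_four_point hM h0 h1 huT (by linarith) p q p' q'
  have k2' : ‖(secondCoef σ u q' - secondCoef σ u q) - (secondCoef σ s p' - secondCoef σ s p)‖
      ≤ 4 * M ^ 2 * (r + g * l ^ κ * P + (ρ + g * l ^ κ) * P + (P + Q) * l ^ (1 / 3 : ℝ)) :=
    k2.trans (by gcongr)
  have e : (germ σ ζ ζ2 s t p' - germ σ ζ ζ2 s t p) - (germ σ ζ ζ2 s u p' - germ σ ζ ζ2 s u p)
        - (germ σ ζ ζ2 u t q' - germ σ ζ ζ2 u t q)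
      = -(((σ u q' - σ s p' - fderiv ℝ (σ s) p' (σ s p' (ζ u - ζ s)))
          - (σ u q - σ s p - fderiv ℝ (σ s) p (σ s p (ζ u - ζ s)))) (ζ t - ζ u)
        + contract ((secondCoef σ u q' - secondCoef σ u q)
          - (secondCoef σ s p' - secondCoef σ s p)) (ζ2 u t)) := by
    have e1 := germ_cob (σ := σ) hζ h0 h1 h2 h3 p q
    have e2 := germ_cob (σ := σ) hζ h0 h1 h2 h3 p' q'
    have e3 : (germ σ ζ ζ2 s t p' - germ σ ζ ζ2 s t p)
        - (germ σ ζ ζ2 s u p' - germ σ ζ ζ2 s u p) - (germ σ ζ ζ2 u t q' - germ σ ζ ζ2 u t q)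
        = (germ σ ζ ζ2 s t p' - germ σ ζ ζ2 s u p' - germ σ ζ ζ2 u t q')
          - (germ σ ζ ζ2 s t p - germ σ ζ ζ2 s u p - germ σ ζ ζ2 u t q) := by abel
    rw [e3, e1, e2, sub_sub_sub_comm (secondCoef σ u q'), contract_sub _
      (secondCoef σ u q - secondCoef σ s p), sub_apply
      (σ u q' - σ s p' - fderiv ℝ (σ s) p' (σ s p' (ζ u - ζ s)))]
    abel
  rw [e, norm_neg]
  calc _ ≤ M * (1 + 2 * R * M ^ 2 + (1 + M * R) * (1 + R * M ^ 2) + 2 * (M * R) ^ 2)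
          * (P * (c + ρ) + Q * c + r) * (R * l ^ κ)
        + R * l ^ (2 * κ) * (4 * M ^ 2 * (r + g * l ^ κ * P + (ρ + g * l ^ κ) * P
          + (P + Q) * l ^ (1 / 3 : ℝ))) :=
        (norm_add_le _ _).trans (add_le_add
          (apply_le_of_le k1' ((hζ.path u t hu0 h2 h3).trans (by gcongr)))
          ((hζ.contract_le hu0 h2 h3 k2' hR).trans (by gcongr)))
    _ = M * (1 + 2 * R * M ^ 2 + (1 + M * R) * (1 + R * M ^ 2) + 2 * (M * R) ^ 2)
          * (P * (c + ρ) + Q * c + r) * (R * l ^ κ)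
        + 4 * M ^ 2 * R * l ^ κ * (l ^ κ * r + l ^ κ * (ρ * P) + 2 * g * (l ^ (2 * κ) * P)
          + (l ^ κ * l ^ (1 / 3 : ℝ)) * (P + Q)) := by
        rw [w7]
        ring
    _ ≤ M * (1 + 2 * R * M ^ 2 + (1 + M * R) * (1 + R * M ^ 2) + 2 * (M * R) ^ 2)
          * (P * (c + ρ) + Q * c + r) * (R * l ^ κ)
        + 4 * M ^ 2 * R * l ^ κ * (1 * r + 1 * (ρ * P) + 2 * g * (c * P) + c * (P + Q)) := by
        gcongr
    _ ≤ M * (1 + 2 * R * M ^ 2 + (1 + M * R) * (1 + R * M ^ 2) + 2 * (M * R) ^ 2)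
          * (P * (c + ρ) + Q * c + r) * (R * l ^ κ)
        + 4 * M ^ 2 * R * l ^ κ * ((2 + 2 * g) * (P * (c + ρ) + Q * c + r)) := by
        have q1 : 0 ≤ P * c := by positivity
        have q2 : 0 ≤ P * ρ := by positivity
        have q3 : 0 ≤ Q * c := by positivity
        have z1 : 2 * g * (c * P) ≤ 2 * g * (P * (c + ρ) + Q * c + r) := by
          have : c * P ≤ P * (c + ρ) + Q * c + r := by linarith
          gcongr
        have z2 : 1 * r + 1 * (ρ * P) + 2 * g * (c * P) + c * (P + Q)
            ≤ (2 + 2 * g) * (P * (c + ρ) + Q * c + r) := by linarith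
        gcongr
    _ = _ := by ring

end Driver

/-! ### The germ of the rough differential equation satisfies `IsGerm`. -/

section Germ

variable {d : ℕ} {V : Type*} [NormedAddCommGroup V] [NormedSpace ℝ V]
  {κ R M T : ℝ} {ζ : ℝ → E d} {ζ2 : ℝ → ℝ → Matrix (Fin d) (Fin d) ℝ} {σ : ℝ → V → E d →L[ℝ] V}

section Tendsto

variable {A W Z : Type*} [NormedAddCommGroup A] [NormedSpace ℝ A]
  [NormedAddCommGroup W] [NormedSpace ℝ W] [NormedAddCommGroup Z] [NormedSpace ℝ Z]

lemma tendsto_of_norm_sub_le {f : ℕ → A} {a : A} {c : ℕ → ℝ} (h : ∀ n, ‖a - f n‖ ≤ c n)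
    (hc : Tendsto c atTop (𝓝 0)) : Tendsto f atTop (𝓝 a) :=
  tendsto_iff_norm_sub_tendsto_zero.mpr
    (squeeze_zero (fun n => norm_nonneg (f n - a)) (fun n => by rw [norm_sub_rev]; exact h n) hc)

lemma tendsto_norm_sub_zero {f : ℕ → A} {a : A} (h : Tendsto f atTop (𝓝 a)) :
    Tendsto (fun n => ‖f n - a‖) atTop (𝓝 0) :=
  tendsto_iff_norm_sub_tendsto_zero.mp h

lemma tendsto_clm_apply {L : ℕ → A →L[ℝ] W} {f : ℕ → A} {l : A →L[ℝ] W} {a : A}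
    (hL : Tendsto L atTop (𝓝 l)) (hf : Tendsto f atTop (𝓝 a)) :
    Tendsto (fun n => L n (f n)) atTop (𝓝 (l a)) :=
  ((isBoundedBilinearMap_apply (𝕜 := ℝ) (E := A) (F := W)).continuous.tendsto (l, a)).comp
    (hL.prodMk_nhds hf)

lemma tendsto_clm_comp {L : ℕ → W →L[ℝ] Z} {P : ℕ → A →L[ℝ] W} {l : W →L[ℝ] Z} {p : A →L[ℝ] W}
    (hL : Tendsto L atTop (𝓝 l)) (hP : Tendsto P atTop (𝓝 p)) :
    Tendsto (fun n => (L n).comp (P n)) atTop (𝓝 (l.comp p)) :=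
  ((isBoundedBilinearMap_comp (𝕜 := ℝ) (E := A) (F := W) (G := Z)).continuous.tendsto
    (l, p)).comp (hL.prodMk_nhds hP)

lemma tendsto_apply_apply (μ : A →L[ℝ] W →L[ℝ] Z) {f : ℕ → A} {g : ℕ → W} {a : A} {b : W}
    (hf : Tendsto f atTop (𝓝 a)) (hg : Tendsto g atTop (𝓝 b)) :
    Tendsto (fun n => μ (f n) (g n)) atTop (𝓝 (μ a b)) :=
  tendsto_clm_apply ((μ.continuous.tendsto a).comp hf) hg

end Tendsto

lemma IsRegular.tendsto_secondCoef (hσ : IsRegular M T σ) {s : ℝ} (hsT : s ≤ T) (x : V)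
    {a : ℕ → ℝ} (ha0 : ∀ n, 0 ≤ a n) (has : ∀ n, a n ≤ s) (ha : Tendsto a atTop (𝓝 s)) :
    Tendsto (fun n => σ (a n) x) atTop (𝓝 (σ s x)) ∧
      Tendsto (fun n => secondCoef σ (a n) x) atTop (𝓝 (secondCoef σ s x)) := by
  have has0 : Tendsto (fun n => s - a n) atTop (𝓝 0) := by simpa using ha.const_sub s
  have hσa : Tendsto (fun n => σ (a n) x) atTop (𝓝 (σ s x)) :=
    tendsto_of_norm_sub_le (fun n => hσ.time _ _ (ha0 n) (has n) hsT x)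
      (by simpa using has0.const_mul M)
  have hσa' : Tendsto (fun n => fderiv ℝ (σ (a n)) x) atTop (𝓝 (fderiv ℝ (σ s) x)) := by
    have h0 : Tendsto (fun n => M * (s - a n) ^ (2 / 3 : ℝ)) atTop (𝓝 0) := by
      have := (has0.rpow_const (p := 2 / 3) (Or.inr (by norm_num))).const_mul M
      rwa [Real.zero_rpow (by norm_num), mul_zero] at this
    exact tendsto_of_norm_sub_le (fun n => hσ.time' _ _ (ha0 n) (has n) hsT x) h0
  exact ⟨hσa, tendsto_clm_comp hσa' hσa⟩

/-- Continuity of the area is derived, not assumed: Chen's relation used at `s` and at `b n`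
expresses `ζ2 (a n) (b n)` through `ζ2 s t` and terms carried by the short intervals `[a n, s]` and
`[b n, t]`. Approach from the left and `s < t` give the order `a n ≤ s ≤ b n ≤ t` eventually. -/
lemma IsDriver.tendsto_germ (hζ : IsDriver κ R T ζ ζ2) (hσ : IsRegular M T σ) (hR : 0 ≤ R)
    (hκ : 0 < κ) {s t : ℝ} (h0 : 0 ≤ s) (hst : s < t) (hT : t ≤ T) (x : V)
    {a b : ℕ → ℝ} (ha0 : ∀ n, 0 ≤ a n) (has : ∀ n, a n ≤ s) (hbt : ∀ n, b n ≤ t)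
    (ha : Tendsto a atTop (𝓝 s)) (hb : Tendsto b atTop (𝓝 t)) :
    Tendsto (fun n => germ σ ζ ζ2 (a n) (b n) x) atTop (𝓝 (germ σ ζ ζ2 s t x)) := by
  have hsT : s ≤ T := hst.le.trans hT
  have hsb : ∀ᶠ n in atTop, s ≤ b n := (hb.eventually (lt_mem_nhds hst)).mono fun _ h => h.le
  have has0 : Tendsto (fun n => s - a n) atTop (𝓝 0) := by simpa using ha.const_sub s
  have hbt0 : Tendsto (fun n => t - b n) atTop (𝓝 0) := by simpa using hb.const_sub t
  have hpow : ∀ {f : ℕ → ℝ}, Tendsto f atTop (𝓝 0) → ∀ {p : ℝ}, 0 < p → ∀ c : ℝ,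
      Tendsto (fun n => c * f n ^ p) atTop (𝓝 0) := by
    intro f hf p hp c
    have := (hf.rpow_const (p := p) (Or.inr hp.le)).const_mul c
    rwa [Real.zero_rpow hp.ne', mul_zero] at this
  have hζa : Tendsto (fun n => ζ s - ζ (a n)) atTop (𝓝 0) :=
    squeeze_zero_norm (fun n => hζ.path _ _ (ha0 n) (has n) hsT) (hpow has0 hκ R)
  have hζb : Tendsto (fun n => ζ t - ζ (b n)) atTop (𝓝 0) :=
    squeeze_zero_norm' (hsb.mono fun n hn => hζ.path _ _ (h0.trans hn) (hbt n) hT)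
      (hpow hbt0 hκ R)
  have hζab : Tendsto (fun n => ζ (b n) - ζ (a n)) atTop (𝓝 (ζ t - ζ s)) := by
    have := (hζa.sub hζb).add_const (ζ t - ζ s)
    rw [sub_zero, zero_add] at this
    refine this.congr fun n => ?_
    abel
  have hζb' : Tendsto (fun n => ζ (b n) - ζ s) atTop (𝓝 (ζ t - ζ s)) := by
    have := hζb.const_sub (ζ t - ζ s)
    rw [sub_zero] at this
    refine this.congr fun n => ?_
    abel
  obtain ⟨hσa, hcoef⟩ := hσ.tendsto_secondCoef hsT x ha0 has ha
  have h1 : Tendsto (fun n => σ (a n) x (ζ (b n) - ζ (a n))) atTop (𝓝 (σ s x (ζ t - ζ s))) :=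
    tendsto_clm_apply hσa hζab
  have h2 : Tendsto (fun n => contract (secondCoef σ (a n) x - secondCoef σ s x)
      (ζ2 (a n) (b n))) atTop (𝓝 0) := by
    have h3 : Tendsto (fun n => R * (b n - a n) ^ (2 * κ)) atTop (𝓝 (R * (t - s) ^ (2 * κ))) :=
      ((hb.sub ha).rpow_const (Or.inr (by linarith))).const_mul R
    have h3 := h3.mul (tendsto_norm_sub_zero (A := E d →L[ℝ] E d →L[ℝ] V) hcoef)
    rw [mul_zero] at h3
    exact squeeze_zero_norm' (hsb.mono fun n hn =>
      hζ.contract_le (ha0 n) ((has n).trans hn) ((hbt n).trans hT) le_rfl hR) h3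
  set μ := secondCoef σ s x with hμ
  have h3 : Tendsto (fun n => contract μ (ζ2 (a n) s)) atTop (𝓝 0) := by
    have := (hpow has0 (p := 2 * κ) (by linarith) R).mul_const ‖μ‖
    rw [zero_mul] at this
    exact squeeze_zero_norm (fun n => hζ.contract_le (ha0 n) (has n) hsT le_rfl hR) this
  have h4 : Tendsto (fun n => contract μ (ζ2 (b n) t)) atTop (𝓝 0) := by
    have := (hpow hbt0 (p := 2 * κ) (by linarith) R).mul_const ‖μ‖
    rw [zero_mul] at this
    exact squeeze_zero_norm' (hsb.mono fun n hn =>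
      hζ.contract_le (h0.trans hn) (hbt n) hT le_rfl hR) this
  have h5 : Tendsto (fun n => μ (ζ s - ζ (a n)) (ζ (b n) - ζ s)) atTop (𝓝 0) := by
    simpa using tendsto_apply_apply μ hζa hζb'
  have h6 : Tendsto (fun n => μ (ζ (b n) - ζ s) (ζ t - ζ (b n))) atTop (𝓝 0) := by
    simpa using tendsto_apply_apply μ hζb' hζb
  have h7 := ((((h1.add h2).add h3).add h5).sub h4).sub h6 |>.add_const (contract μ (ζ2 s t))
  simp only [add_zero, sub_zero] at h7
  refine h7.congr' (hsb.mono fun n hn => ?_)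
  have c1 := hζ.chen (a n) s (b n) (ha0 n) (has n) hn ((hbt n).trans hT)
  have c2 := hζ.chen s (b n) t h0 hn (hbt n) hT
  simp only [germ, contract_sub]
  simp only [c2, c1, contract_add_right, contract_vecMulVec]
  abel

/-- The germ of a rough differential equation. -/
theorem IsDriver.exists_isGerm (hζ : IsDriver κ R T ζ ζ2) (hσ : IsRegular M T σ) (hR : 0 ≤ R)
    (hM : 0 ≤ M) (hT : 0 < T) (hκ : 1 / 3 < κ) (hκ2 : κ ≤ 1 / 2) :
    ∃ C : ℝ, 0 ≤ C ∧ IsGerm κ C T (germ σ ζ ζ2) (germLin σ ζ ζ2) := by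
  set c₁ : ℝ := M * R + 3 * M ^ 2 * R * T ^ κ with hc₁
  set c₂ : ℝ := (M + M * (R * M ^ 2) + M * (M * R) ^ 2) * R
          + R * (2 * M ^ 2 * (1 + (M * R + R * M ^ 2))) + M * R + 2 * R * M ^ 2 with hc₂
  set c₃ : ℝ := M * (1 + 2 * R * M ^ 2 + (1 + M * R) * (1 + R * M ^ 2) + 2 * (M * R) ^ 2) * R
          + 4 * M ^ 2 * R * (2 + 2 * (M * R + 2 * R * M ^ 2)) with hc₃
  have hc₁0 : 0 ≤ c₁ := by positivity
  have hc₂0 : 0 ≤ c₂ := by positivity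
  have hc₃0 : 0 ≤ c₃ := by positivity
  have hκ0 : 0 ≤ κ := by linarith
  -- The size, Lipschitz, Taylor and linear bounds share this shape. They are required on all of
  -- `[0, T]`, hence the factor `T ^ κ` in reducing order `2 * κ` to `κ`.
  have key : ∀ u v : ℝ, 0 ≤ u → u ≤ v → v ≤ T → ∀ k z : ℝ, 0 ≤ z → k ≤ 3 →
      M * z * (R * (v - u) ^ κ) + R * (v - u) ^ (2 * κ) * (k * M ^ 2 * z)
        ≤ (c₁ + c₂ + c₃) * (v - u) ^ κ * z := by
    intro u v g1 g2 g3 k z hz hk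
    have hl0 : 0 ≤ v - u := by linarith
    have hlT : v - u ≤ T := by linarith
    have e : (v - u) ^ (2 * κ) ≤ T ^ κ * (v - u) ^ κ := by
      rw [two_mul, Real.rpow_add_of_nonneg hl0 hκ0 hκ0]
      gcongr
    calc _ ≤ M * z * (R * (v - u) ^ κ) + R * (v - u) ^ (2 * κ) * (3 * M ^ 2 * z) := by gcongr
      _ ≤ M * z * (R * (v - u) ^ κ) + R * (T ^ κ * (v - u) ^ κ) * (3 * M ^ 2 * z) := by gcongr
      _ = c₁ * (v - u) ^ κ * z := by
        rw [hc₁]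
        ring
      _ ≤ _ := by
        gcongr
        linarith
  refine ⟨c₁ + c₂ + c₃, by positivity, ?_⟩
  constructor
  · intro u v g1 g2 g3 x
    have := key u v g1 g2 g3 1 1 zero_le_one (by norm_num)
    simp only [mul_one, one_mul] at this
    exact (hζ.germ_bound hσ hR g1 g2 g3 x).trans this
  · intro u v g1 g2 g3 x x'
    exact (hζ.germ_lip hσ hR hM g1 g2 g3 x x').trans
      (key u v g1 g2 g3 2 _ (norm_nonneg _) (by norm_num))
  · intro u v g1 g2 g3 x h
    exact (hζ.germ_taylor hσ hR hM g1 g2 g3 x h).trans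
      (key u v g1 g2 g3 3 _ (by positivity) le_rfl)
  · intro u v x h h'
    have e : secondCoefDeriv σ u x (h - h')
        = secondCoefDeriv σ u x h - secondCoefDeriv σ u x h' := by
      simp only [secondCoefDeriv, map_sub, ContinuousLinearMap.sub_comp,
        ContinuousLinearMap.comp_sub]
      abel
    rw [germLin, e, contract_sub, map_sub (fderiv ℝ (σ u) x) h h', sub_apply, germLin, germLin]
    abel
  · intro u v x c h
    have e : secondCoefDeriv σ u x (c • h) = c • secondCoefDeriv σ u x h := by
      simp only [secondCoefDeriv, map_smul, ContinuousLinearMap.smul_comp,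
        ContinuousLinearMap.comp_smul, smul_add]
    rw [germLin, e, contract_smul, map_smul (fderiv ℝ (σ u) x) c h, smul_apply, germLin, smul_add]
  · intro u v g1 g2 g3 x h
    exact (hζ.germLin_bound hσ hR g1 g2 g3 x h).trans
      (key u v g1 g2 g3 2 _ (norm_nonneg _) (by norm_num))
  · intro s u t g1 g2 g3 g4 hl p q
    have hl0 : 0 ≤ t - s := by linarith
    have hc : c₂ ≤ c₁ + c₂ + c₃ := by linarith
    have hn := norm_nonneg (q - p - germ σ ζ ζ2 s u p)
    refine (hζ.germ_cob_le hσ hR hM hκ hκ2 g1 g2 g3 g4 hl p q).trans ?_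
    rw [← hc₂]
    exact mul_le_mul_of_nonneg_right hc (by positivity)
  · intro s u t g1 g2 g3 g4 hl p q p' q'
    have hl0 : 0 ≤ t - s := by linarith
    have hc : c₃ ≤ c₁ + c₂ + c₃ := by linarith
    refine (hζ.germ_cob_diff_le hσ hR hM hκ g1 g2 g3 g4 hl p q p' q').trans ?_
    rw [← hc₃]
    have hn := norm_nonneg (q' - p' - germ σ ζ ζ2 s u p')
    refine mul_le_mul (mul_le_mul_of_nonneg_right hc (by positivity)) ?_ (by positivity)
      (by positivity)
    have h4 : ‖p' - p‖ * ((t - s) ^ (2 / 3 : ℝ) + ‖q - p - germ σ ζ ζ2 s u p‖)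
        ≤ ‖p' - p‖ * ((t - s) ^ (2 / 3 : ℝ) + ‖q - p - germ σ ζ ζ2 s u p‖
          + ‖q' - p' - germ σ ζ ζ2 s u p'‖) :=
      mul_le_mul_of_nonneg_left (by linarith) (norm_nonneg _)
    linarith
  · intro s t g1 g2 g3 x a b k1 k2 k3 k4 k5
    exact hζ.tendsto_germ hσ hR (by linarith) g1 g2 g3 x k1 k2 k3 k4 k5

end Germ

/-! ### Convergence in `W2` implies weak convergence. -/

section Wasserstein

variable {X : Type*} [PseudoMetricSpace X] [SecondCountableTopology X] [MeasurableSpace X]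
  [BorelSpace X]

/-- The diagonal coupling has zero cost. -/
lemma W2_self (ν : ProbabilityMeasure X) : W2 ν ν = 0 := by
  refine le_antisymm ?_ zero_le
  refine (iInf₂_le ((ν : Measure X).map fun a => (a, a)) ⟨?_, ?_⟩).trans ?_
  · rw [lintegral_map (by fun_prop) (by fun_prop)]
    simp
  · rw [Measure.map_map measurable_fst (by fun_prop)]
    exact Measure.map_id
  · rw [Measure.map_map measurable_snd (by fun_prop)]
    exact Measure.map_id

/-- Integrals of Lipschitz functions are continuous for the Wasserstein distance. -/
lemma abs_integral_sub_le_of_W2_lt {ν₁ ν₂ : ProbabilityMeasure X} {f : X → ℝ} {C : ℝ} {L : NNReal}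
    (hC : ∀ a, |f a| ≤ C) (hf : LipschitzWith L f) {δ : ℝ} (hδ : 0 ≤ δ)
    (h : W2 ν₁ ν₂ < ENNReal.ofReal δ) :
    |(∫ a, f a ∂(ν₁ : Measure X)) - ∫ a, f a ∂(ν₂ : Measure X)| ≤ L * δ := by
  rw [W2] at h
  simp only [iInf_lt_iff] at h
  obtain ⟨π, ⟨h1, h2⟩, h3⟩ := h
  have hπ : IsProbabilityMeasure π := by
    have : IsProbabilityMeasure (π.map Prod.fst) := h1 ▸ inferInstance
    exact Measure.isProbabilityMeasure_of_map Prod.fst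
  have hint : ∀ g : X × X → X, Measurable g → Integrable (fun p => f (g p)) π := fun g hg =>
    Integrable.of_bound (hf.continuous.measurable.comp hg).aestronglyMeasurable C
      (Eventually.of_forall fun p => hC (g p))
  rw [← h1, ← h2, integral_map measurable_fst.aemeasurable
    hf.continuous.measurable.aestronglyMeasurable, integral_map measurable_snd.aemeasurable
    hf.continuous.measurable.aestronglyMeasurable, ← integral_sub (hint _ measurable_fst)
    (hint _ measurable_snd), ← Real.norm_eq_abs]
  have hmeas : AEMeasurable (fun p : X × X => edist p.1 p.2) π := by fun_prop
  -- Cauchy–Schwarz against the constant `1`, the coupling having total mass one.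
  have h4 : ∫⁻ p, edist p.1 p.2 ∂π ≤ ENNReal.ofReal δ := by
    have := ENNReal.lintegral_mul_le_Lp_mul_Lq π Real.HolderConjugate.two_two hmeas
      (g := fun _ => 1) aemeasurable_const
    simp only [Pi.mul_apply, mul_one, ENNReal.one_rpow, lintegral_one, measure_univ] at this
    refine this.trans ((le_of_eq ?_).trans h3.le)
    norm_cast
  have h5 : ‖∫ p, (f p.1 - f p.2) ∂π‖ₑ ≤ L * ENNReal.ofReal δ := by
    refine (enorm_integral_le_lintegral_enorm _).trans ?_
    calc _ ≤ ∫⁻ p, L * edist p.1 p.2 ∂π := by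
          refine lintegral_mono fun p => ?_
          rw [← edist_eq_enorm_sub]
          exact hf p.1 p.2
      _ = L * ∫⁻ p, edist p.1 p.2 ∂π := lintegral_const_mul'' _ hmeas
      _ ≤ _ := by gcongr
  rw [← ofReal_norm, ← ENNReal.ofReal_coe_nnreal, ← ENNReal.ofReal_mul (by positivity)] at h5
  exact (ENNReal.ofReal_le_ofReal_iff (by positivity)).mp h5

/-- Weak convergence can be tested on bounded Lipschitz functions, whose integrals are Lipschitz for
`W2`. -/
lemma tendsto_of_tendsto_W2 {ι : Type*} {l : Filter ι} [l.IsCountablyGenerated]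
    {νs : ι → ProbabilityMeasure X} {ν : ProbabilityMeasure X}
    (h : Tendsto (fun i => W2 ν (νs i)) l (𝓝 0)) : Tendsto νs l (𝓝 ν) := by
  refine tendsto_iff_forall_lipschitz_integral_tendsto.mpr fun f ⟨C, hC⟩ ⟨L, hL⟩ => ?_
  obtain ⟨a₀⟩ : Nonempty X := nonempty_of_isProbabilityMeasure (ν : Measure X)
  have hb : ∀ a, |f a| ≤ C + |f a₀| := fun a => by
    have h1 := hC a a₀
    have h2 := abs_add_le (f a - f a₀) (f a₀)
    rw [Real.dist_eq] at h1
    rw [sub_add_cancel] at h2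
    linarith
  refine Metric.tendsto_nhds.mpr fun η hη => ?_
  have hδ : 0 < η / (2 * (L + 1)) := by positivity
  filter_upwards [h.eventually (gt_mem_nhds (ENNReal.ofReal_pos.mpr hδ))] with i hi
  rw [dist_comm, Real.dist_eq]
  refine (abs_integral_sub_le_of_W2_lt hb hL hδ.le hi).trans_lt ?_
  rw [← mul_div_assoc, div_lt_iff₀ (by positivity)]
  nlinarith [L.2]

lemma IsRelaxedControl.tendsto_W2 {T ε L : ℝ} {K : Set (ProbabilityMeasure X)}
    {γ : ℝ → ProbabilityMeasure X} (hγ : IsRelaxedControl T ε L K γ) (hε : 0 < ε) {s : ℝ}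
    (hs : s ∈ Icc 0 T) : Tendsto (fun t => W2 (γ s) (γ t)) (𝓝[Icc 0 T] s) (𝓝 0) := by
  have h1 : Tendsto (fun t : ℝ => ENNReal.ofReal (L * |t - s| ^ ε)) (𝓝[Icc 0 T] s) (𝓝 0) := by
    have h1 : Continuous fun t : ℝ => L * |t - s| ^ ε :=
      continuous_const.mul ((continuous_id.sub continuous_const).abs.rpow_const
        fun _ => Or.inr hε.le)
    have h2 := ENNReal.tendsto_ofReal (h1.tendsto s)
    simp only [sub_self, abs_zero, Real.zero_rpow hε.ne', mul_zero, ENNReal.ofReal_zero] at h2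
    exact h2.mono_left nhdsWithin_le_nhds
  refine tendsto_of_tendsto_of_tendsto_of_le_of_le' tendsto_const_nhds h1
    (Eventually.of_forall fun _ => zero_le) ?_
  filter_upwards [self_mem_nhdsWithin] with t ht
  exact hγ.2 s hs t ht

lemma IsRelaxedControl.continuousOn {T ε L : ℝ} {K : Set (ProbabilityMeasure X)}
    {γ : ℝ → ProbabilityMeasure X} (hγ : IsRelaxedControl T ε L K γ) (hε : 0 < ε) :
    ContinuousOn γ (Icc 0 T) :=
  fun _ hs => tendsto_of_tendsto_W2 (hγ.tendsto_W2 hε hs)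

/-- Weak convergence is formulated with real test functions; vector values are treated coordinate by
coordinate. -/
lemma tendsto_integral_of_tendsto {m : ℕ} {ι : Type*} {l : Filter ι}
    {νs : ι → ProbabilityMeasure X} {ν : ProbabilityMeasure X} (h : Tendsto νs l (𝓝 ν))
    {f : X → E m} (hf : Continuous f) {C : ℝ} (hC : ∀ a, ‖f a‖ ≤ C) :
    Tendsto (fun i => ∫ a, f a ∂(νs i : Measure X)) l (𝓝 (∫ a, f a ∂(ν : Measure X))) := by
  have hint : ∀ η : ProbabilityMeasure X, Integrable f (η : Measure X) := fun η =>
    Integrable.of_bound hf.aestronglyMeasurable C (Eventually.of_forall hC)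
  rw [(EuclideanSpace.equiv (Fin m) ℝ).toHomeomorph.isInducing.tendsto_nhds_iff]
  refine tendsto_pi_nhds.mpr fun i => ?_
  have hcoord : ∀ η : ProbabilityMeasure X, (∫ a, f a ∂(η : Measure X)) i
      = ∫ a, f a i ∂(η : Measure X) := fun η =>
    ((EuclideanSpace.proj (𝕜 := ℝ) i).integral_comp_comm (hint η)).symm
  have := ProbabilityMeasure.tendsto_iff_forall_integral_tendsto.mp h
    (BoundedContinuousFunction.ofNormedAddCommGroup (fun a => f a i) (by fun_prop) C
      fun a => (PiLp.norm_apply_le (f a) i).trans (hC a))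
  refine (this.congr fun j => (hcoord (νs j)).symm).trans_eq ?_
  exact congrArg 𝓝 (hcoord ν).symm

end Wasserstein

/-! ### The relaxed drift as a drift field. -/

section Drift

variable {m k : ℕ} {T : ℝ} {U : Set (E k)} {b : ℝ → E m → E k → E m}

lemma IsDrift.continuous_control (hb : IsDrift T U b) {r : ℝ} (hr : r ∈ Icc 0 T) (x : E m) :
    Continuous fun a : U => b r x a :=
  hb.continuousOn.comp_continuous (f := fun a : U => (r, x, (a : E k))) (by fun_prop)
    fun a => ⟨hr, mem_univ _, a.2⟩

lemma IsDrift.continuous_fderiv_control (hb : IsDrift T U b) {r : ℝ} (hr : r ∈ Icc 0 T)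
    (x : E m) : Continuous fun a : U => fderiv ℝ (fun x => b r x a) x :=
  hb.continuousOn_space.comp_continuous (f := fun a : U => (r, x, (a : E k))) (by fun_prop)
    fun a => ⟨hr, mem_univ _, a.2⟩

lemma IsDrift.integrable (hb : IsDrift T U b) {r : ℝ} (hr : r ∈ Icc 0 T) (x : E m)
    (ν : ProbabilityMeasure U) : Integrable (fun a : U => b r x a) (ν : Measure U) := by
  obtain ⟨C, hC⟩ := hb.bounded
  exact Integrable.of_bound (hb.continuous_control hr x).aestronglyMeasurable C
    (Eventually.of_forall fun a => hC r hr x a a.2)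

lemma IsDrift.norm_relaxedDrift_sub_le (hb : IsDrift T U b) {r s : ℝ} (hr : r ∈ Icc 0 T)
    (hs : s ∈ Icc 0 T) {x x' : E m} {c : ℝ} (ν : ProbabilityMeasure U)
    (h : ∀ a ∈ U, ‖b r x a - b s x' a‖ ≤ c) :
    ‖relaxedDrift b r x ν - relaxedDrift b s x' ν‖ ≤ c := by
  rw [relaxedDrift, relaxedDrift, ← integral_sub (hb.integrable hr x ν) (hb.integrable hs x' ν)]
  have := norm_integral_le_of_norm_le_const (μ := (ν : Measure U))
    (f := fun a : U => b r x a - b s x' a) (C := c) (Eventually.of_forall fun a => h a a.2)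
  simpa using this

/-- Time enters twice. Its change inside `b` is uniformly small in the control, and its change in
`γ` is a weak limit tested against the bounded continuous function `b s x`. -/
lemma IsDrift.continuousOn_relaxedDrift (hb : IsDrift T U b) {γ : ℝ → ProbabilityMeasure U}
    (hγ : ContinuousOn γ (Icc 0 T)) (x : E m) :
    ContinuousOn (fun r => relaxedDrift b r x (γ r)) (Icc 0 T) := by
  intro s hs
  obtain ⟨C, hC⟩ := hb.bounded
  have h1 : Tendsto (fun r => relaxedDrift b s x (γ r)) (𝓝[Icc 0 T] s)
      (𝓝 (relaxedDrift b s x (γ s))) :=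
    tendsto_integral_of_tendsto (hγ s hs) (hb.continuous_control hs x) fun a => hC s hs x a a.2
  refine Metric.tendsto_nhds.mpr fun η hη => ?_
  obtain ⟨δ, hδ, hu⟩ := hb.uniform_time (η / 2) (by linarith)
  filter_upwards [Metric.tendsto_nhds.mp h1 (η / 2) (by linarith), self_mem_nhdsWithin,
    nhdsWithin_le_nhds (Metric.ball_mem_nhds s hδ)] with r hr1 hr2 hr3
  have h2 := hb.norm_relaxedDrift_sub_le hr2 hs (γ r)
    fun a ha => (hu s hs r hr2 hr3 x a ha).le
  rw [← dist_eq_norm] at h2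
  linarith [dist_triangle (relaxedDrift b r x (γ r)) (relaxedDrift b s x (γ r))
    (relaxedDrift b s x (γ s))]

/-- The relaxed drift along a control, extended by zero outside of `[0,T]`. -/
noncomputable def driftField (T : ℝ) (b : ℝ → E m → E k → E m) (γ : ℝ → ProbabilityMeasure U)
    (r : ℝ) (x : E m) : E m :=
  (Icc 0 T).indicator (fun r => relaxedDrift b r x (γ r)) r

lemma driftField_of_mem {γ : ℝ → ProbabilityMeasure U} {r : ℝ} (hr : r ∈ Icc 0 T) (x : E m) :
    driftField T b γ r x = relaxedDrift b r x (γ r) :=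
  indicator_of_mem hr _

lemma driftField_spike (γ : ℝ → ProbabilityMeasure U) (μ : ProbabilityMeasure U) (t₀ β r : ℝ)
    (x : E m) : driftField T b (spike γ μ t₀ β) r x
      = (Icc t₀ (t₀ + β)).piecewise (fun r => driftField T b (fun _ => μ) r x)
        (fun r => driftField T b γ r x) r := by
  by_cases h : r ∈ Icc t₀ (t₀ + β)
  · simp [driftField, spike, indicator, h]
  · simp [driftField, spike, indicator, h]

lemma IsDrift.measurable_driftField (hb : IsDrift T U b) {γ : ℝ → ProbabilityMeasure U}
    (hγ : ContinuousOn γ (Icc 0 T)) (x : E m) : Measurable fun r => driftField T b γ r x := by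
  classical
  have h := (hb.continuousOn_relaxedDrift hγ x).measurable_piecewise
    (continuousOn_const (c := (0 : E m)) (s := (Icc 0 T)ᶜ)) measurableSet_Icc
  convert! h using 1
  ext1 r
  exact congrFun (piecewise_eq_indicator (s := Icc 0 T)
    (f := fun r => relaxedDrift b r x (γ r))).symm r

/-- One constant serves every control, so later estimates are uniform in the spike width. A spike
destroys continuity in time, but piecewise measurability survives. -/
lemma IsDrift.exists_isDriftField (hb : IsDrift T U b) :
    ∃ M : ℝ, 0 ≤ M ∧ ∀ γ : ℝ → ProbabilityMeasure U, ContinuousOn γ (Icc 0 T) →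
      IsDriftField M (driftField T b γ) ∧ ∀ μ t₀ β,
        IsDriftField M (driftField T b (spike γ μ t₀ β)) := by
  obtain ⟨C, hC⟩ := hb.bounded
  obtain ⟨L, hL⟩ := hb.lipschitz_space
  have key : ∀ γ : ℝ → ProbabilityMeasure U, (∀ x, Measurable fun r => driftField T b γ r x) →
      IsDriftField (|C| + |L|) (driftField T b γ) := by
    intro γ hγ
    refine ⟨hγ, fun r x => ?_, fun r x x' => ?_⟩
    · by_cases hr : r ∈ Icc 0 T
      · rw [driftField_of_mem hr]
        have := norm_integral_le_of_norm_le_const (μ := (γ r : Measure U))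
          (f := fun a : U => b r x a) (C := C) (Eventually.of_forall fun a => hC r hr x a a.2)
        rw [probReal_univ, mul_one] at this
        exact this.trans (by linarith [le_abs_self C, abs_nonneg L])
      · rw [driftField, indicator_of_notMem hr, norm_zero]
        positivity
    · by_cases hr : r ∈ Icc 0 T
      · rw [driftField_of_mem hr, driftField_of_mem hr]
        refine (hb.norm_relaxedDrift_sub_le hr hr (γ r) fun a ha => hL r hr x' x a ha).trans ?_
        gcongr
        linarith [le_abs_self L, abs_nonneg C]
      · rw [driftField, indicator_of_notMem hr, driftField, indicator_of_notMem hr, sub_zero,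
          norm_zero]
        positivity
  refine ⟨|C| + |L|, by positivity, fun γ hγ => ⟨key γ (hb.measurable_driftField hγ),
    fun μ t₀ β => key _ fun x => ?_⟩⟩
  simp only [driftField_spike]
  exact (hb.measurable_driftField continuousOn_const x).piecewise measurableSet_Icc
    (hb.measurable_driftField hγ x)

lemma IsDrift.differentiable_driftField (hb : IsDrift T U b) (γ : ℝ → ProbabilityMeasure U)
    (r : ℝ) : Differentiable ℝ (driftField T b γ r) := by
  intro x
  by_cases hr : r ∈ Icc 0 T
  · obtain ⟨C, hC⟩ := hb.bounded_space
    have e : driftField T b γ r = fun x => ∫ a : U, b r x a ∂(γ r : Measure U) := by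
      ext1 x
      exact driftField_of_mem hr x
    rw [e]
    exact (hasFDerivAt_integral_of_dominated_of_fderiv_le (μ := (γ r : Measure U))
      (F := fun x (a : U) => b r x a) (F' := fun x (a : U) => fderiv ℝ (fun x => b r x a) x)
      (s := univ) (bound := fun _ => C) univ_mem
      (Eventually.of_forall fun x => (hb.continuous_control hr x).aestronglyMeasurable)
      (hb.integrable hr x (γ r)) (hb.continuous_fderiv_control hr x).aestronglyMeasurable
      (Eventually.of_forall fun a x _ => hC r hr x a a.2) (integrable_const C)
      (Eventually.of_forall fun a x _ =>
        (hb.differentiable_space r hr a a.2 x).hasFDerivAt)).differentiableAt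
  · have e : driftField T b γ r = fun _ => 0 := by
      ext1 x
      exact indicator_of_notMem hr _
    rw [e]
    exact differentiableAt_const _

end Drift

/-! ### Difference quotients of the perturbed states. -/

section Quotient

variable {V : Type*} [NormedAddCommGroup V] [NormedSpace ℝ V]

/-- The difference quotient of a family of paths. -/
noncomputable def quot (x : ℝ → V) (X : ℝ → ℝ → V) (β r : ℝ) : V := β⁻¹ • (X β r - x r)

lemma add_smul_quot (x : ℝ → V) (X : ℝ → ℝ → V) {β : ℝ} (hβ : 0 < β) (r : ℝ) :
    x r + β • quot x X β r = X β r := by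
  rw [quot, smul_smul, mul_inv_cancel₀ hβ.ne', one_smul, add_sub_cancel]

end Quotient

/-! ### Spike families: bounded quotients and their value after the spike. -/

section Spike

variable {V : Type*} [NormedAddCommGroup V] [NormedSpace ℝ V] [MeasurableSpace V]

/-- A solution `x` for the drift `B` and solutions `X β`, with the same initial value, for the
drifts that are equal to `B'` on `[t₀,t₀+β]` and to `B` later. -/
structure IsSpikeFamily (κ K τ M t₀ T : ℝ) (Γ : ℝ → ℝ → V → V) (B B' : ℝ → V → V)
    (Bs : ℝ → ℝ → V → V) (x : ℝ → V) (X : ℝ → ℝ → V) : Prop where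
  drift : IsDriftField M B
  drift_spike : ∀ β, IsDriftField M (Bs β)
  early : ∀ β r z, t₀ ≤ r → r ≤ t₀ + β → Bs β r z = B' r z
  late : ∀ β r z, t₀ + β < r → Bs β r z = B r z
  sol : RDEBound κ K τ Γ B t₀ T x
  sol_spike : ∀ β, RDEBound κ K τ Γ (Bs β) t₀ T (X β)
  init : ∀ β, X β t₀ = x t₀

variable {κ C K τ M t₀ T : ℝ} {Γ : ℝ → ℝ → V → V} {Λ : ℝ → ℝ → V → V → V} {B B' : ℝ → V → V}
  {Bs : ℝ → ℝ → V → V} {x : ℝ → V} {X : ℝ → ℝ → V}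

/-- After the spike `X β` and `x` solve the same equation from different values, so stability
applies. -/
lemma IsSpikeFamily.sol_late (hX : IsSpikeFamily κ K τ M t₀ T Γ B B' Bs x X) {β : ℝ}
    (hβ : 0 ≤ β) : RDEBound κ K τ Γ B (t₀ + β) T (X β) :=
  ((hX.sol_spike β).mono (by linarith) le_rfl).congr fun r h _ => hX.late β r _ h

variable [BorelSpace V] [SecondCountableTopology V]

/-- The spike opens a gap of size `O(β)`, and stability at most doubles it on each of the finitely
many windows that cover `[t₀, T]`. -/
lemma IsSpikeFamily.exists_quot_bound (hX : IsSpikeFamily κ K τ M t₀ T Γ B B' Bs x X)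
    (hΓ : IsGerm κ C T Γ Λ) (hκ : 1 / 3 < κ) (hκ2 : κ ≤ 1 / 2) (hC : 0 ≤ C) (hK : 0 ≤ K)
    (hτ : 0 < τ) (ht₀ : 0 ≤ t₀) (htT : t₀ < T) :
    ∃ C₁ β₀ τ₁ : ℝ, 0 ≤ C₁ ∧ 0 < β₀ ∧ β₀ ≤ 1 ∧ t₀ + β₀ < T ∧ 0 < τ₁ ∧ τ₁ ≤ 1 ∧ τ₁ ≤ τ ∧
      ∀ β, 0 < β → β ≤ β₀ →
      (∀ v, t₀ ≤ v → v ≤ T → ‖quot x X β v‖ ≤ C₁) ∧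
      ∀ u v, t₀ + β ≤ u → u ≤ v → v ≤ T → v - u ≤ τ₁ →
        ‖quot x X β v - quot x X β u - β⁻¹ • (∫ r in u..v, (B r (X β r) - B r (x r)))
          - β⁻¹ • (Γ u v (x u + β • quot x X β u) - Γ u v (x u))‖
          ≤ C₁ * (v - u) ^ (κ + 2 / 3) := by
  have hM := hX.drift.nonneg
  obtain ⟨K₂, τ₂, hK₂, hτ₂, hτ₂1, hτ₂τ, H₂⟩ := hΓ.exists_stability hκ hκ2 hC hM hK hτ
  obtain ⟨K₃, τ₃, hK₃, hτ₃, hτ₃1, H₃⟩ := hΓ.exists_short_time hκ hκ2 hC hM hK hτ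
  obtain ⟨n, hn⟩ := exists_nat_ge ((T - t₀) / τ₂)
  rw [div_le_iff₀ hτ₂] at hn
  have hpn : (1 : ℝ) ≤ 2 ^ n := one_le_pow₀ (by norm_num)
  -- `K₃` measures the gap per unit of `β`, `2 ^ n` its growth over `n` windows, and `K₂` the
  -- remainder of the stability estimate.
  refine ⟨2 ^ n * K₃ * (1 + K₂), min τ₃ ((T - t₀) / 2), τ₂, by positivity,
    lt_min hτ₃ (by linarith), (min_le_left _ _).trans hτ₃1,
    by linarith [min_le_right τ₃ ((T - t₀) / 2)], hτ₂, hτ₂1, hτ₂τ, fun β hβ hβ₀ => ?_⟩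
  have hβ3 : β ≤ τ₃ := hβ₀.trans (min_le_left _ _)
  have hβT : t₀ + β ≤ T := by linarith [hβ₀.trans (min_le_right _ _)]
  have h1 := (H₃ t₀ (t₀ + β) B (Bs β) x (X β) ht₀ hβT (by linarith) (by linarith) hX.drift
    (hX.drift_spike β) (hX.sol.mono le_rfl hβT) ((hX.sol_spike β).mono le_rfl hβT) (hX.init β)).1
  have h2 := H₂ (t₀ + β) T B x (X β) (by linarith) le_rfl hX.drift
    (hX.sol.mono (by linarith) le_rfl) (hX.sol_late hβ.le)
  have h3 : ∀ v, t₀ ≤ v → v ≤ T → ‖X β v - x v‖ ≤ 2 ^ n * K₃ * β := by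
    intro v hv hvT
    rcases le_total v (t₀ + β) with h | h
    · have := h1 v hv h
      rw [add_sub_cancel_left] at this
      refine this.trans ?_
      rw [mul_assoc]
      exact le_mul_of_one_le_left (by positivity) hpn
    · have h4 := le_of_windows (f := fun r => ‖X β r - x r‖) (e := 0) hτ₂
        (fun u v a1 a2 a3 a4 => by simpa using h2.1 u v a1 a2 a3 a4) n v h hvT (by linarith)
        (by positivity) le_rfl
      have h5 := h1 (t₀ + β) (by linarith) le_rfl
      rw [add_sub_cancel_left] at h5
      simp only [add_zero] at h4
      refine h4.trans ?_
      rw [mul_assoc]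
      gcongr
  have hinv : β⁻¹ * β = 1 := inv_mul_cancel₀ hβ.ne'
  refine ⟨fun v hv hvT => ?_, fun u v a1 a2 a3 a4 => ?_⟩
  · rw [quot, norm_smul, norm_inv, Real.norm_of_nonneg hβ.le]
    calc _ ≤ β⁻¹ * (2 ^ n * K₃ * β) := by
          gcongr
          exact h3 v hv hvT
      _ = 2 ^ n * K₃ * (β⁻¹ * β) := by ring
      _ ≤ _ := by
        rw [hinv]
        have : 0 ≤ 2 ^ n * K₃ * K₂ := by positivity
        linarith
  · have h4 := h2.2 (2 ^ n * K₃ * β) (by positivity)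
      (fun u b1 b2 => h3 u (by linarith) b2) u v a1 a2 a3 a4
    rw [add_smul_quot x X hβ u, quot, quot, ← smul_sub, ← smul_sub, ← smul_sub, norm_smul,
      norm_inv, Real.norm_of_nonneg hβ.le]
    have hl : 0 ≤ v - u := by linarith
    calc _ ≤ β⁻¹ * (K₂ * (2 ^ n * K₃ * β) * (v - u) ^ (κ + 2 / 3)) := by gcongr
      _ = 2 ^ n * K₃ * K₂ * (v - u) ^ (κ + 2 / 3) * (β⁻¹ * β) := by ring
      _ ≤ _ := by
        rw [hinv]
        have : 0 ≤ 2 ^ n * K₃ * (v - u) ^ (κ + 2 / 3) := by positivity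
        linarith

/-- The difference quotient at the end of the spike. -/
lemma IsSpikeFamily.tendsto_quot_end [CompleteSpace V]
    (hX : IsSpikeFamily κ K τ M t₀ T Γ B B' Bs x X)
    (hΓ : IsGerm κ C T Γ Λ) (hκ : 1 / 3 < κ) (hκ2 : κ ≤ 1 / 2) (hC : 0 ≤ C) (hK : 0 ≤ K)
    (hτ : 0 < τ) (ht₀ : 0 ≤ t₀) (htT : t₀ < T)
    (hB : ContinuousWithinAt (fun r => B r (x t₀)) (Ici t₀) t₀)
    (hB' : ContinuousWithinAt (fun r => B' r (x t₀)) (Ici t₀) t₀) :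
    Tendsto (fun β => quot x X β (t₀ + β)) (𝓝[>] 0) (𝓝 (B' t₀ (x t₀) - B t₀ (x t₀))) := by
  have hM := hX.drift.nonneg
  obtain ⟨K₃, τ₃, hK₃, hτ₃, hτ₃1, H₃⟩ := hΓ.exists_short_time hκ hκ2 hC hM hK hτ
  have hxc := hX.sol.continuousOn hΓ hX.drift hκ hκ2 hK hτ ht₀ le_rfl
  set w := B' t₀ (x t₀) - B t₀ (x t₀) with hw
  refine Metric.tendsto_nhds.mpr fun η hη => ?_
  have hη8 : 0 < η / (8 * (M + 1)) := by positivity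
  have hη4 : 0 < η / 8 := by positivity
  have ht₀m : Tendsto (fun β : ℝ => t₀ + β) (𝓝[>] 0) (𝓝[≥] t₀) := by
    refine tendsto_nhdsWithin_iff.mpr ⟨?_, ?_⟩
    · have : Tendsto (fun β : ℝ => t₀ + β) (𝓝 0) (𝓝 (t₀ + 0)) :=
        (continuous_const.add continuous_id).tendsto 0
      rw [add_zero] at this
      exact this.mono_left nhdsWithin_le_nhds
    · filter_upwards [self_mem_nhdsWithin] with β (hβ : 0 < β)
      exact (by linarith : t₀ ≤ t₀ + β)
  have hx0 : ContinuousWithinAt x (Ici t₀) t₀ :=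
    (hxc t₀ ⟨le_rfl, htT.le⟩).mono_of_mem_nhdsWithin (Icc_mem_nhdsGE htT)
  have hev : ∀ᶠ r in 𝓝[≥] t₀, dist (B r (x t₀)) (B t₀ (x t₀)) < η / 8 ∧
      dist (B' r (x t₀)) (B' t₀ (x t₀)) < η / 8 ∧ dist (x r) (x t₀) < η / (8 * (M + 1)) :=
    (Metric.tendsto_nhds.mp hB _ hη4).and
      ((Metric.tendsto_nhds.mp hB' _ hη4).and (Metric.tendsto_nhds.mp hx0 _ hη8))
  obtain ⟨ρ, hρ, hball⟩ := mem_nhdsGE_iff_exists_Icc_subset.mp hev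
  -- The remainder `K₃ β ^ (κ + 2 / 3)` of the short-time estimate, divided by `β`.
  have hpow : Tendsto (fun β : ℝ => K₃ * β ^ (κ - 1 / 3)) (𝓝[>] 0) (𝓝 0) := by
    have h1 : Tendsto (fun β : ℝ => β ^ (κ - 1 / 3)) (𝓝 0) (𝓝 (0 ^ (κ - 1 / 3))) :=
      (Real.continuousAt_rpow_const 0 _ (Or.inr (by linarith))).tendsto
    rw [Real.zero_rpow (by linarith)] at h1
    simpa using (h1.mono_left nhdsWithin_le_nhds).const_mul K₃
  have hsm : Tendsto (fun β : ℝ => K₃ * β) (𝓝[>] 0) (𝓝 0) := by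
    simpa using ((continuous_const_mul K₃).tendsto 0).mono_left nhdsWithin_le_nhds
  have hsmall : ∀ c : ℝ, 0 < c → ∀ᶠ β : ℝ in 𝓝[>] 0, β < c := fun c hc =>
    nhdsWithin_le_nhds (gt_mem_nhds hc)
  filter_upwards [self_mem_nhdsWithin, hpow.eventually (gt_mem_nhds hη4),
    hsm.eventually (gt_mem_nhds hη8), hsmall τ₃ hτ₃, hsmall (ρ - t₀) (sub_pos.mpr hρ),
    hsmall (T - t₀) (by linarith)] with β (hβ : 0 < β) h1 h2 h3 h4 h5
  have hβT : t₀ + β ≤ T := by linarith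
  obtain ⟨k1, k2⟩ := H₃ t₀ (t₀ + β) B (Bs β) x (X β) ht₀ hβT (by linarith) (by linarith) hX.drift
    (hX.drift_spike β) (hX.sol.mono le_rfl hβT) ((hX.sol_spike β).mono le_rfl hβT) (hX.init β)
  simp only [add_sub_cancel_left] at k1 k2
  have hXc := (hX.sol_spike β).continuousOn hΓ (hX.drift_spike β) hκ hκ2 hK hτ ht₀ le_rfl
  have hint : IntervalIntegrable (fun r => Bs β r (X β r) - B r (x r)) volume t₀ (t₀ + β) :=
    ((hX.drift_spike β).intervalIntegrable hXc ⟨le_rfl, htT.le⟩ ⟨by linarith, hβT⟩).sub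
      (hX.drift.intervalIntegrable hxc ⟨le_rfl, htT.le⟩ ⟨by linarith, hβT⟩)
  have hMη : M * (η / (8 * (M + 1))) ≤ η / 8 := by
    rw [← mul_div_assoc, div_le_div_iff₀ (by positivity) (by norm_num)]
    nlinarith
  -- Two shares of `η / 8` pay for moving `X β r` to `x r` and then to `x t₀` in `B'`, one for
  -- moving `x r` to `x t₀` in `B`, and one each for freezing time in `B'` and `B`.
  have k3 : ‖(∫ r in t₀..(t₀ + β), (Bs β r (X β r) - B r (x r))) - β • w‖ ≤ 5 * (η / 8) * β := by
    have e : β • w = ∫ r in t₀..(t₀ + β), w := by simp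
    rw [e, ← intervalIntegral.integral_sub hint (by simp)]
    have := intervalIntegral.norm_integral_le_of_norm_le_const (a := t₀) (b := t₀ + β)
      (f := fun r => Bs β r (X β r) - B r (x r) - w) (C := 5 * (η / 8)) fun r hr => by
        rw [uIoc_of_le (by linarith)] at hr
        obtain ⟨g1, g2, g3⟩ := hball ⟨hr.1.le, hr.2.trans (by linarith)⟩
        have g4 := k1 r hr.1.le hr.2
        have g5 : ‖B' r (X β r) - B' r (x t₀)‖ ≤ 2 * (η / 8) := by
          rw [← hX.early β r _ hr.1.le hr.2, ← hX.early β r _ hr.1.le hr.2]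
          rw [dist_eq_norm] at g3
          calc _ ≤ M * ‖X β r - x t₀‖ := (hX.drift_spike β).lip r _ _
            _ ≤ M * (‖X β r - x r‖ + ‖x r - x t₀‖) := by
              gcongr
              exact norm_sub_le_norm_sub_add_norm_sub _ _ _
            _ ≤ M * (η / (8 * (M + 1)) + η / (8 * (M + 1))) := by
              gcongr
              exact g4.trans h2.le
            _ ≤ _ := by linarith
        have g6 : ‖B r (x r) - B r (x t₀)‖ ≤ η / 8 := by
          rw [dist_eq_norm] at g3
          exact (hX.drift.lip r _ _).trans
            ((mul_le_mul_of_nonneg_left g3.le hM).trans hMη)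
        rw [dist_eq_norm] at g1 g2
        have e2 : Bs β r (X β r) - B r (x r) - w = (B' r (X β r) - B' r (x t₀))
            + (B' r (x t₀) - B' t₀ (x t₀)) - (B r (x r) - B r (x t₀))
            - (B r (x t₀) - B t₀ (x t₀)) := by
          rw [hX.early β r _ hr.1.le hr.2, hw]
          abel
        rw [e2]
        refine (norm_sub_le _ _).trans ?_
        linarith [norm_sub_le ((B' r (X β r) - B' r (x t₀)) + (B' r (x t₀) - B' t₀ (x t₀)))
          (B r (x r) - B r (x t₀)), norm_add_le (B' r (X β r) - B' r (x t₀))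
          (B' r (x t₀) - B' t₀ (x t₀))]
    rwa [add_sub_cancel_left, abs_of_pos hβ] at this
  rw [dist_eq_norm]
  have e3 : quot x X β (t₀ + β) - w = β⁻¹ • (((X β (t₀ + β) - x (t₀ + β))
      - ∫ r in t₀..(t₀ + β), (Bs β r (X β r) - B r (x r)))
      + ((∫ r in t₀..(t₀ + β), (Bs β r (X β r) - B r (x r))) - β • w)) := by
    rw [sub_add_sub_cancel, smul_sub, smul_smul, inv_mul_cancel₀ hβ.ne', one_smul, quot]
  have e4 : β ^ (κ + 2 / 3) = β * β ^ (κ - 1 / 3) := by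
    rw [← Real.rpow_one_add' hβ.le (by linarith)]
    congr 1
    ring
  rw [e3, norm_smul, norm_inv, Real.norm_of_nonneg hβ.le, inv_mul_lt_iff₀ hβ]
  rw [e4] at k2
  refine (norm_add_le _ _).trans_lt ((add_le_add k2 k3).trans_lt ?_)
  have : K₃ * (β * β ^ (κ - 1 / 3)) = β * (K₃ * β ^ (κ - 1 / 3)) := by ring
  rw [this]
  nlinarith

end Spike

/-! ### The error of linearising the drift. -/

section SpikeLimit

variable {V : Type*} [NormedAddCommGroup V] [NormedSpace ℝ V]

/-- Difference quotients along bounded directions converge uniformly to the derivative. -/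
lemma eventually_norm_quotient_sub_le {W : Type*} [NormedAddCommGroup W] [NormedSpace ℝ W]
    {f : V → W} {z : V} (hf : DifferentiableAt ℝ f z) {c C₁ : ℝ} (hc : 0 < c) (hC₁ : 0 ≤ C₁) :
    ∀ᶠ s : ℝ in 𝓝[>] 0, ∀ h : V, ‖h‖ ≤ C₁ →
      ‖s⁻¹ • (f (z + s • h) - f z) - fderiv ℝ f z h‖ ≤ c := by
  have h1 := (hasFDerivAt_iff_isLittleO_nhds_zero.mp hf.hasFDerivAt).def
    (c := c / (C₁ + 1)) (by positivity)
  obtain ⟨δ, hδ, hball⟩ := Metric.eventually_nhds_iff.mp h1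
  have h2 : ∀ᶠ s : ℝ in 𝓝[>] 0, s < δ / (C₁ + 1) :=
    nhdsWithin_le_nhds (gt_mem_nhds (by positivity))
  filter_upwards [self_mem_nhdsWithin, h2] with s (hs : 0 < s) hsδ h hh
  rw [lt_div_iff₀ (by positivity)] at hsδ
  have hn : ‖s • h‖ ≤ s * C₁ := by
    rw [norm_smul, Real.norm_of_nonneg hs.le]
    gcongr
  have h3 := hball (y := s • h) (by rw [dist_zero_right]; nlinarith)
  have e : s⁻¹ • (f (z + s • h) - f z) - fderiv ℝ f z h
      = s⁻¹ • (f (z + s • h) - f z - fderiv ℝ f z (s • h)) := by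
    rw [map_smul, smul_sub _ (f (z + s • h) - f z), smul_smul, inv_mul_cancel₀ hs.ne', one_smul]
  rw [e, norm_smul, norm_inv, Real.norm_of_nonneg hs.le, inv_mul_le_iff₀ hs]
  refine h3.trans ?_
  rw [div_mul_eq_mul_div, div_le_iff₀ (by positivity)]
  nlinarith

variable [MeasurableSpace V] {κ C K τ M t₀ T : ℝ} {Γ : ℝ → ℝ → V → V} {Λ : ℝ → ℝ → V → V → V}
  {B B' : ℝ → V → V} {Bs : ℝ → ℝ → V → V} {x : ℝ → V} {X : ℝ → ℝ → V}

/-- The effect of changing the step of the difference quotient of the drift. -/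
noncomputable def driftError (B : ℝ → V → V) (x : ℝ → V) (X : ℝ → ℝ → V) (β β' r : ℝ) : V :=
  β⁻¹ • (B r (x r + β • quot x X β' r) - B r (x r)) - β'⁻¹ • (B r (X β' r) - B r (x r))

lemma norm_inv_smul_sub_le (hB : IsDriftField M B) {s r : ℝ} (hs : 0 < s) (z h : V) :
    ‖s⁻¹ • (B r (z + s • h) - B r z)‖ ≤ M * ‖h‖ := by
  rw [norm_smul, norm_inv, Real.norm_of_nonneg hs.le, inv_mul_le_iff₀ hs]
  refine (hB.lip r z _).trans_eq ?_
  rw [add_sub_cancel_left, norm_smul, Real.norm_of_nonneg hs.le]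
  ring

lemma norm_driftError_le (hB : IsDriftField M B) {β β' r C₁ : ℝ} (hβ : 0 < β) (hβ' : 0 < β')
    (h : ‖quot x X β' r‖ ≤ C₁) : ‖driftError B x X β β' r‖ ≤ 2 * M * C₁ := by
  have h1 := norm_inv_smul_sub_le hB (r := r) hβ (x r) (quot x X β' r)
  have h2 := norm_inv_smul_sub_le hB (r := r) hβ' (x r) (quot x X β' r)
  rw [add_smul_quot x X hβ'] at h2
  have h3 := mul_le_mul_of_nonneg_left h hB.nonneg
  rw [driftError]
  refine (norm_sub_le _ _).trans ?_
  linarith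

/-- Both quotients approximate the derivative of `B r` in the same direction `quot x X β' r`. The
direction moves but stays bounded, and Fréchet differentiability is uniform over bounded directions.
-/
lemma tendsto_driftError {r C₁ : ℝ} (hd : Differentiable ℝ (B r)) (hC₁ : 0 ≤ C₁)
    (h : ∀ᶠ β in 𝓝[>] 0, ‖quot x X β r‖ ≤ C₁) :
    Tendsto (fun p : ℝ × ℝ => driftError B x X p.1 p.2 r) (𝓝[>] 0 ×ˢ 𝓝[>] 0) (𝓝 0) := by
  refine Metric.tendsto_nhds.mpr fun η hη => ?_
  have h1 := eventually_norm_quotient_sub_le (hd (x r)) (c := η / 3) (by linarith) hC₁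
  have hpos : ∀ᶠ β : ℝ in 𝓝[>] 0, 0 < β := self_mem_nhdsWithin
  filter_upwards [h1.prod_mk (h1.and (h.and hpos))] with p hp
  obtain ⟨hp1, hp2, hp3, hp4⟩ := hp
  have k1 := hp1 _ hp3
  have k2 := hp2 _ hp3
  rw [add_smul_quot x X hp4] at k2
  rw [dist_zero_right, driftError]
  rw [← sub_sub_sub_cancel_right _ _ (fderiv ℝ (B r) (x r) (quot x X p.2 r))]
  exact (norm_sub_le _ _).trans_lt (by linarith)

variable [BorelSpace V] [SecondCountableTopology V]

lemma aestronglyMeasurable_driftError (hB : IsDriftField M B) {a b : ℝ}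
    (hx : ContinuousOn x (Icc a b)) (hX : ∀ β, ContinuousOn (X β) (Icc a b)) (β β' : ℝ) :
    AEStronglyMeasurable (driftError B x X β β') (volume.restrict (Icc a b)) := by
  have h1 : ∀ f : ℝ → V, ContinuousOn f (Icc a b) →
      AEStronglyMeasurable (fun r => B r (f r)) (volume.restrict (Icc a b)) := fun f hf =>
    hB.aestronglyMeasurable (hf.aestronglyMeasurable measurableSet_Icc).aemeasurable
  have h2 : ContinuousOn (fun r => x r + β • quot x X β' r) (Icc a b) :=
    hx.add ((((hX β').sub hx).const_smul β'⁻¹).const_smul β)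
  exact (((h1 _ h2).sub (h1 _ hx)).const_smul _).sub (((h1 _ (hX β')).sub (h1 _ hx)).const_smul _)

/-- Differentiability alone gives no rate at a fixed time; dominated convergence still makes the
error small in `L¹`. -/
lemma tendsto_integral_driftError (hB : IsDriftField M B) (hd : ∀ r, Differentiable ℝ (B r))
    (ht : t₀ ≤ T) (hx : ContinuousOn x (Icc t₀ T)) (hX : ∀ β, ContinuousOn (X β) (Icc t₀ T))
    {C₁ β₀ : ℝ} (hC₁ : 0 ≤ C₁) (hβ₀ : 0 < β₀)
    (hq : ∀ β, 0 < β → β ≤ β₀ → ∀ v, t₀ ≤ v → v ≤ T → ‖quot x X β v‖ ≤ C₁) :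
    Tendsto (fun p : ℝ × ℝ => ∫ r in t₀..T, ‖driftError B x X p.1 p.2 r‖)
      (𝓝[>] 0 ×ˢ 𝓝[>] 0) (𝓝 0) := by
  have hev : ∀ᶠ β : ℝ in 𝓝[>] 0, 0 < β ∧ β ≤ β₀ := Ioc_mem_nhdsGT hβ₀
  have h := intervalIntegral.tendsto_integral_filter_of_dominated_convergence (a := t₀) (b := T)
    (μ := volume) (l := 𝓝[>] (0 : ℝ) ×ˢ 𝓝[>] (0 : ℝ))
    (F := fun p r => ‖driftError B x X p.1 p.2 r‖) (f := fun _ => 0)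
    (fun _ => 2 * M * C₁) (Eventually.of_forall fun p => ?_) ?_ intervalIntegrable_const
    (Eventually.of_forall fun r hr => ?_)
  · simpa using h
  · rw [uIoc_of_le ht]
    exact (aestronglyMeasurable_driftError hB hx hX p.1 p.2).norm.mono_measure
      (Measure.restrict_mono Ioc_subset_Icc_self le_rfl)
  · filter_upwards [hev.prod_mk hev] with p hp
    refine Eventually.of_forall fun r hr => ?_
    rw [uIoc_of_le ht] at hr
    rw [norm_norm]
    exact norm_driftError_le hB hp.1.1 hp.2.1 (hq _ hp.2.1 hp.2.2 r hr.1.le hr.2)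
  · rw [uIoc_of_le ht] at hr
    have := tendsto_driftError (x := x) (X := X) (hd r) hC₁
      (hev.mono fun β hβ => hq β hβ.1 hβ.2 r hr.1.le hr.2)
    simpa using this.norm

/-- An integral bounded both by the length of the interval and by a small constant. -/
lemma norm_integral_le_rpow_mul_rpow {f : ℝ → V} {a b u v A N : ℝ} (hau : a ≤ u) (huv : u ≤ v)
    (hvb : v ≤ b) (hA : ∀ r, a ≤ r → r ≤ b → ‖f r‖ ≤ A) (hA0 : 0 ≤ A)
    (hf : IntervalIntegrable f volume a b) (hN : ∫ r in a..b, ‖f r‖ ≤ N) :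
    ‖∫ r in u..v, f r‖ ≤ A ^ (2 / 3 : ℝ) * N ^ (1 / 3 : ℝ) * (v - u) ^ (2 / 3 : ℝ) := by
  have hl : 0 ≤ v - u := by linarith
  have h1 : ‖∫ r in u..v, f r‖ ≤ A * (v - u) := by
    have := intervalIntegral.norm_integral_le_of_norm_le_const (a := u) (b := v)
      (f := f) (C := A) fun r hr => by
        rw [uIoc_of_le huv] at hr
        exact hA r (hau.trans hr.1.le) (hr.2.trans hvb)
    rwa [abs_of_nonneg hl] at this
  have h2 : ‖∫ r in u..v, f r‖ ≤ N := by
    refine (intervalIntegral.norm_integral_le_integral_norm huv).trans (le_trans ?_ hN)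
    exact intervalIntegral.integral_mono_interval hau huv hvb
      (Eventually.of_forall fun r => norm_nonneg _) hf.norm
  have hn := norm_nonneg (∫ r in u..v, f r)
  calc ‖∫ r in u..v, f r‖
      -- The weight `2 / 3` on the length bound gives the exponent required of the driving terms in
      -- the sewing estimates; the other third retains the smallness.
      = ‖∫ r in u..v, f r‖ ^ (2 / 3 : ℝ) * ‖∫ r in u..v, f r‖ ^ (1 / 3 : ℝ) := by
        rw [← Real.rpow_add_of_nonneg hn (by norm_num) (by norm_num)]
        norm_num
    _ ≤ (A * (v - u)) ^ (2 / 3 : ℝ) * N ^ (1 / 3 : ℝ) := by gcongr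
    _ = _ := by
      rw [Real.mul_rpow hA0 hl]
      ring

end SpikeLimit

/-! ### The difference quotients are Cauchy. -/

section SpikeCauchy

variable {V : Type*} [NormedAddCommGroup V] [NormedSpace ℝ V] [MeasurableSpace V]
  [BorelSpace V] [SecondCountableTopology V]
  {κ C K τ M t₀ T : ℝ} {Γ : ℝ → ℝ → V → V} {Λ : ℝ → ℝ → V → V → V}
  {B B' : ℝ → V → V} {Bs : ℝ → ℝ → V → V} {x : ℝ → V} {X : ℝ → ℝ → V}

/-- The scale of the difference of two difference quotients. -/
noncomputable def quotError (κ A N β : ℝ) : ℝ :=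
  A ^ (2 / 3 : ℝ) * N ^ (1 / 3 : ℝ) + β + β ^ (3 / 4 * (κ - 1 / 3))

/-- Since `X β` is `x` plus `β` times its quotient, replacing that quotient by the one of step `β'`
costs `M ω` by the Lipschitz bound. What remains is `driftError`. -/
lemma norm_integral_quot_sub_le (hB : IsDriftField M B) {β β' a b u v ω A N : ℝ}
    (hβ : 0 < β) (hau : a ≤ u) (huv : u ≤ v) (hvb : v ≤ b) (hl : v - u ≤ 1)
    (hx : ContinuousOn x (Icc a b)) (hX : ∀ β, ContinuousOn (X β) (Icc a b)) (hA : 0 ≤ A)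
    (hω : ∀ r, u ≤ r → r ≤ v → ‖quot x X β r - quot x X β' r‖ ≤ ω)
    (he : ∀ r, a ≤ r → r ≤ b → ‖driftError B x X β β' r‖ ≤ A)
    (hN : ∫ r in a..b, ‖driftError B x X β β' r‖ ≤ N) :
    ‖β⁻¹ • (∫ r in u..v, (B r (X β r) - B r (x r)))
      - β'⁻¹ • (∫ r in u..v, (B r (X β' r) - B r (x r)))‖
      ≤ (M * ω + A ^ (2 / 3 : ℝ) * N ^ (1 / 3 : ℝ)) * (v - u) ^ (2 / 3 : ℝ) := by
  have hab : a ≤ b := hau.trans (huv.trans hvb)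
  have hl0 : 0 ≤ v - u := by linarith
  have hM := hB.nonneg
  have hω0 : 0 ≤ ω := (norm_nonneg _).trans (hω u le_rfl huv)
  have hi : ∀ f : ℝ → V, ContinuousOn f (Icc a b) →
      IntervalIntegrable (fun r => B r (f r)) volume u v := fun f hf =>
    hB.intervalIntegrable hf ⟨hau, huv.trans hvb⟩ ⟨hau.trans huv, hvb⟩
  have he' : IntervalIntegrable (driftError B x X β β') volume a b := by
    rw [intervalIntegrable_iff_integrableOn_Icc_of_le hab]
    refine Integrable.of_bound (aestronglyMeasurable_driftError hB hx hX β β') A ?_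
    filter_upwards [ae_restrict_mem measurableSet_Icc] with r hr using he r hr.1 hr.2
  have he'' : IntervalIntegrable (driftError B x X β β') volume u v :=
    he'.mono_set (by rw [uIcc_of_le huv, uIcc_of_le hab]; exact Icc_subset_Icc hau hvb)
  have hsub := fun f hf => (hi f hf).sub (hi x hx)
  have hc : ContinuousOn (fun r => x r + β • quot x X β' r) (Icc a b) :=
    hx.add ((((hX β').sub hx).const_smul β'⁻¹).const_smul β)
  have a1 : IntervalIntegrable (fun r => β⁻¹ • (B r (X β r) - B r (x r))) volume u v :=
    (hsub _ (hX β)).smul β⁻¹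
  have a2 : IntervalIntegrable (fun r => β'⁻¹ • (B r (X β' r) - B r (x r))) volume u v :=
    (hsub _ (hX β')).smul β'⁻¹
  have a3 : IntervalIntegrable
      (fun r => β⁻¹ • (B r (X β r) - B r (x r + β • quot x X β' r))) volume u v :=
    ((hi _ (hX β)).sub (hi _ hc)).smul β⁻¹
  have e : β⁻¹ • (∫ r in u..v, (B r (X β r) - B r (x r)))
      - β'⁻¹ • (∫ r in u..v, (B r (X β' r) - B r (x r)))
      = (∫ r in u..v, β⁻¹ • (B r (X β r) - B r (x r + β • quot x X β' r)))
        + ∫ r in u..v, driftError B x X β β' r := by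
    rw [← intervalIntegral.integral_smul, ← intervalIntegral.integral_smul,
      ← intervalIntegral.integral_sub a1 a2, ← intervalIntegral.integral_add a3 he'']
    congr 1
    ext1 r
    simp only [driftError, smul_sub]
    abel
  have h1 : ‖∫ r in u..v, β⁻¹ • (B r (X β r) - B r (x r + β • quot x X β' r))‖
      ≤ M * ω * (v - u) := by
    have := intervalIntegral.norm_integral_le_of_norm_le_const (a := u) (b := v) (C := M * ω)
      (f := fun r => β⁻¹ • (B r (X β r) - B r (x r + β • quot x X β' r))) fun r hr => by
        rw [uIoc_of_le huv] at hr
        have h2 := hB.lip r (x r + β • quot x X β' r) (X β r)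
        have e2 : X β r - (x r + β • quot x X β' r) = β • (quot x X β r - quot x X β' r) := by
          rw [smul_sub, sub_add_eq_sub_sub, sub_left_inj, quot, smul_smul,
            mul_inv_cancel₀ hβ.ne', one_smul]
        rw [e2, norm_smul, Real.norm_of_nonneg hβ.le] at h2
        rw [norm_smul, norm_inv, Real.norm_of_nonneg hβ.le, inv_mul_le_iff₀ hβ]
        calc _ ≤ M * (β * ω) := h2.trans (by
              gcongr
              exact hω r hr.1.le hr.2)
          _ = _ := by ring
    rwa [abs_of_nonneg hl0] at this
  have h2 := norm_integral_le_rpow_mul_rpow hau huv hvb he hA he' hN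
  have h3 : v - u ≤ (v - u) ^ (2 / 3 : ℝ) := by
    simpa using rpow_le_rpow_of_le_one hl0 hl (b := 2 / 3) (a := 1) (by norm_num) (by norm_num)
  rw [e]
  calc _ ≤ M * ω * (v - u) + A ^ (2 / 3 : ℝ) * N ^ (1 / 3 : ℝ) * (v - u) ^ (2 / 3 : ℝ) :=
        (norm_add_le _ _).trans (add_le_add h1 h2)
    _ ≤ M * ω * (v - u) ^ (2 / 3 : ℝ)
        + A ^ (2 / 3 : ℝ) * N ^ (1 / 3 : ℝ) * (v - u) ^ (2 / 3 : ℝ) := by gcongr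
    _ = _ := by ring

/-- On a short window the growth of the difference of two quotients is a small multiple of its own
maximum plus `quotError`, and the maximum can be absorbed. The Hölder bound is kept because the two
spikes end at different times. -/
lemma IsSpikeFamily.exists_quot_sub_bound (hX : IsSpikeFamily κ K τ M t₀ T Γ B B' Bs x X)
    (hΓ : IsGerm κ C T Γ Λ) (hκ : 1 / 3 < κ) (hκ2 : κ ≤ 1 / 2) (hC : 0 ≤ C) (hK : 0 ≤ K)
    (hτ : 0 < τ) (ht₀ : 0 ≤ t₀) (htT : t₀ < T) :
    ∃ C₁ β₀ τ₁ : ℝ, 0 ≤ C₁ ∧ 0 < β₀ ∧ t₀ + β₀ < T ∧ 0 < τ₁ ∧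
      (∀ β, 0 < β → β ≤ β₀ → ∀ v, t₀ ≤ v → v ≤ T → ‖quot x X β v‖ ≤ C₁) ∧
      (∀ β, 0 < β → β ≤ β₀ → ∀ u v, t₀ + β ≤ u → u ≤ v → v ≤ T → v - u ≤ τ₁ →
        ‖quot x X β v - quot x X β u‖ ≤ (C₁ + M * C₁ + C * C₁) * (v - u) ^ κ) ∧
      ∀ β β', 0 < β' → β' ≤ β → β ≤ β₀ → ∀ N,
        ∫ r in t₀..T, ‖driftError B x X β β' r‖ ≤ N →
        ∀ u v, t₀ + β ≤ u → u ≤ v → v ≤ T → v - u ≤ τ₁ →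
        ‖quot x X β v - quot x X β' v‖
          ≤ 2 * ‖quot x X β u - quot x X β' u‖ + quotError κ (2 * M * C₁) N β := by
  have hM := hX.drift.nonneg
  obtain ⟨C₁, β₀, τ₁, hC₁, hβ₀, hβ₀1, hβ₀T, hτ₁, hτ₁1, hτ₁τ, H⟩ :=
    hX.exists_quot_bound hΓ hκ hκ2 hC hK hτ ht₀ htT
  -- One constant covers the quotients and their remainders, through `C₁`, and the remainder of `x`,
  -- through `M + K`.
  obtain ⟨K₄, τ₄, hK₄, hτ₄, hτ₄1, H₄⟩ := hΓ.exists_quotient_diff_bound hκ hκ2 hC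
    (C₁ := C₁ + (M + K)) (by positivity)
  obtain ⟨τ₅, hτ₅, -, hsmall⟩ := exists_mul_rpow_le (κ := κ) (by linarith)
    ((1 + M) * K₄) (η := 1 / 2) (by norm_num)
  have hxc := hX.sol.continuousOn hΓ hX.drift hκ hκ2 hK hτ ht₀ le_rfl
  have hXc := fun β =>
    (hX.sol_spike β).continuousOn hΓ (hX.drift_spike β) hκ hκ2 hK hτ ht₀ le_rfl
  refine ⟨C₁, β₀, min τ₅ (min τ₄ τ₁), hC₁, hβ₀, hβ₀T, lt_min hτ₅ (lt_min hτ₄ hτ₁),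
    fun β h1 h2 => (H β h1 h2).1, ?_, ?_⟩
  · intro β hβ hββ u v h1 h2 h3 h4
    have hl4 : v - u ≤ τ₁ := h4.trans ((min_le_right _ _).trans (min_le_right _ _))
    have hl0 : 0 ≤ v - u := by linarith
    have hl1 : v - u ≤ 1 := hl4.trans hτ₁1
    have k1 := (H β hβ hββ).2 u v h1 h2 h3 hl4
    have k2 := (H β hβ hββ).1 u (by linarith) (h2.trans h3)
    have k3 : ‖β⁻¹ • (∫ r in u..v, (B r (X β r) - B r (x r)))‖ ≤ M * C₁ * (v - u) := by
      rw [← intervalIntegral.integral_smul]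
      have := intervalIntegral.norm_integral_le_of_norm_le_const (a := u) (b := v) (C := M * C₁)
        (f := fun r => β⁻¹ • (B r (X β r) - B r (x r))) fun r hr => by
          rw [uIoc_of_le h2] at hr
          have e := norm_inv_smul_sub_le hX.drift (r := r) hβ (x r) (quot x X β r)
          rw [add_smul_quot x X hβ] at e
          refine e.trans ?_
          gcongr
          exact (H β hβ hββ).1 r (by linarith [hr.1]) (hr.2.trans h3)
      rwa [abs_of_nonneg hl0] at this
    have k4 : ‖β⁻¹ • (Γ u v (x u + β • quot x X β u) - Γ u v (x u))‖
        ≤ C * (v - u) ^ κ * C₁ := by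
      rw [norm_smul, norm_inv, Real.norm_of_nonneg hβ.le, inv_mul_le_iff₀ hβ]
      refine (hΓ.lip u v (by linarith) h2 h3 _ _).trans ?_
      rw [add_sub_cancel_left, norm_smul, Real.norm_of_nonneg hβ.le]
      calc _ ≤ C * (v - u) ^ κ * (β * C₁) := by gcongr
        _ = _ := by ring
    have k5 : (v - u) ^ (κ + 2 / 3) ≤ (v - u) ^ κ :=
      rpow_le_rpow_of_le_one hl0 hl1 (by linarith) (by linarith)
    have k6 : v - u ≤ (v - u) ^ κ := by
      simpa using rpow_le_rpow_of_le_one hl0 hl1 (b := κ) (a := 1) (by linarith) (by linarith)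
    have e : quot x X β v - quot x X β u = (quot x X β v - quot x X β u
        - β⁻¹ • (∫ r in u..v, (B r (X β r) - B r (x r)))
        - β⁻¹ • (Γ u v (x u + β • quot x X β u) - Γ u v (x u)))
        + β⁻¹ • (∫ r in u..v, (B r (X β r) - B r (x r)))
        + β⁻¹ • (Γ u v (x u + β • quot x X β u) - Γ u v (x u)) := by abel
    rw [e]
    calc _ ≤ C₁ * (v - u) ^ (κ + 2 / 3) + M * C₁ * (v - u) + C * (v - u) ^ κ * C₁ :=
          (norm_add_le _ _).trans (add_le_add ((norm_add_le _ _).trans (add_le_add k1 k3)) k4)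
      _ ≤ C₁ * (v - u) ^ κ + M * C₁ * (v - u) ^ κ + C * (v - u) ^ κ * C₁ := by gcongr
      _ = _ := by ring
  · intro β β' hβ' hββ' hββ N hN u v h1 h2 h3 h4
    have hβ : 0 < β := by linarith
    have hl5 : v - u ≤ τ₅ := h4.trans (min_le_left _ _)
    have hl4 : v - u ≤ τ₄ := h4.trans ((min_le_right _ _).trans (min_le_left _ _))
    have hl1 : v - u ≤ τ₁ := h4.trans ((min_le_right _ _).trans (min_le_right _ _))
    have hu : t₀ ≤ u := by linarith
    have hl0 : 0 ≤ v - u := by linarith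
    have hWc : ContinuousOn (fun r => ‖quot x X β r - quot x X β' r‖) (Icc u v) :=
      (((((hXc β).sub hxc).const_smul β⁻¹).sub
        (((hXc β').sub hxc).const_smul β'⁻¹)).norm).mono (Icc_subset_Icc hu h3)
    obtain ⟨s, hs, hmax⟩ := isCompact_Icc.exists_isMaxOn ⟨u, le_rfl, h2⟩ hWc
    set ω := ‖quot x X β s - quot x X β' s‖ with hω
    have hωb : ∀ r, u ≤ r → r ≤ v → ‖quot x X β r - quot x X β' r‖ ≤ ω :=
      fun r g1 g2 => hmax ⟨g1, g2⟩
    set E := (2 * M * C₁) ^ (2 / 3 : ℝ) * N ^ (1 / 3 : ℝ) with hE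
    have hN0 : 0 ≤ N := le_trans (intervalIntegral.integral_nonneg htT.le
      fun r _ => norm_nonneg _) hN
    have hE0 : 0 ≤ E := by positivity
    have hadd : ∀ β, ∀ s t r, u ≤ s → s ≤ t → t ≤ r → r ≤ v →
        β⁻¹ • (∫ r in s..r, (B r (X β r) - B r (x r)))
          = β⁻¹ • (∫ r in s..t, (B r (X β r) - B r (x r)))
          + β⁻¹ • (∫ r in t..r, (B r (X β r) - B r (x r))) := by
      intro β s t r g1 g2 g3 g4
      have hii : ∀ p q, u ≤ p → p ≤ q → q ≤ v →
          IntervalIntegrable (fun r => B r (X β r) - B r (x r)) volume p q := fun p q f1 f2 f3 =>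
        (hX.drift.intervalIntegrable (hXc β) ⟨by linarith, by linarith⟩
          ⟨by linarith, by linarith⟩).sub (hX.drift.intervalIntegrable hxc
          ⟨by linarith, by linarith⟩ ⟨by linarith, by linarith⟩)
      rw [← smul_add, intervalIntegral.integral_add_adjacent_intervals
        (hii s t g1 g2 (g3.trans g4)) (hii t r (g1.trans g2) g3 g4)]
    have hexp : ∀ β, 0 < β → β ≤ β₀ → t₀ + β ≤ u → ∀ s t, u ≤ s → s ≤ t → t ≤ v →
        ‖quot x X β t - quot x X β s - β⁻¹ • (∫ r in s..t, (B r (X β r) - B r (x r)))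
          - β⁻¹ • (Γ s t (x s + β • quot x X β s) - Γ s t (x s))‖
          ≤ (C₁ + (M + K)) * (t - s) ^ (κ + 2 / 3) := by
      intro β g1 g2 g3 s t g4 g5 g6
      refine ((H β g1 g2).2 s t (g3.trans g4) g5 (g6.trans h3) (by linarith)).trans ?_
      have := Real.rpow_nonneg (by linarith : 0 ≤ t - s) (κ + 2 / 3)
      gcongr
      linarith
    have key := H₄ u v (ht₀.trans hu) h3 hl4 x (quot x X β) (quot x X β')
      (fun s t => β⁻¹ • (∫ r in s..t, (B r (X β r) - B r (x r))))
      (fun s t => β'⁻¹ • (∫ r in s..t, (B r (X β' r) - B r (x r))))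
      β β' ω (M * ω + E) hβ' hββ' (norm_nonneg _) (by positivity)
      (fun s t g1 g2 g3 => by
        refine (hX.sol.remainder hX.drift hκ hK (hu.trans g1) g2 (g3.trans h3) (by linarith)
          (by linarith)).trans ?_
        exact mul_le_mul_of_nonneg_right (by linarith)
          (Real.rpow_nonneg (by linarith : 0 ≤ t - s) (2 / 3)))
      (fun r g1 g2 => ((H β hβ hββ).1 r (hu.trans g1) (g2.trans h3)).trans (by linarith))
      (fun r g1 g2 => ((H β' hβ' (hββ'.trans hββ)).1 r (hu.trans g1) (g2.trans h3)).trans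
        (by linarith))
      (hadd β) (hadd β') (hexp β hβ hββ h1)
      (hexp β' hβ' (hββ'.trans hββ) (by linarith))
      (fun s t g1 g2 g3 => norm_integral_quot_sub_le hX.drift hβ (hu.trans g1) g2 (g3.trans h3)
        (by linarith) hxc hXc (by positivity)
        (fun r f1 f2 => hωb r (g1.trans f1) (f2.trans g3))
        (fun r f1 f2 => norm_driftError_le hX.drift hβ hβ'
          ((H β' hβ' (hββ'.trans hββ)).1 r f1 f2)) hN)
      hωb u s le_rfl hs.1 hs.2
    have hR : quotError κ (2 * M * C₁) N β = E + β + β ^ (3 / 4 * (κ - 1 / 3)) := rfl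
    have hp : 0 ≤ β ^ (3 / 4 * (κ - 1 / 3)) := by positivity
    set R := quotError κ (2 * M * C₁) N β with hRdef
    have hω0 : 0 ≤ ω := norm_nonneg _
    have hR0 : 0 ≤ R := by
      rw [hR]
      positivity
    have hsm := hsmall (s - u) (by linarith [hs.1]) (by linarith [hs.2])
    have hpow : 0 ≤ (s - u) ^ κ := Real.rpow_nonneg (by linarith [hs.1]) _
    have k1 : (ω + (M * ω + E) + β + β ^ (3 / 4 * (κ - 1 / 3))) * K₄ * (s - u) ^ κ
        ≤ (ω + R) * (1 / 2) := by
      calc _ = ((1 + M) * ω + R) * (K₄ * (s - u) ^ κ) := by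
            rw [hR]
            ring
        _ ≤ ((1 + M) * ω + (1 + M) * R) * (K₄ * (s - u) ^ κ) := by
          have : R ≤ (1 + M) * R := le_mul_of_one_le_left hR0 (by linarith)
          gcongr
        _ = (ω + R) * ((1 + M) * K₄ * (s - u) ^ κ) := by ring
        _ ≤ _ := by gcongr
    -- Solving for `ω` gives twice the initial distance plus `R`.
    have k2 : ω ≤ ‖quot x X β u - quot x X β' u‖ + (ω + R) * (1 / 2) := by
      have := norm_add_le (quot x X β u - quot x X β' u)
        ((quot x X β s - quot x X β' s) - (quot x X β u - quot x X β' u))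
      rw [add_sub_cancel] at this
      exact this.trans (add_le_add le_rfl (key.trans k1))
    linarith [hωb v h2 le_rfl]

/-- The difference quotients converge. -/
theorem IsSpikeFamily.exists_tendsto_quot [CompleteSpace V]
    (hX : IsSpikeFamily κ K τ M t₀ T Γ B B' Bs x X)
    (hΓ : IsGerm κ C T Γ Λ) (hκ : 1 / 3 < κ) (hκ2 : κ ≤ 1 / 2) (hC : 0 ≤ C) (hK : 0 ≤ K)
    (hτ : 0 < τ) (ht₀ : 0 ≤ t₀) (htT : t₀ < T)
    (hB : ContinuousWithinAt (fun r => B r (x t₀)) (Ici t₀) t₀)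
    (hB' : ContinuousWithinAt (fun r => B' r (x t₀)) (Ici t₀) t₀)
    (hd : ∀ r, Differentiable ℝ (B r)) :
    ∃ (D : ℝ → V) (C₁ β₀ : ℝ), 0 ≤ C₁ ∧ 0 < β₀ ∧
      (∀ β, 0 < β → β ≤ β₀ → ∀ v, t₀ ≤ v → v ≤ T → ‖quot x X β v‖ ≤ C₁) ∧
      ∀ t ∈ Ioc t₀ T, Tendsto (fun β => quot x X β t) (𝓝[>] 0) (𝓝 (D t)) := by
  obtain ⟨C₁, β₀, τ₁, hC₁, hβ₀, hβ₀T, hτ₁, H₁, H₂, H₃⟩ :=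
    hX.exists_quot_sub_bound hΓ hκ hκ2 hC hK hτ ht₀ htT
  have hM := hX.drift.nonneg
  have hxc := hX.sol.continuousOn hΓ hX.drift hκ hκ2 hK hτ ht₀ le_rfl
  have hXc := fun β =>
    (hX.sol_spike β).continuousOn hΓ (hX.drift_spike β) hκ hκ2 hK hτ ht₀ le_rfl
  set w := B' t₀ (x t₀) - B t₀ (x t₀) with hw
  have hend := tendsto_iff_norm_sub_tendsto_zero.mp
    (hX.tendsto_quot_end hΓ hκ hκ2 hC hK hτ ht₀ htT hB hB')
  have hN := tendsto_integral_driftError hX.drift hd htT.le hxc hXc hC₁ hβ₀ H₁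
  obtain ⟨n, hn⟩ := exists_nat_ge ((T - t₀) / τ₁)
  rw [div_le_iff₀ hτ₁] at hn
  set N : ℝ × ℝ → ℝ := fun p => ∫ r in t₀..T, ‖driftError B x X p.1 p.2 r‖ with hNdef
  set C₃ := C₁ + M * C₁ + C * C₁ with hC₃
  -- The distances to the common limit `w` at the two spike ends, the Hölder cost of moving from the
  -- earlier end to the later, and the linearisation errors; `2 ^ n` is the growth over `n` windows.
  set R : ℝ × ℝ → ℝ := fun p => 2 ^ n * (‖quot x X p.1 (t₀ + p.1) - w‖
    + ‖quot x X p.2 (t₀ + p.2) - w‖ + C₃ * p.1 ^ κ + quotError κ (2 * M * C₁) (N p) p.1) with hR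
  have hpow : ∀ {ι : Type} {l : Filter ι} {f : ι → ℝ}, Tendsto f l (𝓝 0) → ∀ {p : ℝ}, 0 < p →
      Tendsto (fun i => f i ^ p) l (𝓝 0) := by
    intro ι l f hf p hp
    have := hf.rpow_const (p := p) (Or.inr hp.le)
    rwa [Real.zero_rpow hp.ne'] at this
  have hfst : Tendsto (fun p : ℝ × ℝ => p.1) (𝓝[>] 0 ×ˢ 𝓝[>] 0) (𝓝 0) :=
    tendsto_fst.mono_right nhdsWithin_le_nhds
  have hRlim : Tendsto R (𝓝[>] 0 ×ˢ 𝓝[>] 0) (𝓝 0) := by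
    have h1 := hend.comp (tendsto_fst (f := 𝓝[>] (0 : ℝ)) (g := 𝓝[>] (0 : ℝ)))
    have h2 := hend.comp (tendsto_snd (f := 𝓝[>] (0 : ℝ)) (g := 𝓝[>] (0 : ℝ)))
    have h3 := (hpow hfst (p := κ) (by linarith)).const_mul C₃
    have h4 := (hpow hN (p := 1 / 3) (by norm_num)).const_mul ((2 * M * C₁) ^ (2 / 3 : ℝ))
    have h5 := hpow hfst (p := 3 / 4 * (κ - 1 / 3)) (by linarith)
    have h6 := (((h1.add h2).add h3).add ((h4.add hfst).add h5)).const_mul (2 ^ n : ℝ)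
    simp only [mul_zero, add_zero] at h6
    exact h6
  have hmain : ∀ t, t ≤ T → ∀ β β', 0 < β' → β' ≤ β → β ≤ β₀ → β ≤ τ₁ → t₀ + β ≤ t →
      ‖quot x X β t - quot x X β' t‖ ≤ R (β, β') := by
    intro t ht β β' hβ' hββ' hββ₀ hβτ hβt
    have hβ : 0 < β := by linarith
    have hN0 : 0 ≤ N (β, β') := intervalIntegral.integral_nonneg htT.le fun r _ => norm_nonneg _
    have hq0 : 0 ≤ quotError κ (2 * M * C₁) (N (β, β')) β := by
      rw [quotError]
      positivity
    have h1 := le_of_windows (f := fun r => ‖quot x X β r - quot x X β' r‖) hτ₁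
      (H₃ β β' hβ' hββ' hββ₀ (N (β, β')) le_rfl) n t hβt ht (by linarith) (by positivity) hq0
    refine h1.trans ?_
    rw [hR]
    refine mul_le_mul_of_nonneg_left (add_le_add ?_ le_rfl) (by positivity)
    have h2 := H₂ β' hβ' (hββ'.trans hββ₀) (t₀ + β') (t₀ + β) le_rfl (by linarith) (by linarith)
      (by linarith)
    have h3 : C₃ * (t₀ + β - (t₀ + β')) ^ κ ≤ C₃ * β ^ κ := by
      refine mul_le_mul_of_nonneg_left (Real.rpow_le_rpow ?_ ?_ ?_) (by positivity) <;> linarith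
    -- The comparison starts at `t₀ + β`, the later of the two ends, where both states follow the
    -- unperturbed equation.
    have e : quot x X β (t₀ + β) - quot x X β' (t₀ + β) = (quot x X β (t₀ + β) - w)
        - (quot x X β' (t₀ + β') - w) - (quot x X β' (t₀ + β) - quot x X β' (t₀ + β')) := by abel
    simp only [e]
    exact (norm_sub_le _ _).trans (add_le_add (norm_sub_le _ _) (h2.trans h3))
  have hcauchy : ∀ t ∈ Ioc t₀ T, ∃ z, Tendsto (fun β => quot x X β t) (𝓝[>] 0) (𝓝 z) := by
    intro t ht
    refine cauchy_map_iff_exists_tendsto.mp (cauchy_map_iff'.mpr ?_)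
    refine tendsto_uniformity_iff_dist_tendsto_zero.mpr ?_
    -- `R` treats only `β' ≤ β`; adding the swapped value covers both orders of the pair.
    have hsum : Tendsto (fun p : ℝ × ℝ => |R p| + |R p.swap|) (𝓝[>] 0 ×ˢ 𝓝[>] 0) (𝓝 0) := by
      simpa using hRlim.abs.add (hRlim.comp tendsto_prod_swap).abs
    refine squeeze_zero' (Eventually.of_forall fun p => dist_nonneg) ?_ hsum
    have hmin : 0 < min β₀ (min τ₁ (t - t₀)) :=
      lt_min hβ₀ (lt_min hτ₁ (by linarith [ht.1]))
    have hev : ∀ᶠ β : ℝ in 𝓝[>] 0, 0 < β ∧ β ≤ min β₀ (min τ₁ (t - t₀)) := Ioc_mem_nhdsGT hmin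
    filter_upwards [hev.prod_mk hev] with p hp
    have hlt : ∀ β, β ≤ min β₀ (min τ₁ (t - t₀)) → β ≤ β₀ ∧ β ≤ τ₁ ∧ t₀ + β ≤ t := fun β h =>
      ⟨h.trans (min_le_left _ _), h.trans ((min_le_right _ _).trans (min_le_left _ _)),
        by linarith [h.trans ((min_le_right _ _).trans (min_le_right _ _))]⟩
    obtain ⟨a1, a2, a3⟩ := hlt _ hp.1.2
    obtain ⟨b1, b2, b3⟩ := hlt _ hp.2.2
    rw [dist_eq_norm]
    rcases le_total p.2 p.1 with h | h
    · have := hmain t ht.2 p.1 p.2 hp.2.1 h a1 a2 a3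
      linarith [le_abs_self (R p), abs_nonneg (R p.swap)]
    · have := hmain t ht.2 p.2 p.1 hp.1.1 h b1 b2 b3
      rw [norm_sub_rev]
      have h2 : R p.swap ≤ |R p| + |R p.swap| := by
        linarith [le_abs_self (R p.swap), abs_nonneg (R p)]
      exact this.trans h2
  choose! D hD using hcauchy
  exact ⟨D, C₁, β₀, hC₁, hβ₀, H₁, hD⟩

end SpikeCauchy

/-! ### Differentiation of the reward along the perturbed states. -/

section Reward

variable {V : Type*} [NormedAddCommGroup V] [NormedSpace ℝ V]
  {t₀ T C₁ β₀ L : ℝ} {x : ℝ → V} {X : ℝ → ℝ → V}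

/-- A chain rule for a convergent direction: the directions are eventually bounded, so the Fréchet
error is uniform along them. -/
lemma tendsto_quotient_comp {W : Type*} [NormedAddCommGroup W] [NormedSpace ℝ W] {f : V → W}
    {r : ℝ} {D : V} (hf : DifferentiableAt ℝ f (x r))
    (hD : Tendsto (fun β => quot x X β r) (𝓝[>] 0) (𝓝 D)) :
    Tendsto (fun β : ℝ => β⁻¹ • (f (X β r) - f (x r))) (𝓝[>] 0) (𝓝 (fderiv ℝ f (x r) D)) := by
  have h1 : Tendsto (fun β => fderiv ℝ f (x r) (quot x X β r)) (𝓝[>] 0)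
      (𝓝 (fderiv ℝ f (x r) D)) := ((fderiv ℝ f (x r)).continuous.tendsto D).comp hD
  have h2 : Tendsto (fun β : ℝ => β⁻¹ • (f (X β r) - f (x r)) - fderiv ℝ f (x r) (quot x X β r))
      (𝓝[>] 0) (𝓝 0) := by
    refine Metric.tendsto_nhds.mpr fun η hη => ?_
    have hb : ∀ᶠ β in 𝓝[>] 0, ‖quot x X β r‖ < ‖D‖ + 1 :=
      hD.norm.eventually (gt_mem_nhds (by linarith))
    filter_upwards [eventually_norm_quotient_sub_le hf (c := η / 2) (C₁ := ‖D‖ + 1) (by linarith)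
      (by positivity), hb, self_mem_nhdsWithin] with β g1 g2 (g3 : 0 < β)
    have := g1 _ g2.le
    rw [add_smul_quot x X g3] at this
    rw [dist_zero_right]
    linarith
  simpa using h2.add h1

lemma tendsto_average {g : ℝ → ℝ → ℝ} {c : ℝ}
    (hint : ∀ᶠ β in 𝓝[>] 0, IntervalIntegrable (g β) volume t₀ (t₀ + β))
    (hg : ∀ η : ℝ, 0 < η → ∀ᶠ β in 𝓝[>] 0, ∀ r, t₀ ≤ r → r ≤ t₀ + β → |g β r - c| ≤ η) :
    Tendsto (fun β : ℝ => β⁻¹ * ∫ r in t₀..(t₀ + β), g β r) (𝓝[>] 0) (𝓝 c) := by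
  refine Metric.tendsto_nhds.mpr fun η hη => ?_
  filter_upwards [hint, hg (η / 2) (by linarith), self_mem_nhdsWithin] with β h1 h2 (h3 : 0 < β)
  have e : β⁻¹ * (∫ r in t₀..(t₀ + β), g β r) - c = β⁻¹ * ∫ r in t₀..(t₀ + β), (g β r - c) := by
    rw [intervalIntegral.integral_sub h1 intervalIntegrable_const,
      intervalIntegral.integral_const, add_sub_cancel_left, smul_eq_mul]
    field_simp
  have h4 := intervalIntegral.norm_integral_le_of_norm_le_const (a := t₀) (b := t₀ + β)
    (C := η / 2) (f := fun r => g β r - c) fun r hr => by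
      rw [uIoc_of_le (by linarith)] at hr
      exact h2 r hr.1.le hr.2
  rw [add_sub_cancel_left, abs_of_pos h3] at h4
  rw [Real.dist_eq, e, abs_mul, abs_inv, abs_of_pos h3, inv_mul_lt_iff₀ h3]
  refine h4.trans_lt ?_
  nlinarith

lemma tendsto_spike_average {f : ℝ → V → ℝ} (htT : t₀ < T) (hx : ContinuousOn x (Icc t₀ T))
    (hX : ∀ β, ContinuousOn (X β) (Icc t₀ T)) (hβ₀ : 0 < β₀) (hL : 0 ≤ L)
    (hq : ∀ β, 0 < β → β ≤ β₀ → ∀ v, t₀ ≤ v → v ≤ T → ‖quot x X β v‖ ≤ C₁)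
    (hfc : ∀ z, ContinuousOn z (Icc t₀ T) → ContinuousOn (fun r => f r (z r)) (Icc t₀ T))
    (hlip : ∀ r ∈ Icc t₀ T, ∀ z z', |f r z' - f r z| ≤ L * ‖z' - z‖) :
    Tendsto (fun β : ℝ => β⁻¹ * ∫ r in t₀..(t₀ + β), f r (X β r)) (𝓝[>] 0)
      (𝓝 (f t₀ (x t₀))) := by
  have hsmall : ∀ c : ℝ, 0 < c → ∀ᶠ β : ℝ in 𝓝[>] 0, 0 < β ∧ β ≤ c := fun c hc =>
    Ioc_mem_nhdsGT hc
  refine tendsto_average ?_ fun η hη => ?_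
  · filter_upwards [hsmall (T - t₀) (by linarith)] with β hβ
    refine ((hfc _ (hX β)).mono ?_).intervalIntegrable
    rw [uIcc_of_le (by linarith)]
    exact Icc_subset_Icc le_rfl (by linarith)
  · have h1 : Tendsto (fun r => f r (x r)) (𝓝[≥] t₀) (𝓝 (f t₀ (x t₀))) :=
      (hfc x hx t₀ ⟨le_rfl, htT.le⟩).mono_of_mem_nhdsWithin (Icc_mem_nhdsGE htT)
    have h1' := Metric.tendsto_nhds.mp h1 (η / 2) (by linarith)
    obtain ⟨ρ, hρ, hball⟩ := mem_nhdsGE_iff_exists_Icc_subset.mp h1'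
    have h2 : Tendsto (fun β : ℝ => L * (C₁ * β)) (𝓝[>] 0) (𝓝 0) := by
      have : Continuous fun β : ℝ => L * (C₁ * β) := by fun_prop
      simpa using (this.tendsto 0).mono_left nhdsWithin_le_nhds
    filter_upwards [hsmall (T - t₀) (by linarith), hsmall (ρ - t₀) (sub_pos.mpr hρ),
      hsmall β₀ hβ₀, h2.eventually (gt_mem_nhds (by linarith : 0 < η / 2))] with β g1 g2 g3 g4 r
      g5 g6
    have hr : r ∈ Icc t₀ T := ⟨g5, by linarith⟩
    have k1 : |f r (x r) - f t₀ (x t₀)| < η / 2 := hball ⟨g5, by linarith⟩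
    have k2 := hlip r hr (x r) (X β r)
    have k3 : ‖X β r - x r‖ ≤ C₁ * β := by
      have := hq β g3.1 g3.2 r hr.1 hr.2
      rwa [quot, norm_smul, norm_inv, Real.norm_of_nonneg g3.1.le, inv_mul_le_iff₀ g3.1,
        mul_comm] at this
    have k4 : L * ‖X β r - x r‖ ≤ L * (C₁ * β) := mul_le_mul_of_nonneg_left k3 hL
    have := abs_add_le (f r (X β r) - f r (x r)) (f r (x r) - f t₀ (x t₀))
    rw [sub_add_sub_cancel] at this
    linarith

/-- Differentiation of a reward along a family of paths. -/
theorem tendsto_reward_quotient {f h : ℝ → V → ℝ} {G : V → ℝ} {D : ℝ → V} (htT : t₀ < T)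
    (hx : ContinuousOn x (Icc t₀ T)) (hX : ∀ β, ContinuousOn (X β) (Icc t₀ T)) (hβ₀ : 0 < β₀)
    (hL : 0 ≤ L)
    (hq : ∀ β, 0 < β → β ≤ β₀ → ∀ v, t₀ ≤ v → v ≤ T → ‖quot x X β v‖ ≤ C₁)
    (hD : ∀ t ∈ Ioc t₀ T, Tendsto (fun β => quot x X β t) (𝓝[>] 0) (𝓝 (D t)))
    (hfc : ∀ z, ContinuousOn z (Icc t₀ T) → ContinuousOn (fun r => f r (z r)) (Icc t₀ T))
    (hhc : ∀ z, ContinuousOn z (Icc t₀ T) → ContinuousOn (fun r => h r (z r)) (Icc t₀ T))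
    (hlip : ∀ r ∈ Icc t₀ T, ∀ z z', |f r z' - f r z| ≤ L * ‖z' - z‖)
    (hlip' : ∀ r ∈ Icc t₀ T, ∀ z z', |h r z' - h r z| ≤ L * ‖z' - z‖)
    (hd : ∀ r ∈ Icc t₀ T, Differentiable ℝ (f r))
    (hG : DifferentiableAt ℝ G (x T)) :
    IntervalIntegrable (fun r => fderiv ℝ (f r) (x r) (D r)) volume t₀ T ∧
      Tendsto (fun β : ℝ => ((∫ s in t₀..(t₀ + β), h s (X β s)) + (∫ s in (t₀ + β)..T, f s (X β s))
        + G (X β T) - ((∫ s in t₀..T, f s (x s)) + G (x T))) / β) (𝓝[>] 0)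
        (𝓝 (h t₀ (x t₀) - f t₀ (x t₀) + (∫ s in t₀..T, fderiv ℝ (f s) (x s) (D s))
          + fderiv ℝ G (x T) (D T))) := by
  have hsmall : ∀ c : ℝ, 0 < c → ∀ᶠ β : ℝ in 𝓝[>] 0, 0 < β ∧ β ≤ c := fun c hc =>
    Ioc_mem_nhdsGT hc
  have hint : ∀ (g : ℝ → V → ℝ),
      (∀ z, ContinuousOn z (Icc t₀ T) → ContinuousOn (fun r => g r (z r)) (Icc t₀ T)) →
      ∀ z, ContinuousOn z (Icc t₀ T) → ∀ u v, u ∈ Icc t₀ T → v ∈ Icc t₀ T →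
      IntervalIntegrable (fun r => g r (z r)) volume u v := fun g hg z hz u v hu hv =>
    ((hg z hz).mono (uIcc_subset_Icc hu hv)).intervalIntegrable
  have h1 := tendsto_spike_average htT hx hX hβ₀ hL hq hhc hlip'
  have h2 := tendsto_spike_average htT hx hX hβ₀ hL hq hfc hlip
  have hpt : ∀ r ∈ Ioc t₀ T, Tendsto (fun β : ℝ => β⁻¹ • (f r (X β r) - f r (x r))) (𝓝[>] 0)
      (𝓝 (fderiv ℝ (f r) (x r) (D r))) := fun r hr =>
    tendsto_quotient_comp (hd r ⟨hr.1.le, hr.2⟩ _) (hD r hr)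
  have hbound : ∀ β, 0 < β → β ≤ β₀ → ∀ r ∈ Ioc t₀ T,
      ‖β⁻¹ • (f r (X β r) - f r (x r))‖ ≤ L * C₁ := by
    intro β hβ hββ r hr
    have k1 := hlip r ⟨hr.1.le, hr.2⟩ (x r) (X β r)
    have k2 := hq β hβ hββ r hr.1.le hr.2
    rw [quot, norm_smul, norm_inv, Real.norm_of_nonneg hβ.le, inv_mul_le_iff₀ hβ] at k2
    rw [norm_smul, norm_inv, Real.norm_of_nonneg hβ.le, inv_mul_le_iff₀ hβ, Real.norm_eq_abs]
    calc _ ≤ L * (β * C₁) := k1.trans (mul_le_mul_of_nonneg_left k2 hL)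
      _ = _ := by ring
  have hmeas : ∀ β : ℝ, AEStronglyMeasurable (fun r => β⁻¹ • (f r (X β r) - f r (x r)))
      (volume.restrict (Ioc t₀ T)) := fun β =>
    ((((hfc _ (hX β)).sub (hfc _ hx)).const_smul β⁻¹).mono Ioc_subset_Icc_self).aestronglyMeasurable
      measurableSet_Ioc
  have h3 : Tendsto (fun β : ℝ => ∫ r in t₀..T, β⁻¹ • (f r (X β r) - f r (x r))) (𝓝[>] 0)
      (𝓝 (∫ r in t₀..T, fderiv ℝ (f r) (x r) (D r))) := by
    -- The Lipschitz bound of `f` and the bound on the quotients dominate. The limit at `t₀` is not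
    -- known, and the integral does not see it.
    refine intervalIntegral.tendsto_integral_filter_of_dominated_convergence (fun _ => L * C₁)
      (Eventually.of_forall fun β => ?_) ?_ intervalIntegrable_const
      (Eventually.of_forall fun r hr => ?_)
    · rw [uIoc_of_le htT.le]
      exact hmeas β
    · filter_upwards [hsmall β₀ hβ₀] with β hβ
      refine Eventually.of_forall fun r hr => ?_
      rw [uIoc_of_le htT.le] at hr
      exact hbound β hβ.1 hβ.2 r hr
    · rw [uIoc_of_le htT.le] at hr
      exact hpt r hr
  have h4 := tendsto_quotient_comp hG (hD T ⟨htT, le_rfl⟩)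
  refine ⟨?_, ?_⟩
  · rw [intervalIntegrable_iff, uIoc_of_le htT.le]
    have hlim : ∀ᵐ r ∂(volume.restrict (Ioc t₀ T)),
        Tendsto (fun β : ℝ => β⁻¹ • (f r (X β r) - f r (x r))) (𝓝[>] 0)
          (𝓝 (fderiv ℝ (f r) (x r) (D r))) := by
      filter_upwards [ae_restrict_mem measurableSet_Ioc] with r hr using hpt r hr
    -- No regularity of `D` in time is known; measurability of the integrand is inherited from the
    -- quotients.
    refine Integrable.of_bound (aestronglyMeasurable_of_tendsto_ae (𝓝[>] (0 : ℝ)) hmeas hlim)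
      (L * C₁) ?_
    filter_upwards [ae_restrict_mem measurableSet_Ioc] with r hr
    refine le_of_tendsto (hpt r hr).norm ?_
    filter_upwards [hsmall β₀ hβ₀] with β hβ using hbound β hβ.1 hβ.2 r hr
  -- Adding and subtracting the integral of `f` along `X β` over the spike leaves the average of `h
  -- - f` plus a difference over all of `[t₀, T]`.
  · refine (((h1.sub h2).add h3).add h4).congr' ?_
    filter_upwards [hsmall (T - t₀) (by linarith)] with β hβ
    have hm : t₀ + β ∈ Icc t₀ T := ⟨by linarith, by linarith⟩
    have ht : t₀ ∈ Icc t₀ T := ⟨le_rfl, htT.le⟩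
    have hT : T ∈ Icc t₀ T := ⟨htT.le, le_rfl⟩
    have e1 : ∫ r in t₀..T, β⁻¹ • (f r (X β r) - f r (x r))
        = β⁻¹ * ((∫ r in t₀..T, f r (X β r)) - ∫ r in t₀..T, f r (x r)) := by
      rw [intervalIntegral.integral_smul, intervalIntegral.integral_sub
        (hint f hfc _ (hX β) _ _ ht hT) (hint f hfc _ hx _ _ ht hT), smul_eq_mul]
    have e2 := intervalIntegral.integral_add_adjacent_intervals
      (hint f hfc _ (hX β) _ _ ht hm) (hint f hfc _ (hX β) _ _ hm hT)
    rw [e1, ← e2, smul_eq_mul, div_eq_inv_mul]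
    ring

end Reward

/-! ### Continuity in time and Lipschitz bound of the running reward. -/

section RunningReward

variable {m : ℕ} {X V : Type*} [PseudoEMetricSpace X] [MeasurableSpace X] [NormedAddCommGroup V]
  {T : ℝ} {S : Set (ProbabilityMeasure X)}

lemma ContinuousW2.continuousOn {Φ : ℝ → E m → ProbabilityMeasure X → V}
    (hΦ : ContinuousW2 T S Φ) {A : Set ℝ} (hA : A ⊆ Icc 0 T) {z : ℝ → E m}
    (hz : ContinuousOn z A) {ν : ℝ → ProbabilityMeasure X} (hνS : ∀ r ∈ A, ν r ∈ S)
    (hν : ∀ s ∈ A, Tendsto (fun r => W2 (ν s) (ν r)) (𝓝[A] s) (𝓝 0)) :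
    ContinuousOn (fun r => Φ r (z r) (ν r)) A := by
  intro s hs
  refine Metric.tendsto_nhds.mpr fun η hη => ?_
  obtain ⟨δ, hδ, h⟩ := hΦ s (hA hs) (z s) (ν s) (hνS s hs) η hη
  filter_upwards [self_mem_nhdsWithin, nhdsWithin_le_nhds (Metric.ball_mem_nhds s hδ),
    Metric.tendsto_nhds.mp (hz s hs) δ hδ,
    (hν s hs).eventually (gt_mem_nhds (ENNReal.ofReal_pos.mpr hδ))] with r h1 h2 h3 h4
  rw [dist_eq_norm]
  rw [dist_eq_norm] at h3
  exact h r (hA h1) (z r) (ν r) (hνS r h1) h2 h3 h4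

lemma IsRunningReward.exists_lip {F : ℝ → E m → ProbabilityMeasure X → ℝ}
    (hF : IsRunningReward T S F) : ∃ L : ℝ, 0 ≤ L ∧ ∀ r ∈ Icc 0 T, ∀ ν ∈ S, ∀ z z',
      |F r z' ν - F r z ν| ≤ L * ‖z' - z‖ := by
  obtain ⟨L, hL⟩ := hF.bounded_space
  refine ⟨|L|, abs_nonneg L, fun r hr ν hν z z' => ?_⟩
  exact convex_univ.norm_image_sub_le_of_norm_fderiv_le (𝕜 := ℝ) (f := fun z => F r z ν)
    (fun y _ => hF.differentiable_space r hr ν hν y)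
    (fun y _ => (hL r hr y ν hν).trans (le_abs_self L)) (mem_univ z) (mem_univ z')

end RunningReward

/-! ### Rough solutions and local expansions are equivalent. -/

section Solution

variable {m d k : ℕ} {κ K τ R C M M' T t₀ : ℝ} {ζ : ℝ → E d}
  {ζ2 : ℝ → ℝ → Matrix (Fin d) (Fin d) ℝ} {σ : ℝ → E m → E d →L[ℝ] E m} {U : Set (E k)}
  {b : ℝ → E m → E k → E m} {γ : ℝ → ProbabilityMeasure U} {x x' : ℝ → E m} {y : E m}

lemma rpow_add_le_mul_rpow {l p q : ℝ} (hl : 0 ≤ l) (hlT : l ≤ T) (hp : 0 ≤ p) (hq : 0 ≤ q) :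
    l ^ (p + q) ≤ T ^ q * l ^ p := by
  rw [Real.rpow_add_of_nonneg hl hp hq, mul_comm]
  gcongr

lemma integral_driftField (ht₀ : 0 ≤ t₀) {u v : ℝ} (h1 : t₀ ≤ u) (h2 : u ≤ v) (h3 : v ≤ T) :
    ∫ r in u..v, driftField T b γ r (x r) = ∫ r in u..v, relaxedDrift b r (x r) (γ r) := by
  refine intervalIntegral.integral_congr fun r hr => ?_
  rw [uIcc_of_le h2] at hr
  exact driftField_of_mem ⟨by linarith [hr.1], hr.2.trans h3⟩ _

/-- A path with the local expansion of a solution is a solution. -/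
lemma RDEBound.isRDESolution (hx : RDEBound κ K τ (germ σ ζ ζ2) (driftField T b γ) t₀ T x)
    (hζ : IsDriver κ R T ζ ζ2) (hσ : IsRegular M T σ)
    (hΓ : IsGerm κ C T (germ σ ζ ζ2) (germLin σ ζ ζ2)) (hB : IsDriftField M' (driftField T b γ))
    (hR : 0 ≤ R) (hM : 0 ≤ M) (hκ : 1 / 3 < κ) (hκ2 : κ ≤ 1 / 2) (hC : 0 ≤ C) (hK : 0 ≤ K)
    (hτ : 0 < τ) (ht₀ : 0 ≤ t₀) (htT : t₀ < T) (hxy : x t₀ = y) :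
    IsRDESolution κ T ζ ζ2 b σ γ t₀ y x := by
  have hM' := hB.nonneg
  have hT : 0 < T := ht₀.trans_lt htT
  have hxc := hx.continuousOn hΓ hB hκ hκ2 hK hτ ht₀ le_rfl
  obtain ⟨N, hN⟩ := isCompact_Icc.exists_bound_of_continuousOn hxc
  have hN0 : 0 ≤ N := (norm_nonneg _).trans (hN t₀ ⟨le_rfl, htT.le⟩)
  have hdiff : ∀ u v, t₀ ≤ u → u ≤ v → v ≤ T → ‖x v - x u‖ ≤ N + N := fun u v h1 h2 h3 =>
    (norm_sub_le _ _).trans (add_le_add (hN v ⟨h1.trans h2, h3⟩) (hN u ⟨h1, h2.trans h3⟩))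
  have hlen : ∀ {u v : ℝ}, t₀ ≤ u → u ≤ v → v ≤ T → 0 ≤ v - u ∧ v - u ≤ T :=
    fun h1 h2 h3 => ⟨by linarith, by linarith⟩
  -- The expansion is local but the definition of a solution asks for bounds on all of `[t₀, T]`;
  -- boundedness of the quantities bridges the gap.
  obtain ⟨H, hH⟩ := exists_global_bound (g := fun u v => x v - x u) (a := t₀) (b := T)
    (τ := min τ 1) (p := κ) (K := M' + K + C) (N := N + N) (lt_min hτ one_pos) (by linarith)
    (by positivity) (by positivity) (fun u v h1 h2 h3 h4 => hx.holder hΓ hB hκ hκ2 hK ht₀ le_rfl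
      h1 h2 h3 (h4.trans (min_le_left _ _)) (h4.trans (min_le_right _ _))) hdiff
  obtain ⟨P, hP⟩ := exists_global_bound
    (g := fun u v => x v - x u - (∫ r in u..v, driftField T b γ r (x r)) - germ σ ζ ζ2 u v (x u))
    (a := t₀) (b := T) (τ := τ) (p := 3 * κ) (K := K) (N := N + N + M' * T + C * T ^ κ) hτ
    (by linarith) hK (by positivity) hx (fun u v h1 h2 h3 => by
      obtain ⟨hl0, hlT⟩ := hlen h1 h2 h3
      refine (norm_sub_le _ _).trans (add_le_add ((norm_sub_le _ _).trans (add_le_add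
        (hdiff u v h1 h2 h3) ((hB.norm_integral_le x h2).trans (by gcongr)))) ?_)
      refine (hΓ.bound u v (ht₀.trans h1) h2 h3 _).trans ?_
      have hκ0 : 0 ≤ κ := by linarith
      gcongr)
  have hint : ∀ u v, u ∈ Icc t₀ T → v ∈ Icc t₀ T →
      IntervalIntegrable (fun r => driftField T b γ r (x r)) volume u v :=
    fun u v hu hv => hB.intervalIntegrable hxc hu hv
  have ht₀m : t₀ ∈ Icc t₀ T := ⟨le_rfl, htT.le⟩
  -- The rough integral is taken to be what is left of `x` after the initial value and the drift.
  refine ⟨⟨⟨H, hH⟩, ⟨M * T ^ (1 - κ) + M * H, fun u v h1 h2 h3 => ?_⟩,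
    ⟨|P| * T ^ κ + M' * T ^ (1 - 2 * κ) + R * M ^ 2, fun u v h1 h2 h3 => ?_⟩⟩, ?_,
    fun t => x t - y - ∫ r in t₀..t, driftField T b γ r (x r), ⟨?_, P, fun u v h1 h2 h3 => ?_⟩, ?_⟩
  · obtain ⟨hl0, hlT⟩ := hlen h1 h2 h3
    have e : σ v (x v) - σ u (x u) = (σ v (x v) - σ u (x v)) + (σ u (x v) - σ u (x u)) := by abel
    have k1 := hσ.time u v (ht₀.trans h1) h2 h3 (x v)
    have k2 := hσ.lip (ht₀.trans h1) (h2.trans h3) (x u) (x v)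
    have k3 := rpow_add_le_mul_rpow hl0 hlT (p := κ) (q := 1 - κ) (by linarith) (by linarith)
    rw [add_sub_cancel, Real.rpow_one] at k3
    rw [e]
    calc _ ≤ M * (v - u) + M * ‖x v - x u‖ := (norm_add_le _ _).trans (add_le_add k1 k2)
      _ ≤ M * (T ^ (1 - κ) * (v - u) ^ κ) + M * (H * (v - u) ^ κ) := by
        have := hH u v h1 h2 h3
        gcongr
      _ = _ := by ring
  · obtain ⟨hl0, hlT⟩ := hlen h1 h2 h3
    have e : x v - x u - σ u (x u) (ζ v - ζ u)
        = (x v - x u - (∫ r in u..v, driftField T b γ r (x r)) - germ σ ζ ζ2 u v (x u))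
          + (∫ r in u..v, driftField T b γ r (x r))
          + contract (secondCoef σ u (x u)) (ζ2 u v) := by
      rw [germ]
      abel
    have k1 := hP u v h1 h2 h3
    have k2 := hB.norm_integral_le x h2
    have k3 := hζ.contract_le (ht₀.trans h1) h2 h3
      (hσ.secondCoef_bound (ht₀.trans h1) (h2.trans h3) (x u)) hR
    have k4 := rpow_add_le_mul_rpow hl0 hlT (p := 2 * κ) (q := 1 - 2 * κ) (by linarith)
      (by linarith)
    rw [add_sub_cancel, Real.rpow_one] at k4
    have k5 := rpow_add_le_mul_rpow hl0 hlT (p := 2 * κ) (q := κ) (by linarith) (by linarith)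
    rw [show 2 * κ + κ = 3 * κ by ring] at k5
    rw [e]
    calc _ ≤ P * (v - u) ^ (3 * κ) + M' * (v - u) + R * (v - u) ^ (2 * κ) * M ^ 2 :=
          (norm_add_le _ _).trans (add_le_add ((norm_add_le _ _).trans (add_le_add k1 k2)) k3)
      _ ≤ |P| * (T ^ κ * (v - u) ^ (2 * κ)) + M' * (T ^ (1 - 2 * κ) * (v - u) ^ (2 * κ))
          + R * (v - u) ^ (2 * κ) * M ^ 2 := by
        have := le_abs_self P
        gcongr
      _ = _ := by ring
  · refine (hint t₀ T ht₀m ⟨htT.le, le_rfl⟩).congr fun r hr => ?_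
    rw [uIoc_of_le htT.le] at hr
    exact driftField_of_mem ⟨by linarith [hr.1], hr.2⟩ _
  · simp [hxy]
  · have e := intervalIntegral.integral_add_adjacent_intervals
      (hint t₀ u ht₀m ⟨h1, h2.trans h3⟩) (hint u v ⟨h1, h2.trans h3⟩ ⟨h1.trans h2, h3⟩)
    refine le_of_eq_of_le (congrArg norm ?_) (hP u v h1 h2 h3)
    simp only [← e, germ, secondCoef]
    abel
  · intro t ht
    beta_reduce
    rw [integral_driftField ht₀ le_rfl ht.1 ht.2]
    abel

/-- A solution has the local expansion of a solution. -/
lemma IsRDESolution.exists_rdeBound (hx : IsRDESolution κ T ζ ζ2 b σ γ t₀ y x) (ht₀ : 0 ≤ t₀)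
    (htT : t₀ ≤ T) : x t₀ = y ∧
      ∃ P : ℝ, RDEBound κ P 1 (germ σ ζ ζ2) (driftField T b γ) t₀ T x := by
  obtain ⟨z, ⟨hz0, P, hP⟩, hz⟩ := hx.equation
  -- The expansion holds for all lengths, so the window size `1` is arbitrary.
  refine ⟨by simpa [hz0] using hz t₀ ⟨le_rfl, htT⟩, P, fun u v h1 h2 h3 _ => ?_⟩
  have hsub : ∀ p q, t₀ ≤ p → p ≤ q → q ≤ T →
      IntervalIntegrable (fun r => relaxedDrift b r (x r) (γ r)) volume p q := fun p q g1 g2 g3 =>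
    hx.integrable.mono_set (by
      rw [uIcc_of_le g2, uIcc_of_le htT]
      exact Icc_subset_Icc g1 g3)
  have e := intervalIntegral.integral_add_adjacent_intervals
    (hsub t₀ u le_rfl h1 (h2.trans h3)) (hsub u v h1 h2 h3)
  refine le_of_eq_of_le (congrArg norm ?_) (hP u v h1 h2 h3)
  rw [integral_driftField ht₀ h1 h2 h3, eq_sub_of_add_eq' (hz v ⟨h1.trans h2, h3⟩).symm,
    eq_sub_of_add_eq' (hz u ⟨h1, h2.trans h3⟩).symm, ← e]
  simp only [germ, secondCoef]
  abel

/-- A competing solution satisfies the same expansion with constants of its own, which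
`RDEBound.eqOn` allows. -/
lemma RDEBound.isUniqueRDESolution
    (hx : RDEBound κ K τ (germ σ ζ ζ2) (driftField T b γ) t₀ T x)
    (hζ : IsDriver κ R T ζ ζ2) (hσ : IsRegular M T σ)
    (hΓ : IsGerm κ C T (germ σ ζ ζ2) (germLin σ ζ ζ2)) (hB : IsDriftField M' (driftField T b γ))
    (hR : 0 ≤ R) (hM : 0 ≤ M) (hκ : 1 / 3 < κ) (hκ2 : κ ≤ 1 / 2) (hC : 0 ≤ C) (hK : 0 ≤ K)
    (hτ : 0 < τ) (ht₀ : 0 ≤ t₀) (htT : t₀ < T) (hxy : x t₀ = y) :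
    IsUniqueRDESolution κ T ζ ζ2 b σ γ t₀ y x := by
  refine ⟨hx.isRDESolution hζ hσ hΓ hB hR hM hκ hκ2 hC hK hτ ht₀ htT hxy, fun x' hx' => ?_⟩
  obtain ⟨h0, P, hP⟩ := hx'.exists_rdeBound ht₀ htT.le
  exact hx.eqOn hΓ hκ hκ2 hC hB ht₀ le_rfl hτ one_pos hP (h0.trans hxy.symm)

lemma IsDrift.continuousWithinAt_driftField (hb : IsDrift T U b) (hγ : ContinuousOn γ (Icc 0 T))
    (ht₀ : 0 ≤ t₀) (htT : t₀ < T) (x : E m) :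
    ContinuousWithinAt (fun r => driftField T b γ r x) (Ici t₀) t₀ := by
  have h1 : ContinuousOn (fun r => driftField T b γ r x) (Icc 0 T) :=
    (hb.continuousOn_relaxedDrift hγ x).congr fun r hr => driftField_of_mem hr x
  exact ((h1 t₀ ⟨ht₀, htT.le⟩).mono (Icc_subset_Icc_left ht₀)).mono_of_mem_nhdsWithin
    (Icc_mem_nhdsGE htT)

end Solution

end RoughControl

/-! ### The infinitesimal `Q`-function. -/

theorem mainTheorem3 {m d k : ℕ} (T α κ ε L : ℝ) (hT : 0 < T)
    (hα : 1 / 3 < α) (hκ : 1 / 3 < κ) (hκα : κ < α) (hκ2 : κ ≤ 1 / 2)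
    (hε : 0 < ε) (hL : 0 < L)
    -- the geometric rough path
    (ζ : ℝ → E d) (ζ2 : ℝ → ℝ → Matrix (Fin d) (Fin d) ℝ)
    (hζ : IsGeometricRoughPath α T ζ ζ2)
    -- the control space, the compact set of relaxed controls, and the coefficients
    (U : Set (E k)) (K : Set (ProbabilityMeasure U)) (hK : IsCompact K)
    (b : ℝ → E m → E k → E m) (hb : IsDrift T U b)
    (σ : ℝ → E m → E d →L[ℝ] E m) (hσ : IsDiffusion T σ)
    -- the strategy, the perturbing measure and the initial data
    (γ : ℝ → ProbabilityMeasure U) (hγ : IsRelaxedControl T ε L K γ)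
    (μ : ProbabilityMeasure U) (t₀ : ℝ) (ht₀ : t₀ ∈ Set.Ico 0 T) (y : E m)
    -- the rewards
    (F : ℝ → E m → ProbabilityMeasure U → ℝ) (hF : IsRunningReward T (insert μ K) F)
    (G : E m → ℝ) (hG : IsTerminalReward G) :
    ∃ (x : ℝ → E m) (xhat : ℝ → ℝ → E m) (V : ℝ → E m),
      -- the state controlled by `γ` and the states controlled by the spike variations
      IsUniqueRDESolution κ T ζ ζ2 b σ γ t₀ y x ∧
      (∀ β ∈ Set.Ioc 0 (T - t₀),
        IsUniqueRDESolution κ T ζ ζ2 b σ (spike γ μ t₀ β) t₀ y (xhat β)) ∧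
      -- `V` is the right derivative at `β = 0` of the perturbed state
      (∀ t ∈ Set.Ioc t₀ T,
        Tendsto (fun β : ℝ => β⁻¹ • (xhat β t - x t)) (𝓝[>] 0) (𝓝 (V t))) ∧
      -- the integrals in the rewards and in the `q`-function converge
      IntervalIntegrable (fun s => F s (x s) (γ s)) volume t₀ T ∧
      (∀ β ∈ Set.Ioc 0 (T - t₀),
        IntervalIntegrable (fun s => F s (xhat β s) μ) volume t₀ (t₀ + β) ∧
        IntervalIntegrable (fun s => F s (xhat β s) (γ s)) volume (t₀ + β) T) ∧
      IntervalIntegrable (fun s => fderiv ℝ (fun x' => F s x' (γ s)) (x s) (V s)) volume t₀ T ∧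
      -- the infinitesimal `Q`-function
      Tendsto
        (fun β : ℝ => (Qreward T F G t₀ β μ γ (xhat β) - reward T F G t₀ γ x) / β)
        (𝓝[>] 0) (𝓝 (qFunction T F G t₀ y μ γ x V)) := by
  obtain ⟨ht0, htT⟩ := ht₀
  have hκ0 : 0 < κ := by linarith
  obtain ⟨R, hR, hζd⟩ := hζ.exists_isDriver hT hκ0 hκα
  obtain ⟨M, hM, hσr⟩ := hσ.exists_isRegular
  obtain ⟨C, hC, hΓ⟩ := hζd.exists_isGerm hσr hR hM hT hκ hκ2
  obtain ⟨M', hM', hB⟩ := hb.exists_isDriftField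
  -- `P` and `τ` are fixed before the drift is chosen, so the expansions of all perturbed states are
  -- uniform in `β`.
  obtain ⟨P, τ, hP, hτ, -, hsol⟩ := hΓ.exists_solution hκ hκ2 hC hM'
  have hγc := hγ.continuousOn hε
  obtain ⟨x, hx0, hx⟩ := hsol _ (hB γ hγc).1 t₀ y ht0 htT
  -- States are built for every real `β`, which keeps the family free of side conditions; only `0 <
  -- β ≤ T - t₀` matters in the conclusion.
  choose X hX0 hX using fun β => hsol _ ((hB γ hγc).2 μ t₀ β) t₀ y ht0 htT
  have hfam : IsSpikeFamily κ P τ M' t₀ T (germ σ ζ ζ2) (driftField T b γ)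
      (driftField T b fun _ => μ) (fun β => driftField T b (spike γ μ t₀ β)) x X := by
    refine ⟨(hB γ hγc).1, (hB γ hγc).2 μ t₀, fun β r z h1 h2 => ?_, fun β r z h => ?_, hx, hX,
      fun β => (hX0 β).trans hx0.symm⟩
    · rw [driftField_spike, piecewise_eq_of_mem _ _ _ (mem_Icc.mpr ⟨h1, h2⟩)]
    · rw [driftField_spike, piecewise_eq_of_notMem _ _ _
        fun h' : r ∈ Icc t₀ (t₀ + β) => not_lt.mpr h'.2 h]
  obtain ⟨D, C₁, β₀, -, hβ₀, hq, hD⟩ := hfam.exists_tendsto_quot hΓ hκ hκ2 hC hP hτ ht0 htT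
    (hb.continuousWithinAt_driftField hγc ht0 htT _)
    (hb.continuousWithinAt_driftField continuousOn_const ht0 htT _)
    (hb.differentiable_driftField γ)
  have hxc := hx.continuousOn hΓ (hB γ hγc).1 hκ hκ2 hP hτ ht0 le_rfl
  have hXc := fun β => (hX β).continuousOn hΓ ((hB γ hγc).2 μ t₀ β) hκ hκ2 hP hτ ht0 le_rfl
  have hsub : Icc t₀ T ⊆ Icc 0 T := Icc_subset_Icc_left ht0
  have hFc : ∀ z : ℝ → E m, ContinuousOn z (Icc t₀ T) →
      ContinuousOn (fun r => F r (z r) (γ r)) (Icc t₀ T) := fun z hz =>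
    hF.continuous.continuousOn hsub hz (fun r hr => mem_insert_of_mem _ (hγ.1 r (hsub hr)))
      fun s hs => (hγ.tendsto_W2 hε (hsub hs)).mono_left (nhdsWithin_mono _ hsub)
  -- On the spike the control is constant in time, so continuity in `W2` reduces to `W2_self`, and
  -- `μ` need not belong to `K`.
  have hFμ : ∀ z : ℝ → E m, ContinuousOn z (Icc t₀ T) →
      ContinuousOn (fun r => F r (z r) μ) (Icc t₀ T) := fun z hz =>
    hF.continuous.continuousOn hsub hz (ν := fun _ => μ) (fun r _ => mem_insert _ _)
      fun s _ => by
        rw [W2_self]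
        exact tendsto_const_nhds
  obtain ⟨L', hL', hlip⟩ := hF.exists_lip
  obtain ⟨hVint, hlim⟩ := tendsto_reward_quotient (f := fun r z => F r z (γ r))
    (h := fun r z => F r z μ) (G := G) htT hxc hXc hβ₀ hL' hq hD hFc hFμ
    (fun r hr => hlip r (hsub hr) _ (mem_insert_of_mem _ (hγ.1 r (hsub hr))))
    (fun r hr => hlip r (hsub hr) _ (mem_insert _ _))
    (fun r hr => hF.differentiable_space r (hsub hr) _
      (mem_insert_of_mem _ (hγ.1 r (hsub hr))))
    (hG.contDiff.differentiable one_ne_zero _)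
  rw [hx0] at hlim
  have hint : ∀ {f : ℝ → ℝ}, ContinuousOn f (Icc t₀ T) → ∀ {u v : ℝ}, u ∈ Icc t₀ T →
      v ∈ Icc t₀ T → IntervalIntegrable f volume u v := fun hf _ _ hu hv =>
    (hf.mono (uIcc_subset_Icc hu hv)).intervalIntegrable
  have hTm : T ∈ Icc t₀ T := ⟨htT.le, le_rfl⟩
  have ht₀m : t₀ ∈ Icc t₀ T := ⟨le_rfl, htT.le⟩
  refine ⟨x, X, D, hx.isUniqueRDESolution hζd hσr hΓ (hB γ hγc).1 hR hM hκ hκ2 hC hP hτ ht0 htT hx0,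
    fun β _ => (hX β).isUniqueRDESolution hζd hσr hΓ ((hB γ hγc).2 μ t₀ β) hR hM hκ hκ2 hC hP hτ
      ht0 htT (hX0 β), hD, hint (hFc x hxc) ht₀m hTm, fun β hβ => ?_, hVint, hlim⟩
  have hm : t₀ + β ∈ Icc t₀ T := ⟨by linarith [hβ.1], by linarith [hβ.2]⟩
  exact ⟨hint (hFμ _ (hXc β)) ht₀m hm, hint (hFc _ (hXc β)) hm hTm⟩
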